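/- Let $p,q$ be real functions on $(0,\infty)$ with $p>0$ and $p,p',q$ continuous, and let $Lx=-(px')'+qx$. $L$ is in the limit-circle case at an endpoint ($0$ or $\infty$) if for some $l_0\in\mathbb C$ every solution of $Lx=l_0x$ on $(0,\infty)$ is square integrable near that endpoint, and in the limit-point case there otherwise. Fix $c>0$ and let $\varphi_1,\varphi_2$ be the solutions of $Lx=lx$ with $\varphi_1(c,l)=1$, $p(c)\varphi_1'(c,l)=0$, $\varphi_2(c,l)=0$, $p(c)\varphi_2'(c,l)=1$. For $\Im l\neq0$ and $r>0$, $r\ne c$, the Weyl circle $C_r(l)$ is the set of all $m\in\mathbb C$ such that $\chi=\varphi_1+m\varphi_2$ satisfies $\cos\beta\,\chi(r)+\sin\beta\,p(r)\chi'(r)=0$ for some $\beta\in[0,\pi)$. For a compact interval $\delta=[a,b]\subset(0,\infty)$ containing $c$ and $\beta,\beta'\in[0,\pi)$ consider the self-adjoint problem $Lx=lx$ on $\delta$, $\cos\beta'\,x(a)+\sin\beta'\,p(a)x'(a)=0$, $\cos\beta\,x(b)+\sin\beta\,p(b)x'(b)=0$. Its spectral matrix $\rho^{(\delta)}=(\rho^{(\delta)}_{jk})_{j,k=1,2}$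 is the right-continuous step function on $\mathbb R$ with $\rho^{(\delta)}(0)=0$ that jumps exactly at the eigenvalues, the jump at an eigenvalue $\lambda$ being $\sum_m\overline{t_{m,j}}\,t_{m,k}$, where $h_m=t_{m,1}\varphi_1(\cdot,\lambda)+t_{m,2}\varphi_2(\cdot,\lambda)$ runs through an $L^2(\delta)$-orthonormal basis of the eigenspace. **Theorem.** Suppose $L$ is in the limit-point case at both $r=0$ and $r=\infty$. Then for every $l$ with $\Im l\ne0$ the circles $C_a(l)$ shrink to a point $m'_\infty(l)$ as $a\to0^+$, the circles $C_b(l)$ shrink to a point $m_\infty(l)$ as $b\to\infty$, and $m'_\infty(l)\neq m_\infty(l)$. There is a function $\rho=(\rho_{jk})$ from $\mathbb R$ to the Hermitian $2\times2$ matrices, nondecreasing (i.e. $\rho(\lambda)-\rho(\mu)$ is positive semidefinite for $\lambda>\mu$), with entries of bounded variation on every finite interval, such that for $j,k=1,2$ and all continuity points $\lambda,\mu$ of $\rho_{jk}$ $$\rho_{jk}(\lambda)-\rho_{jk}(\mu)=\lim_{n\to\infty}\bigl(\rho^{(\delta_n)}_{jk}(\lambda)-\rho^{(\delta_n)}_{jk}(\mu)\bigr)$$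 for every sequence of problems on intervals $\delta_n=[a_n,b_n]\ni c$ with $a_n\to0$, $b_n\to\infty$ and arbitrary boundary parameters $\beta_n,\beta'_n\in[0,\pi)$. The matrix $\rho$ is essentially unique: if $\tilde\rho$ is another nondecreasing Hermitian matrix function with entries of locally bounded variation which is in the above sense the limit of $\rho^{(\delta_n)}$ along some such sequence, then $\tilde\rho_{jk}(\lambda)-\tilde\rho_{jk}(\mu)=\rho_{jk}(\lambda)-\rho_{jk}(\mu)$ at all common continuity points $\lambda,\mu$ of $\rho_{jk}$ and $\tilde\rho_{jk}$. Furthermore, at continuity points $\lambda,\mu$ of $\rho_{jk}$, $$\rho_{jk}(\lambda)-\rho_{jk}(\mu)=\lim_{\varepsilon\to0^+}\frac1\pi\int_\mu^\lambda\Im M_{jk}(\nu+i\varepsilon)\,d\nu ,$$ where the integrand is integrable for every $\varepsilon>0$ and $$M_{11}=\frac{1}{m'_\infty-m_\infty},\qquad M_{12}=M_{21}=\frac12\,\frac{m'_\infty+m_\infty}{m'_\infty-m_\infty},\qquad M_{22}=\frac{m'_\infty m_\infty}{m'_\infty-m_\infty}.$$ -/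

import Mathlib

open Filter Topology MeasureTheory
open scoped ComplexOrder ComplexConjugate

namespace WeylTheory

/-- The quasi-derivative `p x'` of a complex-valued function of a real variable. -/
noncomputable def quasiDeriv (p : ℝ → ℝ) (x : ℝ → ℂ) (r : ℝ) : ℂ :=
  (p r : ℂ) * deriv x r

/-- The differential expression `L x = -(p x')' + q x`. -/
noncomputable def opL (p q : ℝ → ℝ) (x : ℝ → ℂ) (r : ℝ) : ℂ :=
  -deriv (quasiDeriv p x) r + (q r : ℂ) * x r

/-- `x` is a (classical) solution of `L x = l x` on `(0, ∞)`. The values of `x` outside `(0, ∞)`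
play no role. -/
def IsSolution (p q : ℝ → ℝ) (l : ℂ) (x : ℝ → ℂ) : Prop :=
  ∀ r : ℝ, 0 < r → DifferentiableAt ℝ x r ∧ DifferentiableAt ℝ (quasiDeriv p x) r ∧
    opL p q x r = l * x r

/-- Limit-circle case at `∞`: for some complex `l₀` every solution of `L x = l₀ x` is square
summable near `∞`. -/
def LimitCircleAtInfty (p q : ℝ → ℝ) : Prop :=
  ∃ l₀ : ℂ, ∀ x : ℝ → ℂ, IsSolution p q l₀ x →
    ∃ R : ℝ, 0 < R ∧ IntegrableOn (fun r => ‖x r‖ ^ 2) (Set.Ioi R)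

/-- Limit-circle case at `0`: for some complex `l₀` every solution of `L x = l₀ x` is square
summable near `0`. -/
def LimitCircleAtZero (p q : ℝ → ℝ) : Prop :=
  ∃ l₀ : ℂ, ∀ x : ℝ → ℂ, IsSolution p q l₀ x →
    ∃ R : ℝ, 0 < R ∧ IntegrableOn (fun r => ‖x r‖ ^ 2) (Set.Ioo 0 R)

/-- Limit-point case at `∞`: not the limit-circle case. -/
def LimitPointAtInfty (p q : ℝ → ℝ) : Prop := ¬ LimitCircleAtInfty p q

/-- Limit-point case at `0`: not the limit-circle case. -/
def LimitPointAtZero (p q : ℝ → ℝ) : Prop := ¬ LimitCircleAtZero p q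

/-- The solution of `L x = l x` on `(0, ∞)` with Cauchy data `x c = u`, `(p x') c = v`
(it exists and is unique on `(0, ∞)` when `p > 0` is `C¹`, `q` is continuous and `c > 0`). -/
noncomputable def cauchySolution (p q : ℝ → ℝ) (c : ℝ) (l u v : ℂ) : ℝ → ℂ :=
  Classical.epsilon fun x : ℝ → ℂ => IsSolution p q l x ∧ x c = u ∧ quasiDeriv p x c = v

/-- The fundamental system `φ₁ = phi 0`, `φ₂ = phi 1`, normalised at `c` by
`φ₁ = 1`, `p φ₁' = 0`, `φ₂ = 0`, `p φ₂' = 1`. -/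
noncomputable def phi (p q : ℝ → ℝ) (c : ℝ) (j : Fin 2) (l : ℂ) : ℝ → ℂ :=
  cauchySolution p q c l (if j = 0 then 1 else 0) (if j = 1 then 1 else 0)

/-- The solution `t₁ φ₁ + t₂ φ₂` of `L x = l x` with coefficient vector `t`. -/
noncomputable def comb (p q : ℝ → ℝ) (c : ℝ) (l : ℂ) (t : Fin 2 → ℂ) (r : ℝ) : ℂ :=
  ∑ j : Fin 2, t j * phi p q c j l r

/-- The real boundary condition `cos β · x(r) + sin β · p(r) x'(r) = 0`. -/
def BoundaryCondition (p : ℝ → ℝ) (β r : ℝ) (x : ℝ → ℂ) : Prop :=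
  (Real.cos β : ℂ) * x r + (Real.sin β : ℂ) * quasiDeriv p x r = 0

/-- The Weyl circle at the point `r` in the `m`-plane: all `m` for which
`χ = φ₁ + m φ₂` satisfies, for some `β ∈ [0, π)`, the real boundary condition at `r`.
It is `C_b` for `r = b > c`, and `C'_a` for `r = a < c`. -/
def weylCircle (p q : ℝ → ℝ) (c : ℝ) (l : ℂ) (r : ℝ) : Set ℂ :=
  {m | ∃ β ∈ Set.Ico (0 : ℝ) Real.pi, BoundaryCondition p β r (comb p q c l ![1, m])}

/-- The Weyl circles at `r` shrink to the point `m` as `r` tends to an endpoint (along `f`). -/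
def IsWeylLimitPoint (p q : ℝ → ℝ) (c : ℝ) (l : ℂ) (f : Filter ℝ) (m : ℂ) : Prop :=
  ∀ U ∈ 𝓝 m, ∀ᶠ r in f, (weylCircle p q c l r).Nonempty ∧ weylCircle p q c l r ⊆ U

/-- A compact interval `δ = [a, b] ⊂ (0, ∞)` containing `c`, together with the parameters
`β'` (at `a`) and `β` (at `b`) of self-adjoint separated boundary conditions. -/
structure FiniteProblem (c : ℝ) where
  a : ℝ
  b : ℝ
  β' : ℝ
  β : ℝ
  a_pos : 0 < a
  a_le : a ≤ c
  le_b : c ≤ b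
  a_lt_b : a < b
  β'_mem : β' ∈ Set.Ico (0 : ℝ) Real.pi
  β_mem : β ∈ Set.Ico (0 : ℝ) Real.pi

/-- The intervals `δ_n = [a_n, b_n]` tend to `(0, ∞)`. -/
def ExhaustsHalfLine {c : ℝ} (δ : ℕ → FiniteProblem c) : Prop :=
  Tendsto (fun n => (δ n).a) atTop (𝓝 0) ∧ Tendsto (fun n => (δ n).b) atTop atTop

/-- The coefficient vectors `t` for which `t₁ φ₁(·, s) + t₂ φ₂(·, s)` satisfies both boundary
conditions of the problem, i.e. the eigenspace for the real number `s` (zero included) written in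
the basis `φ₁, φ₂`; it is `{0}` if `s` is not an eigenvalue. -/
def eigenCoeffs (p q : ℝ → ℝ) {c : ℝ} (δ : FiniteProblem c) (s : ℝ) : Set (Fin 2 → ℂ) :=
  {t | BoundaryCondition p δ.β' δ.a (comb p q c s t) ∧
       BoundaryCondition p δ.β δ.b (comb p q c s t)}

/-- `t 0, …, t (d - 1)` are the coefficient vectors of an `L²(a, b)`-orthonormal basis
`h_m = t_{m,1} φ₁ + t_{m,2} φ₂` of the eigenspace for `s`. -/
def IsOrthonormalEigenbasis (p q : ℝ → ℝ) {c : ℝ} (δ : FiniteProblem c) (s : ℝ) (d : ℕ)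
    (t : Fin d → Fin 2 → ℂ) : Prop :=
  (∀ m, t m ∈ eigenCoeffs p q δ s) ∧
  (∀ m m', ∫ r in δ.a..δ.b, comb p q c s (t m) r * conj (comb p q c s (t m') r) =
    if m = m' then 1 else 0) ∧
  (∀ v ∈ eigenCoeffs p q δ s, v ∈ Submodule.span ℂ (Set.range t))

/-- The jump `∑_m conj(t_{m,j}) t_{m,k}` of the spectral matrix at `s`, the sum being over an
orthonormal basis of the eigenspace for `s` (the sum does not depend on the basis, and is `0` when
`s` is not an eigenvalue). -/
noncomputable def spectralJump (p q : ℝ → ℝ) {c : ℝ} (δ : FiniteProblem c) (s : ℝ) :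
    Matrix (Fin 2) (Fin 2) ℂ :=
  Classical.epsilon fun S => ∃ (d : ℕ) (t : Fin d → Fin 2 → ℂ),
    IsOrthonormalEigenbasis p q δ s d t ∧ ∀ j k, S j k = ∑ m, conj (t m j) * t m k

/-- The spectral matrix `ρ^(δ)` of the finite problem: the right-continuous step function with
`ρ^(δ)(0) = 0` which jumps by `spectralJump` at the eigenvalues (finitely many in every bounded
interval). -/
noncomputable def finiteSpectralMatrix (p q : ℝ → ℝ) {c : ℝ} (δ : FiniteProblem c) (x : ℝ) :
    Matrix (Fin 2) (Fin 2) ℂ :=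
  Matrix.of fun j k =>
    if 0 ≤ x then ∑ᶠ s ∈ Set.Ioc 0 x, spectralJump p q δ s j k
    else -∑ᶠ s ∈ Set.Ioc x 0, spectralJump p q δ s j k

/-- Hermitian, nondecreasing matrix functions with entries of bounded variation on every
bounded interval. -/
structure IsSpectralMatrix (ρ : ℝ → Matrix (Fin 2) (Fin 2) ℂ) : Prop where
  hermitian : ∀ x, (ρ x).IsHermitian
  nondecreasing : ∀ ⦃x y : ℝ⦄, x < y → (ρ y - ρ x).PosSemidef
  boundedVariation : ∀ j k, LocallyBoundedVariationOn (fun x => ρ x j k) Set.univ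

/-- `ρ` is the limit of the spectral matrices of the problems `δ n`: the increments of the
entries converge, at all continuity points of the respective entry of `ρ`. -/
def IsLimitOfFinite (p q : ℝ → ℝ) {c : ℝ} (δ : ℕ → FiniteProblem c)
    (ρ : ℝ → Matrix (Fin 2) (Fin 2) ℂ) : Prop :=
  ∀ (j k : Fin 2) (x y : ℝ), ContinuousAt (fun s => ρ s j k) x →
    ContinuousAt (fun s => ρ s j k) y →
    Tendsto (fun n => finiteSpectralMatrix p q (δ n) x j k -
      finiteSpectralMatrix p q (δ n) y j k) atTop (𝓝 (ρ x j k - ρ y j k))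

/-- The matrix `M` built from the limit point `m'` at `0` and the limit point `m` at `∞`. -/
noncomputable def matrixM (m' m : ℂ) : Matrix (Fin 2) (Fin 2) ℂ :=
  !![1 / (m' - m), (1 / 2) * ((m' + m) / (m' - m));
     (1 / 2) * ((m' + m) / (m' - m)), m' * m / (m' - m)]

end WeylTheory

/-!
The theorem holds because `Im M(ν + i ε)` is, up to a limit, a Poisson integral of the spectral
matrices of the finite problems, and Poisson integrals determine their measures.

**Limit points.** On the circle `C_r` one has `∫_c^r |χ|² = Im m / Im l`
(`integral_eq_of_mem_weylCircle`), so `C_r` lies in a compact disk, and these disks are nested. Two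
different points common to all disks would make all solutions square integrable near the endpoint;
hence in the limit-point case, already at the given `l`, the disks shrink to a point
(`exists_isWeylLimitPoint`). The same identity gives `Im m_∞ / Im l > 0 > Im m'_∞ / Im l`, so the
two limit points differ.

**Finite problems.** Let `m' ∈ C_a`, `m ∈ C_b` belong to the boundary conditions of the problem on
`[a, b]`. Green's function with pole at `c` and its quasi-derivative in the pole are vectors of
`L²(a, b)` with Gram matrix `Im M / Im l` and with Fourier coefficients `t_j / (s - l)` with respect
to the normalized eigenfunctions (`exists_greenVec`). The eigenfunctions are complete, by the
spectral theorem for the compact resolvent at a real point (`orthogonal_span_eigLp`). Parseval's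
identity therefore expresses `Im M` as the Poisson integral of the spectral matrix
(`hasSum_im_matrixM`). When the intervals exhaust `(0, ∞)`, the left side converges, because `m'`
and `m` tend to the limit points.

**Stieltjes inversion.** Smearing a test function by the Poisson kernel changes its integral against
the spectral matrix by an error that is uniform in the sequence of problems
(`poissonIntegral_approx`). So convergence of the Poisson integrals yields vague convergence of the
spectral matrices, to a limit that depends on `Im M` alone and is also the vague limit of
`Im M(ν + i ε) / π` as `ε → 0` (`PoissonApprox.exists_limit`). The limit is represented by measures
(Riesz–Markov–Kakutani), whose distribution functions form `ρ`.

**Endpoints.** Passing from test functions to intervals requires control at the endpoints. For a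
diagonal entry of `ρ`, continuity at the endpoint suffices. Continuity of the off-diagonal entry
alone says nothing, in general, about the mass that the diagonal entries put there; but
`det (Im M) = -Im m_∞ · Im m'_∞ / |m'_∞ - m_∞|² ≤ 1 / 4` (`im_matrixM_det_le`) forces the jumps of
`ρ` to have rank at most one (`mul_eq_zero_of_form_le`). Hence, where `ρ₁₂` is continuous, at least
one of `ρ₁₁`, `ρ₂₂` is continuous too, and a weighted Cauchy–Schwarz inequality near the endpoint
makes this enough (`tendsto_setIntegral_Ioc`).
-/


namespace WeylTheory

/-! ### Linear differential equations on the half-line -/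

section

/-- The Picard iterates of the linear equation `X' = A X` with `X c = x₀`, split into the terms of
the series whose sum is the solution. -/
noncomputable def picardTerm {E : Type*} [NormedAddCommGroup E] [NormedSpace ℝ E]
    (A : ℝ → E →L[ℝ] E) (c : ℝ) (x₀ : E) : ℕ → ℝ → E
  | 0 => fun _ => x₀
  | n + 1 => fun r => ∫ t in c..r, A t (picardTerm A c x₀ n t)

section Picard

variable {E : Type*} [NormedAddCommGroup E] [NormedSpace ℝ E] [CompleteSpace E]
  {A : ℝ → E →L[ℝ] E} {c : ℝ} {x₀ : E}

lemma hasDerivAt_integral_of_continuousOn {f : ℝ → E} (hf : ContinuousOn f (Set.Ioi 0))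
    (hc : 0 < c) {r : ℝ} (hr : 0 < r) : HasDerivAt (fun x => ∫ t in c..x, f t) (f r) r := by
  have hsub : Set.uIcc c r ⊆ Set.Ioi 0 := fun t ht =>
    lt_of_lt_of_le (lt_min hc hr) ht.1
  refine intervalIntegral.integral_hasDerivAt_right ((hf.mono hsub).intervalIntegrable) ?_
    (hf.continuousAt (Ioi_mem_nhds hr))
  exact hf.stronglyMeasurableAtFilter isOpen_Ioi r hr

lemma continuousOn_picardTerm (hA : ContinuousOn A (Set.Ioi 0)) (hc : 0 < c) (n : ℕ) :
    ContinuousOn (picardTerm A c x₀ n) (Set.Ioi 0) := by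
  induction n with
  | zero => exact continuousOn_const
  | succ n ih => exact fun r hr =>
      (hasDerivAt_integral_of_continuousOn (hA.clm_apply ih) hc hr).continuousAt.continuousWithinAt

lemma hasDerivAt_picardTerm (hA : ContinuousOn A (Set.Ioi 0)) (hc : 0 < c) (n : ℕ) {r : ℝ}
    (hr : 0 < r) :
    HasDerivAt (picardTerm A c x₀ (n + 1)) (A r (picardTerm A c x₀ n r)) r :=
  hasDerivAt_integral_of_continuousOn (hA.clm_apply (continuousOn_picardTerm hA hc n)) hc hr

lemma norm_picardTerm_le (hA : ContinuousOn A (Set.Ioi 0)) {a b K : ℝ} (ha : 0 < a)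
    (hc : c ∈ Set.Icc a b) (hK : ∀ t ∈ Set.Icc a b, ‖A t‖ ≤ K) (n : ℕ) :
    ∀ r ∈ Set.Icc a b, ‖picardTerm A c x₀ n r‖ ≤ ‖x₀‖ * ((K * |r - c|) ^ n / n.factorial) := by
  have hK0 : 0 ≤ K := (norm_nonneg _).trans (hK c hc)
  induction n with
  | zero => intro r _; simp [picardTerm]
  | succ n ih =>
    intro r hr
    have hsub : Set.uIoc c r ⊆ Set.Icc a b :=
      Set.uIoc_subset_uIcc.trans (Set.uIcc_subset_Icc hc hr)
    have hcont : ContinuousOn (fun t => A t (picardTerm A c x₀ n t)) (Set.uIcc c r) :=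
      (hA.clm_apply (continuousOn_picardTerm hA (ha.trans_le hc.1) n)).mono fun t ht =>
        ha.trans_le (Set.uIcc_subset_Icc hc hr ht).1
    calc ‖picardTerm A c x₀ (n + 1) r‖
        ≤ ∫ t in Set.uIoc c r, ‖A t (picardTerm A c x₀ n t)‖ :=
          intervalIntegral.norm_integral_le_integral_norm_uIoc
      _ ≤ ∫ t in Set.uIoc c r, ‖x₀‖ * (K ^ (n + 1) / n.factorial) * |t - c| ^ n := by
          refine setIntegral_mono_on ?_ ?_ measurableSet_uIoc fun t ht => ?_
          · exact (hcont.norm.integrableOn_uIcc).mono_set Set.uIoc_subset_uIcc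
          · exact (Continuous.integrableOn_uIcc (by fun_prop)).mono_set Set.uIoc_subset_uIcc
          · calc ‖A t (picardTerm A c x₀ n t)‖ ≤ ‖A t‖ * ‖picardTerm A c x₀ n t‖ :=
                  (A t).le_opNorm _
              _ ≤ K * (‖x₀‖ * ((K * |t - c|) ^ n / n.factorial)) := by
                  gcongr
                  · exact hK t (hsub ht)
                  · exact ih t (hsub ht)
              _ = _ := by ring
      _ = ‖x₀‖ * ((K * |r - c|) ^ (n + 1) / (n + 1).factorial) := by
          rw [integral_const_mul, integral_pow_abs_sub_uIoc, Nat.factorial_succ]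
          push_cast
          have : (n.factorial : ℝ) ≠ 0 := by positivity
          have : (n : ℝ) + 1 ≠ 0 := by positivity
          rw [mul_pow]
          field_simp

/-- Global existence for linear equations on `(0, ∞)`, with the Grönwall bound on compact
intervals in both directions. -/
theorem exists_linear_ode (hA : ContinuousOn A (Set.Ioi 0)) (hc : 0 < c) (x₀ : E) :
    ∃ X : ℝ → E, X c = x₀ ∧ (∀ r, 0 < r → HasDerivAt X (A r (X r)) r) ∧
      ∀ a b K : ℝ, 0 < a → c ∈ Set.Icc a b → (∀ t ∈ Set.Icc a b, ‖A t‖ ≤ K) →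
        ∀ r ∈ Set.Icc a b, ‖X r‖ ≤ ‖x₀‖ * Real.exp (K * |r - c|) := by
  have hsum : ∀ a b K : ℝ, 0 < a → c ∈ Set.Icc a b → (∀ t ∈ Set.Icc a b, ‖A t‖ ≤ K) →
      ∀ r ∈ Set.Icc a b, Summable fun n => picardTerm A c x₀ n r := fun a b K ha hcab hK r hr =>
    Summable.of_norm_bounded ((Real.summable_pow_div_factorial _).mul_left _)
      fun n => norm_picardTerm_le hA ha hcab hK n r hr
  have hbd : ∀ a b : ℝ, 0 < a → ∃ K, ∀ t ∈ Set.Icc a b, ‖A t‖ ≤ K := fun a b ha =>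
    isCompact_Icc.exists_bound_of_continuousOn (hA.mono fun t ht => ha.trans_le ht.1)
  refine ⟨fun r => ∑' n, picardTerm A c x₀ n r, ?_, fun r hr => ?_, fun a b K ha hcab hK r hr => ?_⟩
  · change ∑' n, picardTerm A c x₀ n c = x₀
    rw [tsum_eq_single 0]
    · rfl
    · intro n hn
      obtain ⟨m, rfl⟩ := Nat.exists_eq_succ_of_ne_zero hn
      simp [picardTerm]
  · obtain ⟨a, ha, har, hac⟩ : ∃ a, 0 < a ∧ a < r ∧ a < c :=
      ⟨min r c / 2, by positivity, by have := min_le_left r c; linarith [lt_min hr hc],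
        by have := min_le_right r c; linarith [lt_min hr hc]⟩
    set b := max r c + 1
    have hrb : r < b := by have := le_max_left r c; simp only [b]; linarith
    have hcb : c < b := by have := le_max_right r c; simp only [b]; linarith
    obtain ⟨K, hK⟩ := hbd a b ha
    have hcab : c ∈ Set.Icc a b := ⟨hac.le, hcb.le⟩
    have hK0 : 0 ≤ K := (norm_nonneg _).trans (hK c hcab)
    have hshift : ∀ z ∈ Set.Icc a b,
        ∑' n, picardTerm A c x₀ n z = x₀ + ∑' n, picardTerm A c x₀ (n + 1) z := fun z hz =>
      (hsum a b K ha hcab hK z hz).tsum_eq_zero_add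
    have hu : Summable fun n : ℕ => K * (‖x₀‖ * ((K * (b - a)) ^ n / n.factorial)) :=
      ((Real.summable_pow_div_factorial (K * (b - a))).mul_left ‖x₀‖).mul_left K
    have hd : HasDerivAt (fun z => ∑' n, picardTerm A c x₀ (n + 1) z)
        (∑' n, A r (picardTerm A c x₀ n r)) r := by
      refine hasDerivAt_tsum_of_isPreconnected
        (g := fun n => picardTerm A c x₀ (n + 1)) (g' := fun n z => A z (picardTerm A c x₀ n z))
        hu isOpen_Ioo isPreconnected_Ioo
        (fun n z hz => hasDerivAt_picardTerm hA hc n (ha.trans hz.1)) (fun n z hz => ?_)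
        (y₀ := c) ⟨hac, hcb⟩ ?_ ⟨har, hrb⟩
      · have hz' := Set.Ioo_subset_Icc_self hz
        calc ‖A z (picardTerm A c x₀ n z)‖ ≤ ‖A z‖ * ‖picardTerm A c x₀ n z‖ := (A z).le_opNorm _
          _ ≤ K * (‖x₀‖ * ((K * |z - c|) ^ n / n.factorial)) := by
            gcongr
            · exact hK z hz'
            · exact norm_picardTerm_le hA ha hcab hK n z hz'
          _ ≤ _ := by
            gcongr
            rw [abs_le]; constructor <;> linarith [hz.1, hz.2]
      · simp [picardTerm]
    rw [← (A r).map_tsum (hsum a b K ha hcab hK r ⟨har.le, hrb.le⟩)] at hd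
    refine (hd.const_add x₀).congr_of_eventuallyEq ?_
    filter_upwards [Ioo_mem_nhds har hrb] with z hz
    exact hshift z (Set.Ioo_subset_Icc_self hz)
  · have h := (Real.summable_pow_div_factorial (K * |r - c|)).mul_left ‖x₀‖
    refine (tsum_of_norm_bounded h.hasSum
      fun n => norm_picardTerm_le hA ha hcab hK n r hr).trans_eq ?_
    rw [tsum_mul_left, Real.exp_eq_exp_ℝ, NormedSpace.exp_eq_tsum_div]

end Picard

end

/-! ### The first-order system, the Wronskian and the fundamental system -/

section

/-- Positivity and continuity of the coefficients on `(0, ∞)`; the smoothness of `p` is never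
needed because equations are written in terms of the quasi-derivative. -/
structure Coeffs (p q : ℝ → ℝ) : Prop where
  pos : ∀ r : ℝ, 0 < r → 0 < p r
  cont_p : ContinuousOn p (Set.Ioi 0)
  cont_q : ContinuousOn q (Set.Ioi 0)

/-- `L x = l x` on `S`, written as a first-order system for `x` and its quasi-derivative `v`. -/
def Sys (p q : ℝ → ℝ) (l : ℂ) (S : Set ℝ) (x v : ℝ → ℂ) : Prop :=
  ∀ r ∈ S, HasDerivAt x (v r / p r) r ∧ HasDerivAt v ((q r - l) * x r) r

/-- The Wronskian of two functions with quasi-derivatives `v₁`, `v₂`. -/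
def wr (x₁ v₁ x₂ v₂ : ℝ → ℂ) (r : ℝ) : ℂ := x₁ r * v₂ r - v₁ r * x₂ r

variable {p q : ℝ → ℝ} {l l₁ l₂ : ℂ} {S : Set ℝ} {x v x₁ v₁ x₂ v₂ : ℝ → ℂ} {c : ℝ}

lemma Sys.mono {S' : Set ℝ} (h : Sys p q l S x v) (hS : S' ⊆ S) : Sys p q l S' x v :=
  fun r hr => h r (hS hr)

lemma Sys.add (h₁ : Sys p q l S x₁ v₁) (h₂ : Sys p q l S x₂ v₂) :
    Sys p q l S (fun r => x₁ r + x₂ r) (fun r => v₁ r + v₂ r) := fun r hr =>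
  ⟨((h₁ r hr).1.add (h₂ r hr).1).congr_deriv (by ring),
    ((h₁ r hr).2.add (h₂ r hr).2).congr_deriv (by ring)⟩

lemma Sys.const_mul (h : Sys p q l S x v) (t : ℂ) :
    Sys p q l S (fun r => t * x r) (fun r => t * v r) := fun r hr =>
  ⟨((h r hr).1.const_mul t).congr_deriv (by ring),
    ((h r hr).2.const_mul t).congr_deriv (by ring)⟩

lemma Sys.conj (h : Sys p q l S x v) :
    Sys p q (conj l) S (fun r => conj (x r)) (fun r => conj (v r)) := fun r hr =>
  ⟨((h r hr).1.star).congr_deriv (by simp [Complex.conj_ofReal]),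
    ((h r hr).2.star).congr_deriv (by simp [Complex.conj_ofReal])⟩

lemma Sys.continuousOn (h : Sys p q l S x v) : ContinuousOn x S ∧ ContinuousOn v S :=
  ⟨fun r hr => (h r hr).1.continuousAt.continuousWithinAt,
    fun r hr => (h r hr).2.continuousAt.continuousWithinAt⟩

lemma Sys.quasiDeriv_eq (h : Sys p q l S x v) {r : ℝ} (hr : r ∈ S) (hp : 0 < p r) :
    quasiDeriv p x r = v r := by
  rw [quasiDeriv, (h r hr).1.deriv]
  have : (p r : ℂ) ≠ 0 := by exact_mod_cast hp.ne'
  field_simp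

lemma Sys.isSolution (hC : Coeffs p q) (h : Sys p q l (Set.Ioi 0) x v) : IsSolution p q l x := by
  intro r hr
  have he : quasiDeriv p x =ᶠ[𝓝 r] v := by
    filter_upwards [Ioi_mem_nhds hr] with s hs using h.quasiDeriv_eq hs (hC.pos s hs)
  have hd := (h r hr).2.congr_of_eventuallyEq he
  refine ⟨(h r hr).1.differentiableAt, hd.differentiableAt, ?_⟩
  rw [opL, hd.deriv]
  ring

lemma IsSolution.sys (hC : Coeffs p q) (h : IsSolution p q l x) :
    Sys p q l (Set.Ioi 0) x (quasiDeriv p x) := by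
  intro r hr
  obtain ⟨h1, h2, h3⟩ := h r hr
  have : (p r : ℂ) ≠ 0 := by exact_mod_cast (hC.pos r hr).ne'
  refine ⟨h1.hasDerivAt.congr_deriv (by rw [quasiDeriv]; field_simp),
    h2.hasDerivAt.congr_deriv ?_⟩
  rw [opL] at h3
  linear_combination -h3

lemma hasDerivAt_wr (hp : ∀ r ∈ S, 0 < p r) (h₁ : Sys p q l₁ S x₁ v₁) (h₂ : Sys p q l₂ S x₂ v₂)
    {r : ℝ} (hr : r ∈ S) : HasDerivAt (wr x₁ v₁ x₂ v₂) ((l₁ - l₂) * (x₁ r * x₂ r)) r := by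
  have : (p r : ℂ) ≠ 0 := by exact_mod_cast (hp r hr).ne'
  refine (((h₁ r hr).1.mul (h₂ r hr).2).sub ((h₁ r hr).2.mul (h₂ r hr).1)).congr_deriv ?_
  field_simp
  ring

/-- Lagrange's identity. -/
lemma mul_integral_eq_wr_sub (hp : ∀ r ∈ S, 0 < p r) (h₁ : Sys p q l₁ S x₁ v₁)
    (h₂ : Sys p q l₂ S x₂ v₂) {a b : ℝ} (hab : Set.uIcc a b ⊆ S) :
    (l₁ - l₂) * ∫ r in a..b, x₁ r * x₂ r = wr x₁ v₁ x₂ v₂ b - wr x₁ v₁ x₂ v₂ a := by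
  rw [← intervalIntegral.integral_const_mul]
  refine intervalIntegral.integral_eq_sub_of_hasDerivAt
    (fun r hr => hasDerivAt_wr hp h₁ h₂ (hab hr)) (ContinuousOn.intervalIntegrable ?_)
  exact continuousOn_const.mul ((h₁.continuousOn.1.mono hab).mul (h₂.continuousOn.1.mono hab))

lemma wr_const (hp : ∀ r ∈ S, 0 < p r) (h₁ : Sys p q l S x₁ v₁)
    (h₂ : Sys p q l S x₂ v₂) {a b : ℝ} (hab : Set.uIcc a b ⊆ S) :
    wr x₁ v₁ x₂ v₂ b = wr x₁ v₁ x₂ v₂ a := by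
  have := mul_integral_eq_wr_sub hp h₁ h₂ hab
  rw [sub_self, zero_mul] at this
  exact (sub_eq_zero.mp this.symm)

/-- Existence of solutions with given Cauchy data, with an a priori bound that is locally uniform
in the spectral parameter. -/
theorem exists_sys (hC : Coeffs p q) (hc : 0 < c) (l u w : ℂ) :
    ∃ x v : ℝ → ℂ, Sys p q l (Set.Ioi 0) x v ∧ x c = u ∧ v c = w ∧
      ∀ a b K : ℝ, 0 < a → c ∈ Set.Icc a b →
        (∀ t ∈ Set.Icc a b, 1 / p t + ‖(q t : ℂ) - l‖ ≤ K) →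
        ∀ r ∈ Set.Icc a b, ‖x r‖ ≤ max ‖u‖ ‖w‖ * Real.exp (K * |r - c|) := by
  set B₁ : ℂ × ℂ →L[ℝ] ℂ × ℂ :=
    (ContinuousLinearMap.inl ℝ ℂ ℂ).comp (ContinuousLinearMap.snd ℝ ℂ ℂ)
  set B₂ : ℂ × ℂ →L[ℝ] ℂ × ℂ :=
    (ContinuousLinearMap.inr ℝ ℂ ℂ).comp (ContinuousLinearMap.fst ℝ ℂ ℂ)
  have hB₁ : ‖B₁‖ ≤ 1 := ContinuousLinearMap.opNorm_le_bound _ zero_le_one fun z => by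
    simp [B₁, Prod.norm_def]
  have hB₂ : ‖B₂‖ ≤ 1 := ContinuousLinearMap.opNorm_le_bound _ zero_le_one fun z => by
    simp [B₂, Prod.norm_def]
  set A : ℝ → ℂ × ℂ →L[ℝ] ℂ × ℂ := fun r => (1 / p r) • B₁ + ((q r : ℂ) - l) • B₂ with hAdef
  have hA : ContinuousOn A (Set.Ioi 0) := by
    have he : A = fun r => (1 / p r) • B₁ + (q r • B₂ - l • B₂) := by
      funext r
      ext z <;> simp [A, sub_mul]
    rw [he]
    have hp' : ContinuousOn (fun r => 1 / p r) (Set.Ioi 0) :=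
      continuousOn_const.div hC.cont_p fun r hr => (hC.pos r hr).ne'
    have h1 : ContinuousOn (fun r => (1 / p r) • B₁) (Set.Ioi 0) :=
      hp'.smul (g := fun _ => B₁) continuousOn_const
    have h2 : ContinuousOn (fun r => q r • B₂) (Set.Ioi 0) :=
      hC.cont_q.smul (g := fun _ => B₂) continuousOn_const
    exact h1.add (h2.sub continuousOn_const)
  have hAn : ∀ r, 0 < r → ‖A r‖ ≤ 1 / p r + ‖(q r : ℂ) - l‖ := fun r hr => by
    refine (norm_add_le _ _).trans (add_le_add ?_ ?_)
    · rw [norm_smul, Real.norm_of_nonneg (one_div_nonneg.mpr (hC.pos r hr).le)]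
      exact mul_le_of_le_one_right (one_div_nonneg.mpr (hC.pos r hr).le) hB₁
    · rw [norm_smul]
      exact mul_le_of_le_one_right (norm_nonneg _) hB₂
  obtain ⟨X, hX0, hX, hXb⟩ := exists_linear_ode hA hc (u, w)
  refine ⟨fun r => (X r).1, fun r => (X r).2, fun r hr => ?_, by simp [hX0], by simp [hX0],
    fun a b K ha hcab hK r hr => ?_⟩
  · have h1 := (ContinuousLinearMap.fst ℝ ℂ ℂ).hasFDerivAt.comp_hasDerivAt r (hX r hr)
    have h2 := (ContinuousLinearMap.snd ℝ ℂ ℂ).hasFDerivAt.comp_hasDerivAt r (hX r hr)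
    refine ⟨h1.congr_deriv ?_, h2.congr_deriv ?_⟩
    · simp [A, B₁, B₂, div_eq_inv_mul]
    · simp [A, B₁, B₂]
  · have := hXb a b K ha hcab (fun t ht => (hAn t (ha.trans_le ht.1)).trans (hK t ht)) r hr
    exact (norm_fst_le _).trans this

lemma cauchySolution_spec (hC : Coeffs p q) (hc : 0 < c) (l u w : ℂ) :
    IsSolution p q l (cauchySolution p q c l u w) ∧ cauchySolution p q c l u w c = u ∧
      quasiDeriv p (cauchySolution p q c l u w) c = w := by
  apply Classical.epsilon_spec (p := fun x : ℝ → ℂ =>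
    IsSolution p q l x ∧ x c = u ∧ quasiDeriv p x c = w)
  obtain ⟨x, v, h, hu, hw, -⟩ := exists_sys hC hc l u w
  exact ⟨x, h.isSolution hC, hu, by rw [h.quasiDeriv_eq hc (hC.pos c hc), hw]⟩

lemma phi_sys (hC : Coeffs p q) (hc : 0 < c) (j : Fin 2) (l : ℂ) :
    Sys p q l (Set.Ioi 0) (phi p q c j l) (quasiDeriv p (phi p q c j l)) :=
  (cauchySolution_spec hC hc l _ _).1.sys hC

lemma phi_self (hC : Coeffs p q) (hc : 0 < c) (j : Fin 2) (l : ℂ) :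
    phi p q c j l c = (if j = 0 then 1 else 0) ∧
      quasiDeriv p (phi p q c j l) c = (if j = 1 then 1 else 0) :=
  (cauchySolution_spec hC hc l _ _).2

lemma comb_eq (t : Fin 2 → ℂ) (r : ℝ) :
    comb p q c l t r = t 0 * phi p q c 0 l r + t 1 * phi p q c 1 l r := by
  simp [comb]

lemma comb_sys' (hC : Coeffs p q) (hc : 0 < c) (l : ℂ) (t : Fin 2 → ℂ) :
    Sys p q l (Set.Ioi 0) (comb p q c l t) (fun r => t 0 * quasiDeriv p (phi p q c 0 l) r +
      t 1 * quasiDeriv p (phi p q c 1 l) r) := by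
  have := ((phi_sys hC hc 0 l).const_mul (t 0)).add ((phi_sys hC hc 1 l).const_mul (t 1))
  have he : comb p q c l t = fun r => t 0 * phi p q c 0 l r + t 1 * phi p q c 1 l r :=
    funext fun r => comb_eq t r
  rwa [he]

lemma comb_sys (hC : Coeffs p q) (hc : 0 < c) (l : ℂ) (t : Fin 2 → ℂ) :
    Sys p q l (Set.Ioi 0) (comb p q c l t) (quasiDeriv p (comb p q c l t)) :=
  ((comb_sys' hC hc l t).isSolution hC).sys hC

lemma quasiDeriv_comb (hC : Coeffs p q) (hc : 0 < c) (l : ℂ) (t : Fin 2 → ℂ) {r : ℝ}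
    (hr : 0 < r) : quasiDeriv p (comb p q c l t) r =
      t 0 * quasiDeriv p (phi p q c 0 l) r + t 1 * quasiDeriv p (phi p q c 1 l) r :=
  (comb_sys' hC hc l t).quasiDeriv_eq hr (hC.pos r hr)

lemma comb_self (hC : Coeffs p q) (hc : 0 < c) (l : ℂ) (t : Fin 2 → ℂ) :
    comb p q c l t c = t 0 ∧ quasiDeriv p (comb p q c l t) c = t 1 := by
  rw [quasiDeriv_comb hC hc l t hc, comb_eq]
  simp [phi_self hC hc]

lemma wr_phi (hC : Coeffs p q) (hc : 0 < c) (l : ℂ) {r : ℝ} (hr : 0 < r) :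
    phi p q c 0 l r * quasiDeriv p (phi p q c 1 l) r -
      quasiDeriv p (phi p q c 0 l) r * phi p q c 1 l r = 1 := by
  have := wr_const hC.pos (phi_sys hC hc 0 l) (phi_sys hC hc 1 l) (a := c) (b := r)
    fun t ht => (lt_min hc hr).trans_le ht.1
  simpa [wr, phi_self hC hc] using this

/-- Every solution on an interval around `c` is the combination of `φ₁`, `φ₂` given by its Cauchy
data at `c`. -/
lemma Sys.eq_comb (hC : Coeffs p q) (hc : 0 < c) (hS : S ⊆ Set.Ioi 0) (hS' : S.OrdConnected)
    (hcS : c ∈ S) (h : Sys p q l S x v) {r : ℝ} (hr : r ∈ S) :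
    x r = comb p q c l ![x c, v c] r ∧ v r = quasiDeriv p (comb p q c l ![x c, v c]) r := by
  have hr0 : 0 < r := hS hr
  have hsub : Set.uIcc c r ⊆ S := hS'.uIcc_subset hcS hr
  have hpS : ∀ r ∈ S, 0 < p r := fun r hr => hC.pos r (hS hr)
  have h0 := wr_const hpS h ((phi_sys hC hc 0 l).mono hS) hsub
  have h1 := wr_const hpS h ((phi_sys hC hc 1 l).mono hS) hsub
  have hw := wr_phi hC hc l hr0
  simp only [wr, phi_self hC hc] at h0 h1
  norm_num at h0 h1
  rw [quasiDeriv_comb hC hc l _ hr0, comb_eq]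
  simp only [Matrix.cons_val_zero, Matrix.cons_val_one]
  constructor
  · linear_combination (-x r) * hw + phi p q c 0 l r * h1 - phi p q c 1 l r * h0
  · linear_combination (-v r) * hw + quasiDeriv p (phi p q c 0 l) r * h1 -
      quasiDeriv p (phi p q c 1 l) r * h0

lemma IsSolution.eq_comb (hC : Coeffs p q) (hc : 0 < c) (h : IsSolution p q l x) {r : ℝ}
    (hr : 0 < r) : x r = comb p q c l ![x c, quasiDeriv p x c] r :=
  ((h.sys hC).eq_comb hC hc subset_rfl Set.ordConnected_Ioi hc hr).1

/-- The Cauchy data of a combination at any point determine its coefficients. -/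
lemma comb_injective (hC : Coeffs p q) (hc : 0 < c) (l : ℂ) {t : Fin 2 → ℂ} {r : ℝ}
    (hr : 0 < r) (h0 : comb p q c l t r = 0) (h1 : quasiDeriv p (comb p q c l t) r = 0) :
    t = 0 := by
  have hw := wr_phi hC hc l hr
  rw [quasiDeriv_comb hC hc l _ hr] at h1
  rw [comb_eq] at h0
  ext j
  fin_cases j
  · simp only [Fin.zero_eta, Pi.zero_apply]
    linear_combination (-t 0) * hw + quasiDeriv p (phi p q c 1 l) r * h0 - phi p q c 1 l r * h1
  · simp only [Fin.mk_one, Pi.zero_apply]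
    linear_combination (-t 1) * hw + phi p q c 0 l r * h1 - quasiDeriv p (phi p q c 0 l) r * h0

lemma continuousOn_comb (hC : Coeffs p q) (hc : 0 < c) (l : ℂ) (t : Fin 2 → ℂ) :
    ContinuousOn (comb p q c l t) (Set.Ioi 0) := (comb_sys hC hc l t).continuousOn.1

/-- A nontrivial solution has positive `L²` norm on every nondegenerate interval. -/
lemma integral_norm_comb_pos (hC : Coeffs p q) (hc : 0 < c) (l : ℂ) {t : Fin 2 → ℂ} (ht : t ≠ 0)
    {a b : ℝ} (ha : 0 < a) (hab : a < b) : 0 < ∫ r in a..b, ‖comb p q c l t r‖ ^ 2 := by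
  have hcont : ContinuousOn (fun r => ‖comb p q c l t r‖ ^ 2) (Set.Icc a b) :=
    ((continuousOn_comb hC hc l t).mono fun r hr => ha.trans_le hr.1).norm.pow 2
  by_contra hneg
  have hz : ∀ r ∈ Set.Icc a b, comb p q c l t r = 0 := by
    by_contra! hne
    obtain ⟨r, hr, hr0⟩ := hne
    exact hneg (intervalIntegral.integral_pos hab hcont (fun _ _ => by positivity)
      ⟨r, hr, by positivity⟩)
  obtain ⟨m, hm⟩ := exists_between hab
  have hm0 : 0 < m := ha.trans hm.1
  refine ht (comb_injective hC hc l hm0 (hz m (Set.Ioo_subset_Icc_self hm)) ?_)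
  have he : comb p q c l t =ᶠ[𝓝 m] fun _ => 0 := by
    filter_upwards [Ioo_mem_nhds hm.1 hm.2] with r hr using hz r (Set.Ioo_subset_Icc_self hr)
  rw [quasiDeriv, he.deriv_eq, deriv_const, mul_zero]

/-- The solutions `φ₁`, `φ₂` are bounded on compact intervals, uniformly for bounded spectral
parameters. -/
lemma exists_phi_bound (hC : Coeffs p q) (hc : 0 < c) {a b : ℝ} (ha : 0 < a)
    (hcab : c ∈ Set.Icc a b) (R : ℝ) : ∃ B : ℝ, 0 < B ∧ ∀ (j : Fin 2) (l : ℂ), ‖l‖ ≤ R →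
      ∀ r ∈ Set.Icc a b, ‖phi p q c j l r‖ ≤ B := by
  have hpos : Set.Icc a b ⊆ Set.Ioi 0 := fun t ht => ha.trans_le ht.1
  have hcont : ContinuousOn (fun t => 1 / p t + (‖(q t : ℂ)‖ + R)) (Set.Icc a b) := by
    refine ContinuousOn.add ?_ (ContinuousOn.add ?_ continuousOn_const)
    · exact continuousOn_const.div (hC.cont_p.mono hpos) fun r hr => (hC.pos r (hpos hr)).ne'
    · exact (Complex.continuous_ofReal.comp_continuousOn (hC.cont_q.mono hpos)).norm
  obtain ⟨K, hK⟩ := isCompact_Icc.exists_bound_of_continuousOn hcont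
  have hK0 : 0 ≤ K := (norm_nonneg _).trans (hK c hcab)
  refine ⟨Real.exp (K * (b - a)), Real.exp_pos _, fun j l hl r hr => ?_⟩
  obtain ⟨x, v, hs, hx, hv, hb⟩ :=
    exists_sys hC hc l (if j = 0 then 1 else 0) (if j = 1 then 1 else 0)
  have h1 := hb a b K ha hcab (fun t ht => by
    have h2 : ‖(q t : ℂ) - l‖ ≤ ‖(q t : ℂ)‖ + ‖l‖ := norm_sub_le _ _
    have h3 := (le_abs_self _).trans (hK t ht)
    linarith) r hr
  have h4 : phi p q c j l r = x r := by
    have e1 := IsSolution.eq_comb hC hc (hs.isSolution hC) (hpos hr)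
    have e2 := IsSolution.eq_comb hC hc ((phi_sys hC hc j l).isSolution hC) (hpos hr)
    rw [e1, e2, hs.quasiDeriv_eq hc (hC.pos c hc), hx, hv, (phi_self hC hc j l).1,
      (phi_self hC hc j l).2]
  rw [h4]
  refine h1.trans ?_
  have hm : max ‖(if j = 0 then 1 else 0 : ℂ)‖ ‖(if j = 1 then 1 else 0 : ℂ)‖ = 1 := by
    fin_cases j <;> simp
  rw [hm, one_mul, Real.exp_le_exp]
  refine mul_le_mul_of_nonneg_left ?_ hK0
  rw [abs_le]
  constructor <;> linarith [hr.1, hr.2, hcab.1, hcab.2]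

end

/-! ### Weyl circles and limit points -/

section

variable {p q : ℝ → ℝ} {l : ℂ} {c : ℝ}

/-- The Wronskian of two functions satisfying the same real boundary condition vanishes. -/
lemma wr_eq_zero_of_boundary {β : ℝ} {x v y w : ℂ} (h₁ : (Real.cos β : ℂ) * x + Real.sin β * v = 0)
    (h₂ : (Real.cos β : ℂ) * y + Real.sin β * w = 0) : x * w - v * y = 0 := by
  have h : (Real.cos β : ℂ) ^ 2 + (Real.sin β : ℂ) ^ 2 = 1 := by
    exact_mod_cast Real.cos_sq_add_sin_sq β
  linear_combination (Real.cos β * w - Real.sin β * y) * h₁ +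
    (Real.sin β * x - Real.cos β * v) * h₂ - (x * w - v * y) * h

lemma conj_boundary {β : ℝ} {x v : ℂ} (h : (Real.cos β : ℂ) * x + Real.sin β * v = 0) :
    (Real.cos β : ℂ) * conj x + Real.sin β * conj v = 0 := by
  have := congrArg conj h
  simpa only [map_add, map_mul, Complex.conj_ofReal, map_zero] using this

/-- Lagrange's identity for a solution and its complex conjugate. -/
lemma sub_conj_mul_integral (hC : Coeffs p q) (hc : 0 < c) (l : ℂ) (t : Fin 2 → ℂ) {a b : ℝ}
    (ha : 0 < a) (hb : 0 < b) :
    2 * Complex.I * l.im * ((∫ r in a..b, ‖comb p q c l t r‖ ^ 2 : ℝ) : ℂ) =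
      (comb p q c l t b * conj (quasiDeriv p (comb p q c l t) b) -
        quasiDeriv p (comb p q c l t) b * conj (comb p q c l t b)) -
      (comb p q c l t a * conj (quasiDeriv p (comb p q c l t) a) -
        quasiDeriv p (comb p q c l t) a * conj (comb p q c l t a)) := by
  have h := mul_integral_eq_wr_sub hC.pos (comb_sys hC hc l t) (comb_sys hC hc l t).conj
    (a := a) (b := b) fun s hs => (lt_min ha hb).trans_le hs.1
  rw [← intervalIntegral.integral_ofReal]
  have h1 : ∀ r, ((‖comb p q c l t r‖ ^ 2 : ℝ) : ℂ) =
      comb p q c l t r * conj (comb p q c l t r) := fun r => by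
    rw [Complex.mul_conj, Complex.normSq_eq_norm_sq]
  simp only [h1]
  have h2 : l - conj l = 2 * Complex.I * l.im := by
    rw [Complex.sub_conj]; push_cast; ring
  rw [h2] at h
  simpa [wr] using h

/-- On the circle `C_r`, the `L²` norm of `χ` between `c` and `r` is determined by `Im m`. -/
lemma integral_eq_of_mem_weylCircle (hC : Coeffs p q) (hc : 0 < c) (hl : l.im ≠ 0) {r : ℝ}
    (hr : 0 < r) {m : ℂ} (hm : m ∈ weylCircle p q c l r) :
    ∫ s in c..r, ‖comb p q c l ![1, m] s‖ ^ 2 = m.im / l.im := by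
  obtain ⟨β, -, hβ⟩ := hm
  have h := sub_conj_mul_integral hC hc l ![1, m] hc hr
  rw [wr_eq_zero_of_boundary hβ (conj_boundary hβ), (comb_self hC hc l _).1,
    (comb_self hC hc l _).2] at h
  simp only [Matrix.cons_val_zero, Matrix.cons_val_one, map_one, one_mul, mul_one] at h
  have h2 : conj m - m = -(2 * Complex.I * m.im) := by
    rw [← neg_sub, Complex.sub_conj]; push_cast; ring
  rw [h2, zero_sub, neg_neg] at h
  have h3 : (l.im : ℂ) * ((∫ s in c..r, ‖comb p q c l ![1, m] s‖ ^ 2 : ℝ) : ℂ) = m.im := by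
    have h4 : (2 * Complex.I : ℂ) ≠ 0 := by simp
    exact mul_left_cancel₀ h4 (by linear_combination h)
  rw [eq_div_iff hl, mul_comm]
  exact_mod_cast h3

/-- At `r ≠ c` a real boundary condition excludes `φ₂` for non-real `l`. -/
lemma boundary_phi_one_ne_zero (hC : Coeffs p q) (hc : 0 < c) (hl : l.im ≠ 0) {r : ℝ}
    (hr : 0 < r) (hrc : r ≠ c) (β : ℝ) : (Real.cos β : ℂ) * phi p q c 1 l r +
      Real.sin β * quasiDeriv p (phi p q c 1 l) r ≠ 0 := by
  intro h0
  have e1 : comb p q c l ![0, 1] r = phi p q c 1 l r := by simp [comb_eq]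
  have e2 : quasiDeriv p (comb p q c l ![0, 1]) r = quasiDeriv p (phi p q c 1 l) r := by
    simp [quasiDeriv_comb hC hc l _ hr]
  have h := sub_conj_mul_integral hC hc l ![0, 1] hc hr
  rw [← e1, ← e2] at h0
  rw [wr_eq_zero_of_boundary h0 (conj_boundary h0), (comb_self hC hc l _).1,
    (comb_self hC hc l _).2] at h
  simp only [Matrix.cons_val_zero, Matrix.cons_val_one, map_one, map_zero, zero_mul, mul_zero,
    sub_zero, mul_eq_zero, Complex.I_ne_zero, Complex.ofReal_eq_zero, hl, or_false, false_or,
    OfNat.ofNat_ne_zero] at h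
  have ht : (![0, 1] : Fin 2 → ℂ) ≠ 0 := fun h => by simpa using congrFun h 1
  rcases lt_or_gt_of_ne hrc with hlt | hlt
  · have := integral_norm_comb_pos hC hc l ht hr hlt
    rw [intervalIntegral.integral_symm] at h
    linarith
  · have := integral_norm_comb_pos hC hc l ht hc hlt
    linarith

/-- Each real boundary condition at `r ≠ c` determines a point of the Weyl circle. -/
lemma exists_mem_weylCircle (hC : Coeffs p q) (hc : 0 < c) (hl : l.im ≠ 0) {r : ℝ}
    (hr : 0 < r) (hrc : r ≠ c) {β : ℝ} (hβ : β ∈ Set.Ico 0 Real.pi) :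
    ∃ m ∈ weylCircle p q c l r, BoundaryCondition p β r (comb p q c l ![1, m]) := by
  have h0 := boundary_phi_one_ne_zero hC hc hl hr hrc β
  set d := (Real.cos β : ℂ) * phi p q c 1 l r + Real.sin β * quasiDeriv p (phi p q c 1 l) r
    with hd
  set m := -((Real.cos β : ℂ) * phi p q c 0 l r +
    Real.sin β * quasiDeriv p (phi p q c 0 l) r) / d with hm
  have hbc : BoundaryCondition p β r (comb p q c l ![1, m]) := by
    rw [BoundaryCondition, quasiDeriv_comb hC hc l _ hr, comb_eq]
    simp only [Matrix.cons_val_zero, Matrix.cons_val_one]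
    have : m * d = -((Real.cos β : ℂ) * phi p q c 0 l r +
      Real.sin β * quasiDeriv p (phi p q c 0 l) r) := by rw [hm]; field_simp
    rw [hd] at this
    linear_combination this
  exact ⟨m, ⟨β, hβ, hbc⟩, hbc⟩

lemma integrableOn_norm_comb (hC : Coeffs p q) (hc : 0 < c) (l : ℂ) (t : Fin 2 → ℂ) {r : ℝ}
    (hr : 0 < r) : IntegrableOn (fun s => ‖comb p q c l t s‖ ^ 2) (Set.uIoc c r) := by
  have : ContinuousOn (fun s => ‖comb p q c l t s‖ ^ 2) (Set.uIcc c r) :=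
    ((continuousOn_comb hC hc l t).mono fun s hs => (lt_min hc hr).trans_le hs.1).norm.pow 2
  exact this.integrableOn_uIcc.mono_set Set.uIoc_subset_uIcc

lemma norm_comb_one_sq (m : ℂ) (s : ℝ) : ‖comb p q c l ![1, m] s‖ ^ 2 =
    ‖phi p q c 0 l s‖ ^ 2 + ‖m‖ ^ 2 * ‖phi p q c 1 l s‖ ^ 2 +
    (m.re * (2 * (phi p q c 0 l s * conj (phi p q c 1 l s)).re) +
      m.im * (2 * (phi p q c 0 l s * conj (phi p q c 1 l s)).im)) := by
  simp only [← Complex.normSq_eq_norm_sq, Complex.normSq_apply, comb_eq, Matrix.cons_val_zero,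
    Matrix.cons_val_one, Complex.add_re, Complex.add_im, Complex.mul_re, Complex.mul_im,
    Complex.conj_re, Complex.conj_im, one_mul]
  ring

/-- The norm of `χ` over `(c, r)` is a quadratic polynomial in `m` with positive leading
coefficient. -/
lemma exists_quadratic (hC : Coeffs p q) (hc : 0 < c) (l : ℂ) {r : ℝ} (hr : 0 < r)
    (hrc : r ≠ c) : ∃ A B C₁ C₂ : ℝ, 0 < B ∧ ∀ m : ℂ,
      ∫ s in Set.uIoc c r, ‖comb p q c l ![1, m] s‖ ^ 2 =
        A + ‖m‖ ^ 2 * B + (m.re * C₁ + m.im * C₂) := by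
  have hsub : Set.uIcc c r ⊆ Set.Ioi 0 := fun s hs => (lt_min hc hr).trans_le hs.1
  have c0 := (phi_sys hC hc 0 l).continuousOn.1.mono hsub
  have c1 := (phi_sys hC hc 1 l).continuousOn.1.mono hsub
  have hi : ∀ {g : ℝ → ℝ}, ContinuousOn g (Set.uIcc c r) → IntegrableOn g (Set.uIoc c r) :=
    fun hg => hg.integrableOn_uIcc.mono_set Set.uIoc_subset_uIcc
  have cc : ContinuousOn (fun s => phi p q c 0 l s * conj (phi p q c 1 l s)) (Set.uIcc c r) :=
    c0.mul (Complex.continuous_conj.comp_continuousOn c1)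
  have i0 : IntegrableOn (fun s => ‖phi p q c 0 l s‖ ^ 2) (Set.uIoc c r) := hi (c0.norm.pow 2)
  have i1 : IntegrableOn (fun s => ‖phi p q c 1 l s‖ ^ 2) (Set.uIoc c r) := hi (c1.norm.pow 2)
  have i2 : IntegrableOn (fun s => 2 * (phi p q c 0 l s * conj (phi p q c 1 l s)).re)
      (Set.uIoc c r) :=
    hi (continuousOn_const.mul (Complex.continuous_re.comp_continuousOn cc))
  have i3 : IntegrableOn (fun s => 2 * (phi p q c 0 l s * conj (phi p q c 1 l s)).im)
      (Set.uIoc c r) :=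
    hi (continuousOn_const.mul (Complex.continuous_im.comp_continuousOn cc))
  refine ⟨∫ s in Set.uIoc c r, ‖phi p q c 0 l s‖ ^ 2, ∫ s in Set.uIoc c r, ‖phi p q c 1 l s‖ ^ 2,
    ∫ s in Set.uIoc c r, 2 * (phi p q c 0 l s * conj (phi p q c 1 l s)).re,
    ∫ s in Set.uIoc c r, 2 * (phi p q c 0 l s * conj (phi p q c 1 l s)).im, ?_, fun m => ?_⟩
  · have ht : (![0, 1] : Fin 2 → ℂ) ≠ 0 := fun h => by simpa using congrFun h 1
    have e1 : ∀ s, comb p q c l ![0, 1] s = phi p q c 1 l s := fun s => by simp [comb_eq]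
    rcases lt_or_gt_of_ne hrc with hlt | hlt
    · have := integral_norm_comb_pos hC hc l ht hr hlt
      rw [Set.uIoc_of_ge hlt.le, ← intervalIntegral.integral_of_le hlt.le]
      simpa only [e1] using this
    · have := integral_norm_comb_pos hC hc l ht hc hlt
      rw [Set.uIoc_of_le hlt.le, ← intervalIntegral.integral_of_le hlt.le]
      simpa only [e1] using this
  · simp only [norm_comb_one_sq]
    have j1 := i1.const_mul (‖m‖ ^ 2)
    have j2 := i2.const_mul m.re
    have j3 := i3.const_mul m.im
    refine (integral_add (i0.add j1) (j2.add j3)).trans ?_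
    exact congrArg₂ _ ((integral_add i0 j1).trans (by rw [integral_const_mul]))
      ((integral_add j2 j3).trans (by simp only [integral_const_mul]))

/-- The Weyl disk at `r`: for `σ = 1` the closed disk bounded by `C_r` if `r > c`, for `σ = -1`
the one bounded by `C_r` if `r < c`. -/
def weylDisk (p q : ℝ → ℝ) (c : ℝ) (l : ℂ) (σ r : ℝ) : Set ℂ :=
  {m | ∫ s in Set.uIoc c r, ‖comb p q c l ![1, m] s‖ ^ 2 ≤ σ * (m.im / l.im)}

lemma isCompact_weylDisk (hC : Coeffs p q) (hc : 0 < c) (l : ℂ) (σ : ℝ) {r : ℝ} (hr : 0 < r)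
    (hrc : r ≠ c) : IsCompact (weylDisk p q c l σ r) := by
  obtain ⟨A, B, C₁, C₂, hB, hq⟩ := exists_quadratic hC hc l hr hrc
  simp only [weylDisk, hq]
  refine Metric.isCompact_of_isClosed_isBounded (isClosed_le (by fun_prop) (by fun_prop)) ?_
  set K := |A| + |C₁| + |C₂| + |σ / l.im| with hK
  refine (Metric.isBounded_closedBall (x := (0 : ℂ)) (r := max 1 (K / B))).subset fun m hm => ?_
  rw [mem_closedBall_zero_iff]
  by_contra! hlt
  have h1 : 1 < ‖m‖ := (le_max_left _ _).trans_lt hlt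
  have h2 : K / B < ‖m‖ := (le_max_right _ _).trans_lt hlt
  rw [div_lt_iff₀ hB] at h2
  have hre := Complex.abs_re_le_norm m
  have him := Complex.abs_im_le_norm m
  have hm' : A + ‖m‖ ^ 2 * B + (m.re * C₁ + m.im * C₂) ≤ σ * (m.im / l.im) := hm
  have e1 : -(‖m‖ * |A|) ≤ A := by
    have := neg_abs_le A
    nlinarith [abs_nonneg A]
  have e2 : -(‖m‖ * |C₁|) ≤ m.re * C₁ := by
    have := neg_abs_le (m.re * C₁)
    rw [abs_mul] at this
    nlinarith [abs_nonneg C₁]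
  have e3 : -(‖m‖ * |C₂|) ≤ m.im * C₂ := by
    have := neg_abs_le (m.im * C₂)
    rw [abs_mul] at this
    nlinarith [abs_nonneg C₂]
  have e4 : σ * (m.im / l.im) ≤ ‖m‖ * |σ / l.im| := by
    have := le_abs_self (m.im * (σ / l.im))
    rw [abs_mul] at this
    have h5 : σ * (m.im / l.im) = m.im * (σ / l.im) := by ring
    rw [h5]
    nlinarith [abs_nonneg (σ / l.im)]
  nlinarith

/-- The nested disks shrink to a point unless all solutions are square integrable. The side of `c`
is encoded in the set `T` of admissible endpoints, the sign `σ`, and the filter `f`. -/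
theorem exists_isWeylLimitPoint (hC : Coeffs p q) (hc : 0 < c) (hl : l.im ≠ 0) {σ : ℝ}
    {T : Set ℝ} {f : Filter ℝ} (hT : ∀ r ∈ T, 0 < r ∧ r ≠ c) (hTne : T.Nonempty)
    (hσ : ∀ r ∈ T, ∀ g : ℝ → ℝ, ∫ s in Set.uIoc c r, g s = σ * ∫ s in c..r, g s)
    (hdir : ∀ r₁ ∈ T, ∀ r₂ ∈ T, Set.uIoc c r₁ ⊆ Set.uIoc c r₂ ∨ Set.uIoc c r₂ ⊆ Set.uIoc c r₁)
    (hf : ∀ r₀ ∈ T, ∀ᶠ r in f, r ∈ T ∧ Set.uIoc c r₀ ⊆ Set.uIoc c r)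
    (hlp : ¬ ∀ t : Fin 2 → ℂ, ∃ C : ℝ, ∀ r ∈ T,
      ∫ s in Set.uIoc c r, ‖comb p q c l t s‖ ^ 2 ≤ C) :
    ∃ m, IsWeylLimitPoint p q c l f m ∧ 0 < σ * (m.im / l.im) := by
  have hanti : ∀ r₁ ∈ T, ∀ r₂ ∈ T, Set.uIoc c r₁ ⊆ Set.uIoc c r₂ →
      weylDisk p q c l σ r₂ ⊆ weylDisk p q c l σ r₁ := fun r₁ h₁ r₂ h₂ hsub m hm =>
    (setIntegral_mono_set (integrableOn_norm_comb hC hc l _ (hT r₂ h₂).1)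
      (Eventually.of_forall fun _ => by positivity) (Filter.Eventually.of_forall hsub)).trans hm
  have hcirc : ∀ r ∈ T, weylCircle p q c l r ⊆ weylDisk p q c l σ r := fun r hr m hm => by
    rw [weylDisk, Set.mem_ofPred_eq, hσ r hr, integral_eq_of_mem_weylCircle hC hc hl (hT r hr).1 hm]
  have hne : ∀ r ∈ T, (weylCircle p q c l r).Nonempty := fun r hr => by
    obtain ⟨m, hm, -⟩ := exists_mem_weylCircle hC hc hl (hT r hr).1 (hT r hr).2
      (β := 0) ⟨le_rfl, Real.pi_pos⟩
    exact ⟨m, hm⟩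
  have : Nonempty T := hTne.to_subtype
  set V : T → Set ℂ := fun r => weylDisk p q c l σ r with hV
  have hVdir : Directed (· ⊇ ·) V := fun r₁ r₂ => by
    rcases hdir r₁ r₁.2 r₂ r₂.2 with h | h
    · exact ⟨r₂, hanti _ r₁.2 _ r₂.2 h, subset_rfl⟩
    · exact ⟨r₁, subset_rfl, hanti _ r₂.2 _ r₁.2 h⟩
  have hVc : ∀ r, IsCompact (V r) := fun r => isCompact_weylDisk hC hc l σ (hT r r.2).1 (hT r r.2).2
  obtain ⟨m, hm⟩ : (⋂ r, V r).Nonempty :=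
    IsCompact.nonempty_iInter_of_directed_nonempty_isCompact_isClosed V hVdir
      (fun r => (hne r r.2).mono (hcirc r r.2)) hVc fun r => (hVc r).isClosed
  -- two points in all disks give two independent square integrable solutions, hence all of them
  have huniq : ∀ m' ∈ ⋂ r, V r, m' = m := by
    intro m' hm'
    by_contra hmm
    refine hlp fun t => ?_
    have hmm0 : m' - m ≠ 0 := sub_ne_zero.mpr hmm
    -- the coordinates of `t` in the basis `(1, m')`, `(1, m)`
    set α := (t 1 - t 0 * m) / (m' - m)
    set β := (t 0 * m' - t 1) / (m' - m)
    have hcomb : ∀ s, comb p q c l t s =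
        α * comb p q c l ![1, m'] s + β * comb p q c l ![1, m] s := fun s => by
      simp only [comb_eq, Matrix.cons_val_zero, Matrix.cons_val_one, α, β]
      field_simp
      ring
    refine ⟨2 * ‖α‖ ^ 2 * (σ * (m'.im / l.im)) + 2 * ‖β‖ ^ 2 * (σ * (m.im / l.im)),
      fun r hr => ?_⟩
    have i1 := integrableOn_norm_comb hC hc l ![1, m'] (hT r hr).1
    have i2 := integrableOn_norm_comb hC hc l ![1, m] (hT r hr).1
    have b1 : ∫ s in Set.uIoc c r, ‖comb p q c l ![1, m'] s‖ ^ 2 ≤ σ * (m'.im / l.im) :=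
      Set.mem_iInter.mp hm' ⟨r, hr⟩
    have b2 : ∫ s in Set.uIoc c r, ‖comb p q c l ![1, m] s‖ ^ 2 ≤ σ * (m.im / l.im) :=
      Set.mem_iInter.mp hm ⟨r, hr⟩
    calc ∫ s in Set.uIoc c r, ‖comb p q c l t s‖ ^ 2
        ≤ ∫ s in Set.uIoc c r, (2 * ‖α‖ ^ 2 * ‖comb p q c l ![1, m'] s‖ ^ 2 +
            2 * ‖β‖ ^ 2 * ‖comb p q c l ![1, m] s‖ ^ 2) := by
          refine setIntegral_mono (integrableOn_norm_comb hC hc l t (hT r hr).1)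
            ((i1.const_mul _).add (i2.const_mul _)) fun s => ?_
          have h1 := norm_add_le (α * comb p q c l ![1, m'] s) (β * comb p q c l ![1, m] s)
          rw [← hcomb, norm_mul, norm_mul] at h1
          have h2 := norm_nonneg (comb p q c l t s)
          nlinarith [sq_nonneg (‖α‖ * ‖comb p q c l ![1, m'] s‖ -
            ‖β‖ * ‖comb p q c l ![1, m] s‖)]
      _ ≤ _ := by
          rw [integral_add (i1.const_mul _) (i2.const_mul _), integral_const_mul,
            integral_const_mul]
          gcongr
  refine ⟨m, fun U hU => ?_, ?_⟩
  -- by compactness, a single disk lies in `U`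
  · obtain ⟨r₀, hr₀⟩ := exists_subset_nhds_of_isCompact' hVdir hVc (fun r => (hVc r).isClosed)
      (U := U) fun x hx => by rw [huniq x hx]; exact hU
    filter_upwards [hf r₀ r₀.2] with r hr
    exact ⟨hne r hr.1, (hcirc r hr.1).trans ((hanti _ r₀.2 _ hr.1 hr.2).trans hr₀)⟩
  · obtain ⟨r, hr⟩ := hTne
    have b2 : ∫ s in Set.uIoc c r, ‖comb p q c l ![1, m] s‖ ^ 2 ≤ σ * (m.im / l.im) :=
      Set.mem_iInter.mp hm ⟨r, hr⟩
    refine lt_of_lt_of_le ?_ b2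
    have ht : (![1, m] : Fin 2 → ℂ) ≠ 0 := fun h => by simpa using congrFun h 0
    rcases lt_or_gt_of_ne (hT r hr).2 with hlt | hlt
    · rw [Set.uIoc_of_ge hlt.le, ← intervalIntegral.integral_of_le hlt.le]
      exact integral_norm_comb_pos hC hc l ht (hT r hr).1 hlt
    · rw [Set.uIoc_of_le hlt.le, ← intervalIntegral.integral_of_le hlt.le]
      exact integral_norm_comb_pos hC hc l ht hc hlt

theorem exists_isWeylLimitPoint_atTop (hC : Coeffs p q) (hc : 0 < c)
    (h : LimitPointAtInfty p q) (hl : l.im ≠ 0) :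
    ∃ m, IsWeylLimitPoint p q c l atTop m ∧ 0 < m.im / l.im := by
  have hu : ∀ r ∈ Set.Ioi c, Set.uIoc c r = Set.Ioc c r := fun r hr =>
    Set.uIoc_of_le (le_of_lt hr)
  have hlp : ¬ ∀ t : Fin 2 → ℂ, ∃ C : ℝ, ∀ r ∈ Set.Ioi c,
      ∫ s in Set.uIoc c r, ‖comb p q c l t s‖ ^ 2 ≤ C := by
    refine fun hbd => h ⟨l, fun x hx => ⟨c, hc, ?_⟩⟩
    obtain ⟨C, hC'⟩ := hbd ![x c, quasiDeriv p x c]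
    have hi : IntegrableOn (fun s => ‖comb p q c l ![x c, quasiDeriv p x c] s‖ ^ 2)
        (Set.Ioi c) := by
      refine integrableOn_Ioi_of_intervalIntegral_norm_bounded C c (b := id) (l := atTop)
        (fun r => ?_) tendsto_id ?_
      · rcases le_or_gt r c with hrc | hrc
        · simp [Set.Ioc_eq_empty (not_lt.mpr hrc)]
        · have := integrableOn_norm_comb hC hc l ![x c, quasiDeriv p x c] (hc.trans hrc)
          rwa [hu r hrc] at this
      · filter_upwards [eventually_gt_atTop c] with r hr
        have := hC' r hr
        rw [hu r hr, ← intervalIntegral.integral_of_le (le_of_lt hr)] at this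
        simpa using this
    refine hi.congr_fun (fun s hs => ?_) measurableSet_Ioi
    simp only
    rw [← IsSolution.eq_comb hC hc hx (hc.trans hs)]
  obtain ⟨m, hm, hpos⟩ := exists_isWeylLimitPoint hC hc hl (σ := 1) (T := Set.Ioi c) (f := atTop)
    (fun r hr => ⟨hc.trans hr, ne_of_gt hr⟩) ⟨c + 1, by simp⟩
    (fun r hr g => by rw [hu r hr, one_mul, intervalIntegral.integral_of_le (le_of_lt hr)])
    (fun r₁ h₁ r₂ h₂ => by
      rw [hu r₁ h₁, hu r₂ h₂]
      exact (le_total r₁ r₂).imp Set.Ioc_subset_Ioc_right Set.Ioc_subset_Ioc_right)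
    (fun r₀ h₀ => by
      filter_upwards [eventually_ge_atTop r₀] with r hr
      have hr' : r ∈ Set.Ioi c := lt_of_lt_of_le h₀ hr
      exact ⟨hr', by rw [hu r₀ h₀, hu r hr']; exact Set.Ioc_subset_Ioc_right hr⟩) hlp
  exact ⟨m, hm, by simpa using hpos⟩

theorem exists_isWeylLimitPoint_zero (hC : Coeffs p q) (hc : 0 < c)
    (h : LimitPointAtZero p q) (hl : l.im ≠ 0) :
    ∃ m, IsWeylLimitPoint p q c l (𝓝[>] 0) m ∧ m.im / l.im < 0 := by
  have hu : ∀ r ∈ Set.Ioo 0 c, Set.uIoc c r = Set.Ioc r c := fun r hr =>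
    Set.uIoc_of_ge hr.2.le
  have hlp : ¬ ∀ t : Fin 2 → ℂ, ∃ C : ℝ, ∀ r ∈ Set.Ioo 0 c,
      ∫ s in Set.uIoc c r, ‖comb p q c l t s‖ ^ 2 ≤ C := by
    refine fun hbd => h ⟨l, fun x hx => ⟨c, hc, ?_⟩⟩
    obtain ⟨C, hC'⟩ := hbd ![x c, quasiDeriv p x c]
    have hmem : ∀ n : ℕ, c / (n + 2) ∈ Set.Ioo 0 c := fun n =>
      ⟨by positivity, div_lt_self hc (by linarith [n.cast_nonneg (α := ℝ)])⟩
    have hi : IntegrableOn (fun s => ‖comb p q c l ![x c, quasiDeriv p x c] s‖ ^ 2)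
        (Set.Ioc 0 c) := by
      refine integrableOn_Ioc_of_intervalIntegral_norm_bounded_left (I := C)
        (a := fun n : ℕ => c / (n + 2)) (l := atTop) (fun n => ?_) ?_ ?_
      · have := integrableOn_norm_comb hC hc l ![x c, quasiDeriv p x c] (hmem n).1
        rwa [hu _ (hmem n)] at this
      · exact tendsto_const_nhds.div_atTop
          (tendsto_atTop_add_const_right _ _ tendsto_natCast_atTop_atTop)
      · filter_upwards with n
        have := hC' _ (hmem n)
        rw [hu _ (hmem n)] at this
        simpa using this
    refine (hi.mono_set Set.Ioo_subset_Ioc_self).congr_fun (fun s hs => ?_) measurableSet_Ioo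
    simp only
    rw [← IsSolution.eq_comb hC hc hx hs.1]
  obtain ⟨m, hm, hpos⟩ := exists_isWeylLimitPoint hC hc hl (σ := -1) (T := Set.Ioo 0 c)
    (f := 𝓝[>] 0)
    (fun r hr => ⟨hr.1, hr.2.ne⟩) ⟨c / 2, by constructor <;> linarith⟩
    (fun r hr g => by
      rw [hu r hr, intervalIntegral.integral_symm, intervalIntegral.integral_of_le hr.2.le]
      ring)
    (fun r₁ h₁ r₂ h₂ => by
      rw [hu r₁ h₁, hu r₂ h₂]
      exact (le_total r₂ r₁).imp Set.Ioc_subset_Ioc_left Set.Ioc_subset_Ioc_left)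
    (fun r₀ h₀ => by
      filter_upwards [Ioo_mem_nhdsGT h₀.1] with r hr
      have hr' : r ∈ Set.Ioo 0 c := ⟨hr.1, hr.2.trans h₀.2⟩
      exact ⟨hr', by rw [hu r₀ h₀, hu r hr']; exact Set.Ioc_subset_Ioc_left hr.2.le⟩) hlp
  exact ⟨m, hm, by linarith⟩

end

/-! ### Integral operators with continuous symmetric kernels -/

section IntegralOperator

variable {X : Type*} [TopologicalSpace X] [CompactSpace X] [MeasurableSpace X] [BorelSpace X]
  (μ : Measure X) [IsFiniteMeasure μ]

/-- The section `G (x, ·)` of a continuous kernel, as a continuous map into `L²`. -/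
noncomputable def kernelSection (G : C(X × X, ℝ)) : C(X, Lp ℂ 2 μ) :=
  (⟨_, (ContinuousMap.toLp (E := ℂ) 2 μ ℂ).continuous⟩ : C(C(X, ℂ), Lp ℂ 2 μ)).comp
    (ContinuousMap.curry ((⟨_, Complex.continuous_ofReal⟩ : C(ℝ, ℂ)).comp G))

variable {μ}

lemma inner_kernelSection (G : C(X × X, ℝ)) (x : X) (f : Lp ℂ 2 μ) :
    inner ℂ (kernelSection μ G x) f = ∫ y, (G (x, y) : ℂ) * f y ∂μ := by
  rw [L2.inner_def]
  refine integral_congr_ae ?_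
  filter_upwards [ContinuousMap.coeFn_toLp (p := 2) (𝕜 := ℂ) μ
    (ContinuousMap.curry ((⟨_, Complex.continuous_ofReal⟩ : C(ℝ, ℂ)).comp G) x)] with y hy
  have : (kernelSection μ G x : X → ℂ) y = (G (x, y) : ℂ) := hy
  rw [this]
  simp [RCLike.inner_apply, mul_comm]

/-- The integral operator with kernel `G`, with values in the continuous functions. -/
noncomputable def kernelMap (G : C(X × X, ℝ)) : Lp ℂ 2 μ →L[ℂ] BoundedContinuousFunction X ℂ :=
  LinearMap.mkContinuous
    { toFun := fun f => BoundedContinuousFunction.mkOfCompact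
        ⟨fun x => inner ℂ (kernelSection μ G x) f, by fun_prop⟩
      map_add' := fun f g => by ext x; simp [inner_add_right]
      map_smul' := fun a f => by ext x; simp [inner_smul_right] }
    ‖kernelSection μ G‖ fun f => by
      rw [BoundedContinuousFunction.norm_le (by positivity)]
      intro x
      exact (norm_inner_le_norm (𝕜 := ℂ) (kernelSection μ G x) f).trans (by
        gcongr
        exact ContinuousMap.norm_coe_le_norm _ _)

lemma kernelMap_apply (G : C(X × X, ℝ)) (f : Lp ℂ 2 μ) (x : X) :
    kernelMap G f x = ∫ y, (G (x, y) : ℂ) * f y ∂μ := inner_kernelSection G x f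

/-- By Arzelà–Ascoli: the images of the unit ball are equicontinuous because the section
`x ↦ G (x, ·)` is continuous into `L²`. -/
lemma isCompactOperator_kernelMap (G : C(X × X, ℝ)) :
    IsCompactOperator (kernelMap (μ := μ) G) := by
  refine (isCompactOperator_iff_isCompact_closure_image_ball
    (kernelMap (μ := μ) G).toLinearMap zero_lt_one).mpr ?_
  refine BoundedContinuousFunction.arzela_ascoli (Metric.closedBall 0 ‖kernelSection μ G‖)
    (isCompact_closedBall _ _) _ ?_ ?_
  · rintro _ x ⟨f, hf, rfl⟩
    rw [mem_closedBall_zero_iff]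
    have hf' : ‖f‖ ≤ 1 := by simpa using (le_of_lt (by simpa using hf))
    calc ‖inner ℂ (kernelSection μ G x) f‖ ≤ ‖kernelSection μ G x‖ * ‖f‖ := norm_inner_le_norm _ _
      _ ≤ ‖kernelSection μ G‖ * 1 := by
        gcongr
        exact ContinuousMap.norm_coe_le_norm _ _
      _ = _ := mul_one _
  · intro x₀
    rw [Metric.equicontinuousAt_iff_right]
    intro ε hε
    have := (kernelSection μ G).continuous.tendsto x₀
    filter_upwards [Metric.tendsto_nhds.mp this ε hε] with x hx
    rintro ⟨_, f, hf, rfl⟩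
    have hf' : ‖f‖ ≤ 1 := by simpa using (le_of_lt (by simpa using hf))
    change dist (inner ℂ (kernelSection μ G x₀) f) (inner ℂ (kernelSection μ G x) f) < ε
    rw [dist_comm, dist_eq_norm, ← inner_sub_left]
    rw [dist_eq_norm] at hx
    refine lt_of_le_of_lt ((norm_inner_le_norm _ _).trans ?_) hx
    exact mul_le_of_le_one_right (norm_nonneg _) hf'

/-- The integral operator with kernel `G` on `L²`. -/
noncomputable def kernelOp (G : C(X × X, ℝ)) : Lp ℂ 2 μ →L[ℂ] Lp ℂ 2 μ :=
  (BoundedContinuousFunction.toLp (E := ℂ) 2 μ ℂ).comp (kernelMap G)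

lemma kernelOp_coe (G : C(X × X, ℝ)) (f : Lp ℂ 2 μ) :
    kernelOp G f =ᵐ[μ] fun x => ∫ y, (G (x, y) : ℂ) * f y ∂μ := by
  refine (BoundedContinuousFunction.coeFn_toLp (p := 2) (𝕜 := ℂ) μ (kernelMap G f)).trans ?_
  exact Eventually.of_forall fun x => kernelMap_apply G f x

lemma isCompactOperator_kernelOp (G : C(X × X, ℝ)) :
    IsCompactOperator (kernelOp (μ := μ) G) :=
  (isCompactOperator_kernelMap G).clm_comp (BoundedContinuousFunction.toLp (E := ℂ) 2 μ ℂ)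

lemma isSymmetric_kernelOp [SecondCountableTopology X] {G : C(X × X, ℝ)}
    (hG : ∀ x y, G (x, y) = G (y, x)) :
    (kernelOp (μ := μ) G).IsSymmetric := by
  intro f g
  have hf : Integrable f μ := (Lp.memLp f).integrable (by norm_num)
  have hg : Integrable g μ := (Lp.memLp g).integrable (by norm_num)
  have h1 : inner ℂ (kernelOp G f) g =
      ∫ x, ∫ y, (G (x, y) : ℂ) * conj (f y) * g x ∂μ ∂μ := by
    rw [L2.inner_def]
    refine integral_congr_ae ?_
    filter_upwards [kernelOp_coe G f] with x hx
    rw [hx, RCLike.inner_apply, ← integral_conj, ← integral_const_mul]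
    refine integral_congr_ae (Eventually.of_forall fun y => ?_)
    simp only [map_mul, Complex.conj_ofReal]
    ring
  have h2 : inner ℂ f (kernelOp G g) =
      ∫ y, ∫ x, (G (x, y) : ℂ) * conj (f y) * g x ∂μ ∂μ := by
    rw [L2.inner_def]
    refine integral_congr_ae ?_
    filter_upwards [kernelOp_coe G g] with y hy
    rw [hy, RCLike.inner_apply, ← integral_mul_const]
    refine integral_congr_ae (Eventually.of_forall fun x => ?_)
    simp only [hG y x]
    ring
  change inner ℂ (kernelOp G f) g = inner ℂ f (kernelOp G g)
  rw [h1, h2]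
  refine integral_integral_swap ?_
  have hi : Integrable (fun z : X × X => g z.1 * conj (f z.2)) (μ.prod μ) :=
    hg.mul_prod (f := g) (g := fun y => conj (f y)) (by
      simpa using (RCLike.conjCLE (K := ℂ)).toContinuousLinearMap.integrable_comp hf)
  refine (hi.bdd_mul (c := ‖G‖) (f := fun z => (G z : ℂ)) ?_ ?_).congr ?_
  · exact (Complex.continuous_ofReal.comp G.continuous).aestronglyMeasurable
  · refine Eventually.of_forall fun z => ?_
    simpa using G.norm_coe_le_norm z
  · refine Eventually.of_forall fun z => ?_
    simp only [Function.uncurry]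
    ring

end IntegralOperator

/-! ### Eigenspaces of the finite problems -/

section

variable {p q : ℝ → ℝ} {c : ℝ}

lemma conj_phi_ofReal (hC : Coeffs p q) (hc : 0 < c) (j : Fin 2) (s : ℝ) {r : ℝ} (hr : 0 < r) :
    conj (phi p q c j s r) = phi p q c j s r ∧
      conj (quasiDeriv p (phi p q c j s) r) = quasiDeriv p (phi p q c j s) r := by
  have h1 := (phi_sys hC hc j s).conj
  rw [Complex.conj_ofReal] at h1
  have h2 := h1.eq_comb hC hc subset_rfl Set.ordConnected_Ioi hc hr
  have h3 := (phi_sys hC hc j s).eq_comb hC hc subset_rfl Set.ordConnected_Ioi hc hr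
  have e1 : conj (phi p q c j s c) = phi p q c j s c := by
    rw [(phi_self hC hc j s).1]; split_ifs <;> simp
  have e2 : conj (quasiDeriv p (phi p q c j s) c) = quasiDeriv p (phi p q c j s) c := by
    rw [(phi_self hC hc j s).2]; split_ifs <;> simp
  rw [e1, e2] at h2
  exact ⟨h2.1.trans h3.1.symm, h2.2.trans h3.2.symm⟩

/-- Real combinations of `φ₁`, `φ₂` at real spectral parameters are real. -/
lemma conj_comb_ofReal (hC : Coeffs p q) (hc : 0 < c) (s : ℝ) (τ : Fin 2 → ℝ) {r : ℝ}
    (hr : 0 < r) :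
    conj (comb p q c s (fun j => (τ j : ℂ)) r) = comb p q c s (fun j => (τ j : ℂ)) r := by
  simp only [comb_eq, map_add, map_mul, Complex.conj_ofReal, (conj_phi_ofReal hC hc _ s hr).1]

lemma comb_smul (l z : ℂ) (t : Fin 2 → ℂ) (r : ℝ) :
    comb p q c l (z • t) r = z * comb p q c l t r := by
  simp only [comb_eq, Pi.smul_apply, smul_eq_mul]
  ring

lemma boundary_comb_iff (hC : Coeffs p q) (hc : 0 < c) (l : ℂ) (β : ℝ) {r : ℝ} (hr : 0 < r)
    (t : Fin 2 → ℂ) : BoundaryCondition p β r (comb p q c l t) ↔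
      t 0 * (Real.cos β * phi p q c 0 l r + Real.sin β * quasiDeriv p (phi p q c 0 l) r) +
      t 1 * (Real.cos β * phi p q c 1 l r + Real.sin β * quasiDeriv p (phi p q c 1 l) r) = 0 := by
  rw [BoundaryCondition, quasiDeriv_comb hC hc l _ hr, comb_eq]
  constructor <;> intro h <;> linear_combination h

/-- For real `s`, the solutions satisfying one real boundary condition are the multiples of a
nontrivial real solution. -/
lemma exists_boundary_vec (hC : Coeffs p q) (hc : 0 < c) (s β : ℝ) {r : ℝ} (hr : 0 < r) :
    ∃ v : Fin 2 → ℝ, v ≠ 0 ∧ ∀ t : Fin 2 → ℂ, BoundaryCondition p β r (comb p q c s t) ↔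
      ∃ z : ℂ, t = z • fun j => (v j : ℂ) := by
  set A : Fin 2 → ℂ := fun j =>
    Real.cos β * phi p q c j s r + Real.sin β * quasiDeriv p (phi p q c j s) r with hA
  have hreal : ∀ j, ((A j).re : ℂ) = A j := fun j => by
    rw [← Complex.conj_eq_iff_re]
    simp only [hA, map_add, map_mul, Complex.conj_ofReal, (conj_phi_ofReal hC hc j s hr).1,
      (conj_phi_ofReal hC hc j s hr).2]
  have hne : ¬ (A 0 = 0 ∧ A 1 = 0) := fun h => by
    have := wr_eq_zero_of_boundary h.1 h.2
    rw [wr_phi hC hc s hr] at this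
    exact one_ne_zero this
  have hbc : ∀ t, BoundaryCondition p β r (comb p q c s t) ↔ t 0 * A 0 + t 1 * A 1 = 0 := fun t =>
    boundary_comb_iff hC hc s β hr t
  have hre : ¬ ((A 0).re = 0 ∧ (A 1).re = 0) := fun h => hne
    ⟨by rw [← hreal, h.1, Complex.ofReal_zero], by rw [← hreal, h.2, Complex.ofReal_zero]⟩
  refine ⟨![-(A 1).re, (A 0).re], fun h => hre ⟨?_, ?_⟩, fun t => ?_⟩
  · simpa using congrFun h 1
  · simpa using congrFun h 0
  · rw [hbc]
    have hN : (A 0) ^ 2 + (A 1) ^ 2 ≠ 0 := by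
      rw [← hreal 0, ← hreal 1]
      norm_cast
      intro h
      exact hre ⟨by nlinarith [sq_nonneg (A 0).re, sq_nonneg (A 1).re],
        by nlinarith [sq_nonneg (A 0).re, sq_nonneg (A 1).re]⟩
    constructor
    · intro h
      refine ⟨(t 1 * A 0 - t 0 * A 1) / ((A 0) ^ 2 + (A 1) ^ 2), ?_⟩
      ext j
      fin_cases j
      · simp only [Fin.zero_eta, Pi.smul_apply, smul_eq_mul, Matrix.cons_val_zero,
          Complex.ofReal_neg, hreal]
        field_simp
        linear_combination A 0 * h
      · simp only [Fin.mk_one, Pi.smul_apply, smul_eq_mul, Matrix.cons_val_one, Matrix.cons_val_fin_one,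
          hreal]
        field_simp
        linear_combination A 1 * h
    · rintro ⟨z, rfl⟩
      simp only [Pi.smul_apply, smul_eq_mul, Matrix.cons_val_zero, Matrix.cons_val_one,
        Complex.ofReal_neg, hreal]
      ring

/-- `τ` is the real coefficient vector of a normalized eigenfunction for `s`, or zero if `s` is not
an eigenvalue. Separated boundary conditions make all eigenvalues simple, so this determines the
eigenspace. -/
def IsEigVec (p q : ℝ → ℝ) {c : ℝ} (δ : FiniteProblem c) (s : ℝ) (τ : Fin 2 → ℝ) : Prop :=
  (τ = 0 ∧ ∀ t ∈ eigenCoeffs p q δ s, t = 0) ∨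
  ((fun j => (τ j : ℂ)) ∈ eigenCoeffs p q δ s ∧
    (∫ r in δ.a..δ.b, ‖comb p q c s (fun j => (τ j : ℂ)) r‖ ^ 2) = 1 ∧
    ∀ t ∈ eigenCoeffs p q δ s, ∃ z : ℂ, t = z • fun j => (τ j : ℂ))

/-- A chosen normalized real eigenvector, zero if `s` is not an eigenvalue. -/
noncomputable def eigVec (p q : ℝ → ℝ) {c : ℝ} (δ : FiniteProblem c) (s : ℝ) : Fin 2 → ℝ :=
  Classical.epsilon fun τ => IsEigVec p q δ s τ

lemma FiniteProblem.b_pos {c : ℝ} (δ : FiniteProblem c) : 0 < δ.b := δ.a_pos.trans δ.a_lt_b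

lemma FiniteProblem.c_mem {c : ℝ} (δ : FiniteProblem c) : c ∈ Set.Icc δ.a δ.b :=
  ⟨δ.a_le, δ.le_b⟩

lemma FiniteProblem.Icc_subset {c : ℝ} (δ : FiniteProblem c) :
    Set.Icc δ.a δ.b ⊆ Set.Ioi 0 := fun _ hr => δ.a_pos.trans_le hr.1

lemma smul_mem_eigenCoeffs (hC : Coeffs p q) (hc : 0 < c) (δ : FiniteProblem c) {s : ℝ}
    {t : Fin 2 → ℂ} (z : ℂ) (ht : t ∈ eigenCoeffs p q δ s) : z • t ∈ eigenCoeffs p q δ s := by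
  obtain ⟨h1, h2⟩ := ht
  rw [boundary_comb_iff hC hc _ _ δ.a_pos] at h1
  rw [boundary_comb_iff hC hc _ _ δ.b_pos] at h2
  constructor
  · rw [boundary_comb_iff hC hc _ _ δ.a_pos]
    simp only [Pi.smul_apply, smul_eq_mul]
    linear_combination z * h1
  · rw [boundary_comb_iff hC hc _ _ δ.b_pos]
    simp only [Pi.smul_apply, smul_eq_mul]
    linear_combination z * h2

/-- The chosen vector exists: the left boundary condition leaves one real solution up to multiples,
and it either satisfies the right one or there is no eigenfunction. -/
lemma eigVec_spec (hC : Coeffs p q) (hc : 0 < c) (δ : FiniteProblem c) (s : ℝ) :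
    IsEigVec p q δ s (eigVec p q δ s) := by
  apply Classical.epsilon_spec (p := fun τ => IsEigVec p q δ s τ)
  obtain ⟨v, hv0, hv⟩ := exists_boundary_vec hC hc s δ.β' δ.a_pos
  by_cases hb : BoundaryCondition p δ.β δ.b (comb p q c s fun j => (v j : ℂ))
  · have hvc : (fun j => (v j : ℂ)) ≠ 0 := fun h => hv0 (funext fun j => by
      simpa using congrFun h j)
    have hN := integral_norm_comb_pos hC hc s hvc δ.a_pos δ.a_lt_b
    set N := ∫ r in δ.a..δ.b, ‖comb p q c s (fun j => (v j : ℂ)) r‖ ^ 2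
    have hsq : (Real.sqrt N)⁻¹ ^ 2 * N = 1 := by
      rw [inv_pow, Real.sq_sqrt hN.le, inv_mul_cancel₀ hN.ne']
    have hw : (fun j => (((Real.sqrt N)⁻¹ • v) j : ℂ)) =
        ((Real.sqrt N)⁻¹ : ℂ) • fun j => (v j : ℂ) := by
      ext j; simp
    have hmem : (fun j => (v j : ℂ)) ∈ eigenCoeffs p q δ s :=
      ⟨(hv _).mpr ⟨1, by simp⟩, hb⟩
    refine ⟨(Real.sqrt N)⁻¹ • v, Or.inr ⟨?_, ?_, fun t ht => ?_⟩⟩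
    · rw [hw]
      exact smul_mem_eigenCoeffs hC hc δ _ hmem
    · rw [hw]
      simp only [comb_smul, norm_mul, mul_pow]
      rw [intervalIntegral.integral_const_mul]
      have : ‖((Real.sqrt N)⁻¹ : ℂ)‖ = (Real.sqrt N)⁻¹ := by
        rw [norm_inv, Complex.norm_real, Real.norm_of_nonneg (Real.sqrt_nonneg _)]
      rw [this, hsq]
    · obtain ⟨z, rfl⟩ := (hv t).mp ht.1
      refine ⟨z * Real.sqrt N, ?_⟩
      rw [hw, smul_smul]
      have : (Real.sqrt N : ℂ) ≠ 0 := by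
        exact_mod_cast (Real.sqrt_pos.mpr hN).ne'
      field_simp
  · refine ⟨0, Or.inl ⟨rfl, fun t ht => ?_⟩⟩
    obtain ⟨z, rfl⟩ := (hv t).mp ht.1
    by_cases hz : z = 0
    · simp [hz]
    · refine absurd ?_ hb
      have := (smul_mem_eigenCoeffs hC hc δ z⁻¹ ht).2
      rwa [smul_smul, inv_mul_cancel₀ hz, one_smul] at this

lemma integral_comb_conj_of_norm {l : ℂ} {t : Fin 2 → ℂ} {a b N : ℝ}
    (h : ∫ r in a..b, ‖comb p q c l t r‖ ^ 2 = N) :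
    ∫ r in a..b, comb p q c l t r * conj (comb p q c l t r) = (N : ℂ) := by
  rw [← h, ← intervalIntegral.integral_ofReal]
  refine intervalIntegral.integral_congr fun r _ => ?_
  rw [Complex.mul_conj, Complex.normSq_eq_norm_sq]

/-- The jump of the spectral matrix in terms of the normalized real eigenvector. -/
lemma spectralJump_eq (hC : Coeffs p q) (hc : 0 < c) (δ : FiniteProblem c) (s : ℝ) (j k : Fin 2) :
    spectralJump p q δ s j k = eigVec p q δ s j * eigVec p q δ s k := by
  have hspec := eigVec_spec hC hc δ s
  set τ := eigVec p q δ s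
  have hz0 : ∀ t : Fin 2 → ℂ, t = 0 →
      ∫ r in δ.a..δ.b, comb p q c s t r * conj (comb p q c s t r) = 0 := by
    rintro _ rfl
    simp [comb_eq]
  have hex : ∃ S : Matrix (Fin 2) (Fin 2) ℂ, ∃ (d : ℕ) (t : Fin d → Fin 2 → ℂ),
      IsOrthonormalEigenbasis p q δ s d t ∧ ∀ j k, S j k = ∑ m, conj (t m j) * t m k := by
    rcases hspec with ⟨-, h⟩ | ⟨hmem, hnorm, hspan⟩
    · refine ⟨Matrix.of fun j k => ∑ m : Fin 0, 0, 0, Fin.elim0,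
        ⟨fun m => m.elim0, fun m => m.elim0, fun v hv => ?_⟩, fun j k => by simp⟩
      rw [h v hv]
      exact Submodule.zero_mem _
    · refine ⟨Matrix.of fun j k => ∑ m : Fin 1, conj (τ j : ℂ) * τ k, 1, fun _ j => (τ j : ℂ),
        ⟨fun m => hmem, fun m m' => ?_, fun v hv => ?_⟩, fun j k => by simp⟩
      · rw [if_pos (Subsingleton.elim _ _), integral_comb_conj_of_norm hnorm, Complex.ofReal_one]
      · obtain ⟨z, rfl⟩ := hspan v hv
        exact Submodule.smul_mem _ _ (Submodule.subset_span ⟨0, rfl⟩)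
  obtain ⟨d, t, ⟨ht, horth, hsp⟩, hS⟩ := Classical.epsilon_spec hex
  change (spectralJump p q δ s) j k = _
  rw [show spectralJump p q δ s j k = ∑ m, conj (t m j) * t m k from hS j k]
  rcases hspec with ⟨hτ, h⟩ | ⟨hmem, hnorm, hspan⟩
  · rw [hτ, Finset.sum_eq_zero]
    · simp
    · intro m _
      rw [h _ (ht m)]
      simp
  · choose z hz using fun m => hspan (t m) (ht m)
    have hzz : ∀ m m', z m * conj (z m') = if m = m' then 1 else 0 := fun m m' => by
      rw [← horth m m']
      simp only [hz m, hz m', comb_smul, map_mul]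
      have : ∀ r, z m * comb p q c s (fun j => (τ j : ℂ)) r *
          (conj (z m') * conj (comb p q c s (fun j => (τ j : ℂ)) r)) = (z m * conj (z m')) *
          (comb p q c s (fun j => (τ j : ℂ)) r * conj (comb p q c s (fun j => (τ j : ℂ)) r)) :=
        fun r => by ring
      simp only [this]
      rw [intervalIntegral.integral_const_mul, integral_comb_conj_of_norm hnorm]
      simp
    have hd : d = 1 := by
      rcases Nat.lt_trichotomy d 1 with hd | hd | hd
      · obtain rfl : d = 0 := by omega
        have h0 := hsp _ hmem
        rw [Set.range_eq_empty, Submodule.span_empty, Submodule.mem_bot] at h0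
        have := hz0 _ h0
        rw [integral_comb_conj_of_norm hnorm] at this
        simp at this
      · exact hd
      · have h01 := hzz ⟨0, by omega⟩ ⟨1, hd⟩
        have h00 := hzz ⟨0, by omega⟩ ⟨0, by omega⟩
        have h11 := hzz ⟨1, hd⟩ ⟨1, hd⟩
        rw [if_neg (by simp [Fin.ext_iff])] at h01
        rw [if_pos rfl] at h00 h11
        rcases mul_eq_zero.mp h01 with h | h
        · rw [h, zero_mul] at h00
          exact absurd h00 zero_ne_one
        · rw [h, mul_zero] at h11
          exact absurd h11 zero_ne_one
    subst hd
    have h00 := hzz 0 0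
    rw [if_pos rfl] at h00
    rw [Fin.sum_univ_one, hz 0]
    simp only [Pi.smul_apply, smul_eq_mul, map_mul, Complex.conj_ofReal]
    linear_combination (τ j * τ k : ℂ) * h00

end

/-! ### Green's function of a finite problem and Bessel's inequality -/

section

variable {p q : ℝ → ℝ} {c : ℝ} {l : ℂ}

/-- Lebesgue measure on the compact space `[a, b]`. -/
noncomputable def volIcc (a b : ℝ) : Measure (Set.Icc a b) := Measure.comap Subtype.val volume

instance isFiniteMeasure_volIcc (a b : ℝ) : IsFiniteMeasure (volIcc a b) := by
  constructor
  rw [volIcc, comap_subtype_coe_apply measurableSet_Icc, Set.image_univ, Subtype.range_coe]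
  exact measure_Icc_lt_top

lemma integral_subtype_Icc {a b : ℝ} (hab : a ≤ b) (F : ℝ → ℂ) :
    ∫ x, F x ∂(volIcc a b) = ∫ x in a..b, F x := by
  rw [volIcc, integral_subtype_comap measurableSet_Icc, integral_Icc_eq_integral_Ioc,
    intervalIntegral.integral_of_le hab]

lemma memLp_subtype_of_continuousOn {a b : ℝ} {F : ℝ → ℂ} (hF : ContinuousOn F (Set.Icc a b)) :
    MemLp (fun x : Set.Icc a b => F x) 2 (volIcc a b) := by
  have hc : Continuous fun x : Set.Icc a b => F x := continuousOn_iff_continuous_domRestrict.mp hF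
  obtain ⟨C, hC⟩ := isCompact_Icc.exists_bound_of_continuousOn hF
  exact MemLp.of_bound hc.aestronglyMeasurable C (Eventually.of_forall fun x => hC x x.2)

lemma inner_toLp_subtype {a b : ℝ} (hab : a ≤ b) {F G : ℝ → ℂ}
    (hF : MemLp (fun x : Set.Icc a b => F x) 2 (volIcc a b))
    (hG : MemLp (fun x : Set.Icc a b => G x) 2 (volIcc a b)) :
    inner ℂ (hF.toLp _) (hG.toLp _) = ∫ x in a..b, conj (F x) * G x := by
  rw [L2.inner_def, ← integral_subtype_Icc hab (fun x => conj (F x) * G x)]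
  refine integral_congr_ae ?_
  filter_upwards [hF.coeFn_toLp, hG.coeFn_toLp] with x h1 h2
  rw [h1, h2, RCLike.inner_apply, mul_comm]

lemma integral_indicator_Iic {a b c : ℝ} (hac : a ≤ c) (hcb : c ≤ b) (F : ℝ → ℂ) :
    ∫ x in a..b, (Set.Iic c).indicator F x = ∫ x in a..c, F x := by
  rw [intervalIntegral.integral_of_le (hac.trans hcb), intervalIntegral.integral_of_le hac,
    setIntegral_indicator measurableSet_Iic, Set.Ioc_inter_Iic, min_eq_right hcb]

lemma integral_indicator_Ioi {a b c : ℝ} (hac : a ≤ c) (hcb : c ≤ b) (F : ℝ → ℂ) :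
    ∫ x in a..b, (Set.Ioi c).indicator F x = ∫ x in c..b, F x := by
  rw [intervalIntegral.integral_of_le (hac.trans hcb), intervalIntegral.integral_of_le hcb,
    setIntegral_indicator measurableSet_Ioi]
  congr 2
  ext x
  simp only [Set.mem_inter_iff, Set.mem_Ioc, Set.mem_Ioi]
  constructor
  · rintro ⟨⟨-, h2⟩, h3⟩; exact ⟨h3, h2⟩
  · rintro ⟨h1, h2⟩; exact ⟨⟨hac.trans_lt h1, h2⟩, h1⟩

/-- The solution `t₁ φ₁ + t₂ φ₂` as an element of `L²(δ)`. -/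
noncomputable def combLp (hC : Coeffs p q) (hc : 0 < c) (δ : FiniteProblem c) (l : ℂ)
    (t : Fin 2 → ℂ) : Lp ℂ 2 (volIcc δ.a δ.b) :=
  (memLp_subtype_of_continuousOn
    ((continuousOn_comb hC hc l t).mono δ.Icc_subset)).toLp _

/-- The imaginary parts of the entries of `M` as a Gram matrix. -/
lemma gram_eq_im_matrixM {m' m : ℂ} (hD : m' - m ≠ 0) (j k : Fin 2) :
    ((((matrixM m' m) j k).im : ℝ) : ℂ) =
      conj ((![1, m] : Fin 2 → ℂ) k / (m' - m)) * ((![1, m] : Fin 2 → ℂ) j / (m' - m)) *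
        (-(m'.im : ℂ)) +
      conj ((![1, m'] : Fin 2 → ℂ) k / (m' - m)) * ((![1, m'] : Fin 2 → ℂ) j / (m' - m)) *
        (m.im : ℂ) := by
  set N : ℝ := (Complex.normSq (m' - m))⁻¹ with hN
  have hNpos : Complex.normSq (m' - m) ≠ 0 := by simpa [Complex.normSq_eq_zero] using hD
  have hw : ∀ z : ℂ, z / (m' - m) = z * (conj (m' - m) * N) := fun z => by
    rw [div_eq_mul_inv, Complex.inv_def, hN]
  have hNN : conj (conj (m' - m) * (N : ℂ)) * (conj (m' - m) * N) = N := by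
    rw [map_mul, Complex.conj_conj, Complex.conj_ofReal]
    have : (m' - m) * conj (m' - m) * (N : ℂ) = 1 := by
      rw [Complex.mul_conj, ← Complex.ofReal_mul, hN, mul_inv_cancel₀ hNpos, Complex.ofReal_one]
    linear_combination (N : ℂ) * this
  have hg : ∀ y z : ℂ, conj (y / (m' - m)) * (z / (m' - m)) = conj y * z * N := fun y z => by
    rw [hw, hw, map_mul]
    linear_combination (conj y * z) * hNN
  have h2 : (m' + m) / (m' - m) = (m' + m) * (conj (m' - m) * N) := hw _
  have h3 : 1 / (m' - m) = 1 * (conj (m' - m) * N) := hw _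
  have h4 : m' * m / (m' - m) = (m' * m) * (conj (m' - m) * N) := hw _
  simp only [hg]
  clear_value N
  have hhalf : (1 / 2 : ℂ) = ((1 / 2 : ℝ) : ℂ) := by norm_num
  fin_cases j <;> fin_cases k <;>
    simp only [matrixM, Fin.zero_eta, Fin.mk_one, Matrix.of_apply, Matrix.cons_val_zero,
      Matrix.cons_val_one, Matrix.cons_val', Matrix.cons_val_fin_one, h2, h3, h4, hhalf] <;>
    apply Complex.ext <;>
    simp only [Complex.ofReal_re, Complex.ofReal_im, Complex.add_re, Complex.add_im,
      Complex.mul_re, Complex.mul_im, Complex.neg_re, Complex.neg_im, Complex.conj_re,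
      Complex.conj_im, Complex.sub_re, Complex.sub_im, Complex.one_re, Complex.one_im, map_one] <;>
    ring

lemma inner_combLp (hC : Coeffs p q) (hc : 0 < c) (δ : FiniteProblem c) (l₁ l₂ : ℂ)
    (t₁ t₂ : Fin 2 → ℂ) :
    inner ℂ (combLp hC hc δ l₁ t₁) (combLp hC hc δ l₂ t₂) =
      ∫ r in δ.a..δ.b, conj (comb p q c l₁ t₁ r) * comb p q c l₂ t₂ r :=
  inner_toLp_subtype δ.a_lt_b.le _ _

/-- Green's function of the problem, and its quasi-derivative, with pole at `c`, as vectors `u₀`,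
`u₁` of `L²(δ)`: their Fourier coefficients and their Gram matrix. With `χ' = φ₁ + m' φ₂` on
`[a, c]` and `χ = φ₁ + m φ₂` on `[c, b]`, the vector `u₀` is `(χ' + χ) / (m' - m)` and `u₁` is
`(m χ' + m' χ) / (m' - m)`. -/
theorem exists_greenVec (hC : Coeffs p q) (hc : 0 < c) (δ : FiniteProblem c)
    (hl : l.im ≠ 0) {m' m : ℂ}
    (hac : δ.a < c) (hcb : c < δ.b)
    (hm' : BoundaryCondition p δ.β' δ.a (comb p q c l ![1, m']))
    (hm : BoundaryCondition p δ.β δ.b (comb p q c l ![1, m])) :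
    ∃ u : Fin 2 → Lp ℂ 2 (volIcc δ.a δ.b),
      (∀ (s : ℝ) (τ : Fin 2 → ℝ), (fun j => (τ j : ℂ)) ∈ eigenCoeffs p q δ s →
        ∀ j, inner ℂ (combLp hC hc δ s fun j => (τ j : ℂ)) (u j) = τ j / (s - l)) ∧
      ∀ j k, inner ℂ (u k) (u j) = (((matrixM m' m j k).im / l.im : ℝ) : ℂ) := by
  have hI' : ∫ r in δ.a..c, ‖comb p q c l ![1, m'] r‖ ^ 2 = -(m'.im / l.im) := by
    rw [intervalIntegral.integral_symm,
      integral_eq_of_mem_weylCircle hC hc hl δ.a_pos ⟨δ.β', δ.β'_mem, hm'⟩]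
  have hI : ∫ r in c..δ.b, ‖comb p q c l ![1, m] r‖ ^ 2 = m.im / l.im :=
    integral_eq_of_mem_weylCircle hC hc hl δ.b_pos ⟨δ.β, δ.β_mem, hm⟩
  have hne : ∀ z : ℂ, (![1, z] : Fin 2 → ℂ) ≠ 0 := fun z h => by simpa using congrFun h 0
  have hD : m' - m ≠ 0 := fun h => by
    have h1 := integral_norm_comb_pos hC hc l (hne m') δ.a_pos hac
    have h2 := integral_norm_comb_pos hC hc l (hne m) hc hcb
    rw [hI'] at h1
    rw [hI] at h2
    rw [sub_eq_zero] at h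
    rw [h] at h1
    linarith
  have hcont : ∀ z : ℂ, MemLp (fun x : Set.Icc δ.a δ.b => comb p q c l ![1, z] x) 2
      (volIcc δ.a δ.b) := fun z =>
    memLp_subtype_of_continuousOn ((continuousOn_comb hC hc l _).mono δ.Icc_subset)
  have hA : MemLp (fun x : Set.Icc δ.a δ.b =>
      (Set.Iic c).indicator (comb p q c l ![1, m']) x) 2 (volIcc δ.a δ.b) :=
    (hcont m').indicator (measurable_subtype_coe measurableSet_Iic)
  have hB : MemLp (fun x : Set.Icc δ.a δ.b =>
      (Set.Ioi c).indicator (comb p q c l ![1, m]) x) 2 (volIcc δ.a δ.b) :=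
    (hcont m).indicator (measurable_subtype_coe measurableSet_Ioi)
  set wa := hA.toLp _ with hwa
  set wb := hB.toLp _ with hwb
  have haa : inner ℂ wa wa = ((-(m'.im / l.im) : ℝ) : ℂ) := by
    rw [hwa, inner_toLp_subtype δ.a_lt_b.le, ← hI', ← intervalIntegral.integral_ofReal,
      ← integral_indicator_Iic hac.le hcb.le]
    refine intervalIntegral.integral_congr fun r _ => ?_
    by_cases hr : r ∈ Set.Iic c
    · simp only [Set.indicator_of_mem hr]
      rw [mul_comm, Complex.mul_conj, Complex.normSq_eq_norm_sq]
    · simp [Set.indicator_of_notMem hr]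
  have hbb : inner ℂ wb wb = ((m.im / l.im : ℝ) : ℂ) := by
    rw [hwb, inner_toLp_subtype δ.a_lt_b.le, ← hI, ← intervalIntegral.integral_ofReal,
      ← integral_indicator_Ioi hac.le hcb.le]
    refine intervalIntegral.integral_congr fun r _ => ?_
    by_cases hr : r ∈ Set.Ioi c
    · simp only [Set.indicator_of_mem hr]
      rw [mul_comm, Complex.mul_conj, Complex.normSq_eq_norm_sq]
    · simp [Set.indicator_of_notMem hr]
  have hab : inner ℂ wa wb = 0 := by
    rw [hwa, hwb, inner_toLp_subtype δ.a_lt_b.le]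
    refine (intervalIntegral.integral_congr (g := fun _ => 0) fun r _ => ?_).trans (by simp)
    by_cases hr : r ≤ c
    · simp [Set.indicator_of_notMem (show r ∉ Set.Ioi c from not_lt.mpr hr)]
    · simp [Set.indicator_of_notMem (show r ∉ Set.Iic c from hr)]
  have hba : inner ℂ wb wa = 0 := by rw [← inner_conj_symm, hab, map_zero]
  set κ : Fin 2 → ℂ := fun j => (![1, m] : Fin 2 → ℂ) j / (m' - m) with hκ
  set κ' : Fin 2 → ℂ := fun j => (![1, m'] : Fin 2 → ℂ) j / (m' - m) with hκ'
  refine ⟨fun j => κ j • wa + κ' j • wb, fun s τ hτ j => ?_, fun j k => ?_⟩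
  · have hreal : ∀ r ∈ Set.Icc δ.a δ.b, conj (comb p q c s (fun j => (τ j : ℂ)) r) =
        comb p q c s (fun j => (τ j : ℂ)) r := fun r hr =>
      conj_comb_ofReal hC hc s τ (δ.Icc_subset hr)
    have hwr : ∀ z : ℂ, wr (comb p q c l ![1, z]) (quasiDeriv p (comb p q c l ![1, z]))
        (comb p q c s fun j => (τ j : ℂ)) (quasiDeriv p (comb p q c s fun j => (τ j : ℂ))) c =
        τ 1 - z * τ 0 := fun z => by
      simp only [wr, comb_self hC hc]
      simp
    have hsubI : Set.uIcc δ.a c ⊆ Set.Ioi 0 := by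
      rw [Set.uIcc_of_le hac.le]; exact fun r hr => δ.a_pos.trans_le hr.1
    have hsubI' : Set.uIcc c δ.b ⊆ Set.Ioi 0 := by
      rw [Set.uIcc_of_le hcb.le]; exact fun r hr => hc.trans_le hr.1
    have h1 : inner ℂ (combLp hC hc δ s fun j => (τ j : ℂ)) wa =
        ∫ r in δ.a..c, comb p q c l ![1, m'] r * comb p q c s (fun j => (τ j : ℂ)) r := by
      rw [combLp, hwa, inner_toLp_subtype δ.a_lt_b.le, ← integral_indicator_Iic hac.le hcb.le]
      refine intervalIntegral.integral_congr fun r hr => ?_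
      rw [Set.uIcc_of_le δ.a_lt_b.le] at hr
      by_cases hr' : r ∈ Set.Iic c
      · simp only [Set.indicator_of_mem hr', hreal r hr, mul_comm]
      · simp [Set.indicator_of_notMem hr']
    have h2 : inner ℂ (combLp hC hc δ s fun j => (τ j : ℂ)) wb =
        ∫ r in c..δ.b, comb p q c l ![1, m] r * comb p q c s (fun j => (τ j : ℂ)) r := by
      rw [combLp, hwb, inner_toLp_subtype δ.a_lt_b.le, ← integral_indicator_Ioi hac.le hcb.le]
      refine intervalIntegral.integral_congr fun r hr => ?_
      rw [Set.uIcc_of_le δ.a_lt_b.le] at hr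
      by_cases hr' : r ∈ Set.Ioi c
      · simp only [Set.indicator_of_mem hr', hreal r hr, mul_comm]
      · simp [Set.indicator_of_notMem hr']
    have g1 := mul_integral_eq_wr_sub hC.pos (comb_sys hC hc l ![1, m'])
      (comb_sys hC hc s fun j => (τ j : ℂ)) hsubI
    have g2 := mul_integral_eq_wr_sub hC.pos (comb_sys hC hc l ![1, m])
      (comb_sys hC hc s fun j => (τ j : ℂ)) hsubI'
    rw [hwr, show wr _ _ _ _ δ.a = 0 from wr_eq_zero_of_boundary hm' hτ.1, ← h1] at g1
    rw [hwr, show wr _ _ _ _ δ.b = 0 from wr_eq_zero_of_boundary hm hτ.2, ← h2] at g2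
    have hsl : (s : ℂ) - l ≠ 0 := fun h => hl (by
      have := congrArg Complex.im h
      simpa using this)
    rw [inner_add_right, inner_smul_right, inner_smul_right, eq_div_iff hsl]
    fin_cases j
    · simp only [hκ, hκ', Fin.zero_eta, Matrix.cons_val_zero]
      field_simp
      linear_combination -g1 - g2
    · simp only [hκ, hκ', Fin.mk_one, Matrix.cons_val_one, Matrix.cons_val_fin_one]
      field_simp
      linear_combination -m * g1 - m' * g2
  · simp only [inner_add_right, inner_add_left, inner_smul_left, inner_smul_right, haa, hbb, hab,
      hba]
    have h := gram_eq_im_matrixM hD j k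
    have hlc : (l.im : ℂ) ≠ 0 := by exact_mod_cast hl
    push_cast
    rw [h]
    simp only [hκ, hκ']
    field_simp
    ring

/-- The eigenvalues, as the support of the chosen eigenvectors. -/
def eigSet (p q : ℝ → ℝ) {c : ℝ} (δ : FiniteProblem c) : Set ℝ := {s | eigVec p q δ s ≠ 0}

lemma eigVec_mem (hC : Coeffs p q) (hc : 0 < c) (δ : FiniteProblem c) {s : ℝ}
    (hs : s ∈ eigSet p q δ) :
    (fun j => (eigVec p q δ s j : ℂ)) ∈ eigenCoeffs p q δ s ∧
    (∫ r in δ.a..δ.b, ‖comb p q c s (fun j => (eigVec p q δ s j : ℂ)) r‖ ^ 2) = 1 ∧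
    ∀ t ∈ eigenCoeffs p q δ s, ∃ z : ℂ, t = z • fun j => (eigVec p q δ s j : ℂ) :=
  (eigVec_spec hC hc δ s).resolve_left fun h => hs h.1

/-- The normalized eigenfunctions in `L²(δ)`. -/
noncomputable def eigLp (hC : Coeffs p q) (hc : 0 < c) (δ : FiniteProblem c)
    (s : eigSet p q δ) : Lp ℂ 2 (volIcc δ.a δ.b) :=
  combLp hC hc δ (s : ℝ) fun j => (eigVec p q δ s j : ℂ)

lemma orthonormal_eigLp (hC : Coeffs p q) (hc : 0 < c) (δ : FiniteProblem c) :
    Orthonormal ℂ (eigLp hC hc δ) := by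
  classical
  rw [orthonormal_iff_ite]
  intro s s'
  obtain ⟨hs, hn, -⟩ := eigVec_mem hC hc δ s.2
  rw [eigLp, eigLp, inner_combLp]
  split_ifs with h
  · subst h
    have := integral_comb_conj_of_norm hn
    rw [← Complex.ofReal_one, ← this]
    exact intervalIntegral.integral_congr fun r _ => mul_comm _ _
  · have hne : (s : ℂ) - s' ≠ 0 := by
      rw [sub_ne_zero]
      exact_mod_cast fun h' => h (Subtype.ext h')
    obtain ⟨hs', -, -⟩ := eigVec_mem hC hc δ s'.2
    have hsub : Set.uIcc δ.a δ.b ⊆ Set.Ioi 0 := by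
      rw [Set.uIcc_of_le δ.a_lt_b.le]; exact δ.Icc_subset
    have g := mul_integral_eq_wr_sub hC.pos (comb_sys hC hc s fun j => (eigVec p q δ s j : ℂ))
      (comb_sys hC hc s' fun j => (eigVec p q δ s' j : ℂ)) hsub
    rw [show wr _ _ _ _ δ.a = 0 from wr_eq_zero_of_boundary hs.1 hs'.1,
      show wr _ _ _ _ δ.b = 0 from wr_eq_zero_of_boundary hs.2 hs'.2, sub_zero, mul_eq_zero] at g
    rw [← g.resolve_left hne]
    refine intervalIntegral.integral_congr fun r hr => ?_
    rw [conj_comb_ofReal hC hc s _ (hsub hr)]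

/-- In every bounded interval there are only finitely many eigenvalues: by Bessel's inequality
`∑ |τ_s|² / |s - i|²` is finite, while normalization bounds `|τ_s|` from below. -/
theorem finite_eigSet_inter (hC : Coeffs p q) (hc : 0 < c) (δ : FiniteProblem c)
    (hac : δ.a < c) (hcb : c < δ.b) (R : ℝ) :
    {s ∈ eigSet p q δ | |s| ≤ R}.Finite := by
  have hl : Complex.I.im ≠ 0 := by simp
  obtain ⟨m', -, hm'⟩ := exists_mem_weylCircle hC hc hl δ.a_pos hac.ne δ.β'_mem
  obtain ⟨m, -, hm⟩ := exists_mem_weylCircle hC hc hl δ.b_pos hcb.ne' δ.β_mem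
  obtain ⟨u, hu, -⟩ := exists_greenVec hC hc δ hl hac hcb hm' hm
  have hsum : Summable fun s : eigSet p q δ =>
      ∑ j : Fin 2, ‖inner ℂ (eigLp hC hc δ s) (u j)‖ ^ 2 :=
    summable_sum fun j _ => (orthonormal_eigLp hC hc δ).inner_products_summable (u j)
  obtain ⟨B, hB, hphi⟩ := exists_phi_bound hC hc δ.a_pos δ.c_mem R
  have hL : 0 < δ.b - δ.a := sub_pos.mpr δ.a_lt_b
  -- `k` is a lower bound for the terms of the summable series at eigenvalues in `[-R, R]`
  set k : ℝ := 1 / (2 * B ^ 2 * (δ.b - δ.a) * (R ^ 2 + 1)) with hk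
  have hkpos : 0 < k := by positivity
  have hev := hsum.tendsto_cofinite_zero.eventually (gt_mem_nhds hkpos)
  have hfin : {s : eigSet p q δ | ¬ ∑ j : Fin 2, ‖inner ℂ (eigLp hC hc δ s) (u j)‖ ^ 2 < k}.Finite :=
    hev
  refine (hfin.image (Subtype.val)).subset ?_
  rintro s ⟨hs, hsR⟩
  refine ⟨⟨s, hs⟩, ?_, rfl⟩
  simp only [Set.mem_ofPred_eq, not_lt]
  obtain ⟨hmem, hn, -⟩ := eigVec_mem hC hc δ hs
  set τ := eigVec p q δ s with hτ
  have hin : ∀ j, ‖inner ℂ (eigLp hC hc δ ⟨s, hs⟩) (u j)‖ ^ 2 = τ j ^ 2 / (s ^ 2 + 1) := fun j => by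
    rw [eigLp, hu s _ hmem j, norm_div, div_pow, ← Complex.normSq_eq_norm_sq,
      ← Complex.normSq_eq_norm_sq]
    simp only [Complex.normSq_apply, Complex.sub_re, Complex.sub_im, Complex.ofReal_re,
      Complex.ofReal_im, Complex.I_re, Complex.I_im, hτ]
    congr 1 <;> ring
  simp only [hin, Fin.sum_univ_two]
  have h1 : (1 : ℝ) ≤ 2 * B ^ 2 * (τ 0 ^ 2 + τ 1 ^ 2) * (δ.b - δ.a) := by
    rw [← hn]
    calc ∫ r in δ.a..δ.b, ‖comb p q c s (fun j => (τ j : ℂ)) r‖ ^ 2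
        ≤ ∫ r in δ.a..δ.b, 2 * B ^ 2 * (τ 0 ^ 2 + τ 1 ^ 2) := by
          refine intervalIntegral.integral_mono_on δ.a_lt_b.le ?_ (by simp) fun r hr => ?_
          · refine ContinuousOn.intervalIntegrable ?_
            rw [Set.uIcc_of_le δ.a_lt_b.le]
            exact ((continuousOn_comb hC hc s _).mono δ.Icc_subset).norm.pow 2
          · have h0 := hphi 0 s (by simpa using hsR) r hr
            have h1 := hphi 1 s (by simpa using hsR) r hr
            have h2 : ‖comb p q c s (fun j => (τ j : ℂ)) r‖ ≤ |τ 0| * B + |τ 1| * B := by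
              rw [comb_eq]
              refine (norm_add_le _ _).trans ?_
              rw [norm_mul, norm_mul, Complex.norm_real, Complex.norm_real, Real.norm_eq_abs,
                Real.norm_eq_abs]
              gcongr
            have h3 := norm_nonneg (comb p q c s (fun j => (τ j : ℂ)) r)
            rw [← sq_abs (τ 0), ← sq_abs (τ 1)]
            nlinarith [sq_nonneg (|τ 0| * B - |τ 1| * B)]
      _ = _ := by rw [intervalIntegral.integral_const, smul_eq_mul]; ring
  have hs2 : s ^ 2 ≤ R ^ 2 := sq_le_sq' (by linarith [neg_abs_le s]) (by linarith [le_abs_self s])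
  rw [hk, ← add_div, div_le_div_iff₀ (by positivity) (by positivity)]
  nlinarith [mul_nonneg (by linarith : (0 : ℝ) ≤ 2 * B ^ 2 * (τ 0 ^ 2 + τ 1 ^ 2) * (δ.b - δ.a) - 1)
    (by positivity : (0 : ℝ) ≤ R ^ 2 + 1)]

end

/-! ### The resolvent at a real point and completeness of the eigenfunctions -/

section

variable {p q : ℝ → ℝ} {c : ℝ}

/-- The data of the resolvent at a real `s₀` which is not an eigenvalue: real solutions with
coefficients `va`, `vb` satisfying the boundary conditions at `a` and at `b`, respectively, and
linearly independent. -/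
structure ResolventData (p q : ℝ → ℝ) {c : ℝ} (δ : FiniteProblem c) (s₀ : ℝ)
    (va vb : Fin 2 → ℝ) : Prop where
  left : BoundaryCondition p δ.β' δ.a (comb p q c s₀ fun j => (va j : ℂ))
  right : BoundaryCondition p δ.β δ.b (comb p q c s₀ fun j => (vb j : ℂ))
  wronskian_ne_zero : va 0 * vb 1 - va 1 * vb 0 ≠ 0

/-- If the solutions adapted to the two boundary conditions were dependent, they would be
eigenfunctions. -/
lemma exists_resolventData (hC : Coeffs p q) (hc : 0 < c) (δ : FiniteProblem c) {s₀ : ℝ}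
    (hs : s₀ ∉ eigSet p q δ) : ∃ va vb, ResolventData p q δ s₀ va vb := by
  obtain ⟨va, hva0, hva⟩ := exists_boundary_vec hC hc s₀ δ.β' δ.a_pos
  obtain ⟨vb, hvb0, hvb⟩ := exists_boundary_vec hC hc s₀ δ.β δ.b_pos
  have ha := (hva _).mpr ⟨1, (one_smul ℂ _).symm⟩
  have hb := (hvb _).mpr ⟨1, (one_smul ℂ _).symm⟩
  refine ⟨va, vb, ha, hb, fun hW => hva0 ?_⟩
  have hmem : (fun j => (va j : ℂ)) ∈ eigenCoeffs p q δ s₀ := by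
    refine ⟨ha, (hvb _).mpr ?_⟩
    have hN : vb 0 ^ 2 + vb 1 ^ 2 ≠ 0 := fun h => hvb0 (by
      ext j
      fin_cases j
      · simp only [Fin.zero_eta, Pi.zero_apply]; nlinarith [sq_nonneg (vb 0), sq_nonneg (vb 1)]
      · simp only [Fin.mk_one, Pi.zero_apply]; nlinarith [sq_nonneg (vb 0), sq_nonneg (vb 1)])
    refine ⟨((va 0 * vb 0 + va 1 * vb 1) / (vb 0 ^ 2 + vb 1 ^ 2) : ℝ), ?_⟩
    ext j
    simp only [Pi.smul_apply, smul_eq_mul]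
    rw [← Complex.ofReal_mul, Complex.ofReal_inj]
    fin_cases j
    · simp only [Fin.zero_eta]
      field_simp
      linear_combination vb 1 * hW
    · simp only [Fin.mk_one]
      field_simp
      linear_combination -vb 0 * hW
  have h0 : eigVec p q δ s₀ = 0 := by simpa [eigSet] using hs
  rcases eigVec_spec hC hc δ s₀ with ⟨-, h⟩ | ⟨-, h, -⟩
  · have := h _ hmem
    ext j
    simpa using congrFun this j
  · rw [h0] at h
    simp [comb_eq] at h

/-- Green's function at a real point which is not an eigenvalue. -/
noncomputable def resolventKernel (hC : Coeffs p q) (hc : 0 < c) (δ : FiniteProblem c) (s₀ : ℝ)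
    (va vb : Fin 2 → ℝ) : C(Set.Icc δ.a δ.b × Set.Icc δ.a δ.b, ℝ) where
  toFun z := -((comb p q c s₀ (fun j => (va j : ℂ)) (min z.1 z.2 : Set.Icc δ.a δ.b)).re *
    (comb p q c s₀ (fun j => (vb j : ℂ)) (max z.1 z.2 : Set.Icc δ.a δ.b)).re) /
      (va 0 * vb 1 - va 1 * vb 0)
  continuous_toFun := by
    have hcont : ∀ v : Fin 2 → ℂ,
        Continuous fun x : Set.Icc δ.a δ.b => (comb p q c s₀ v x).re := fun v =>
      Complex.continuous_re.comp (continuousOn_iff_continuous_domRestrict.mp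
        ((continuousOn_comb hC hc s₀ v).mono δ.Icc_subset))
    have h1 := (hcont fun j => (va j : ℂ)).comp
      (continuous_fst.min continuous_snd : Continuous fun z : Set.Icc δ.a δ.b × Set.Icc δ.a δ.b =>
        min z.1 z.2)
    have h2 := (hcont fun j => (vb j : ℂ)).comp
      (continuous_fst.max continuous_snd : Continuous fun z : Set.Icc δ.a δ.b × Set.Icc δ.a δ.b =>
        max z.1 z.2)
    exact ((h1.mul h2).neg).div_const _

lemma resolventKernel_symm (hC : Coeffs p q) (hc : 0 < c) (δ : FiniteProblem c) (s₀ : ℝ)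
    (va vb : Fin 2 → ℝ) (x y : Set.Icc δ.a δ.b) :
    resolventKernel hC hc δ s₀ va vb (x, y) = resolventKernel hC hc δ s₀ va vb (y, x) := by
  simp only [resolventKernel, ContinuousMap.coe_mk, min_comm, max_comm]

lemma intervalIntegrable_comb_mul (hC : Coeffs p q) (hc : 0 < c) (δ : FiniteProblem c) (l : ℂ)
    (v : Fin 2 → ℂ) {F : ℝ → ℂ} (hF : IntegrableOn F (Set.Icc δ.a δ.b)) {x y : ℝ}
    (hx : x ∈ Set.Icc δ.a δ.b) (hy : y ∈ Set.Icc δ.a δ.b) :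
    IntervalIntegrable (fun r => comb p q c l v r * F r) volume x y := by
  have := hF.continuousOn_mul ((continuousOn_comb hC hc l v).mono δ.Icc_subset) isCompact_Icc
  exact (this.mono_set (Set.uIcc_subset_Icc hx hy)).intervalIntegrable

lemma integral_resolventKernel (hC : Coeffs p q) (hc : 0 < c) (δ : FiniteProblem c) (s₀ : ℝ)
    (va vb : Fin 2 → ℝ) {f : Set.Icc δ.a δ.b → ℂ} {F : ℝ → ℂ}
    (hF : IntegrableOn F (Set.Icc δ.a δ.b)) (hfF : ∀ᵐ x ∂(volIcc δ.a δ.b), f x = F x)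
    (x : Set.Icc δ.a δ.b) :
    ∫ y, (resolventKernel hC hc δ s₀ va vb (x, y) : ℂ) * f y ∂(volIcc δ.a δ.b) =
      -(comb p q c s₀ (fun j => (vb j : ℂ)) x *
          (∫ r in δ.a..x, comb p q c s₀ (fun j => (va j : ℂ)) r * F r) +
        comb p q c s₀ (fun j => (va j : ℂ)) x *
          (∫ r in (x : ℝ)..δ.b, comb p q c s₀ (fun j => (vb j : ℂ)) r * F r)) /
        ((va 0 * vb 1 - va 1 * vb 0 : ℝ) : ℂ) := by
  set W : ℝ := va 0 * vb 1 - va 1 * vb 0 with hW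
  set ψa := comb p q c s₀ (fun j => (va j : ℂ)) with hψa
  set ψb := comb p q c s₀ (fun j => (vb j : ℂ)) with hψb
  have hra : ∀ r ∈ Set.Icc δ.a δ.b, ((ψa r).re : ℂ) = ψa r := fun r hr =>
    Complex.conj_eq_iff_re.mp (conj_comb_ofReal hC hc s₀ va (δ.Icc_subset hr))
  have hrb : ∀ r ∈ Set.Icc δ.a δ.b, ((ψb r).re : ℂ) = ψb r := fun r hr =>
    Complex.conj_eq_iff_re.mp (conj_comb_ofReal hC hc s₀ vb (δ.Icc_subset hr))
  set Gr : ℝ → ℂ := fun y => -(ψa (min (x : ℝ) y) * ψb (max (x : ℝ) y)) / (W : ℂ) with hGr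
  have h1 : ∫ y, (resolventKernel hC hc δ s₀ va vb (x, y) : ℂ) * f y ∂(volIcc δ.a δ.b) =
      ∫ y in δ.a..δ.b, Gr y * F y := by
    rw [← integral_subtype_Icc δ.a_lt_b.le (fun y => Gr y * F y)]
    refine integral_congr_ae ?_
    filter_upwards [hfF] with y hy
    rw [hy]
    congr 1
    simp only [resolventKernel, ContinuousMap.coe_mk, hGr, ← hψa, ← hψb, ← hW]
    have e1 : ((min x y : Set.Icc δ.a δ.b) : ℝ) = min (x : ℝ) y := rfl
    have e2 : ((max x y : Set.Icc δ.a δ.b) : ℝ) = max (x : ℝ) y := rfl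
    rw [← e1, ← e2, ← hra _ (min x y).2, ← hrb _ (max x y).2]
    push_cast
    simp only [Complex.ofReal_re]
  have ha : δ.a ∈ Set.Icc δ.a δ.b := ⟨le_rfl, δ.a_lt_b.le⟩
  have hb : δ.b ∈ Set.Icc δ.a δ.b := ⟨δ.a_lt_b.le, le_rfl⟩
  have hl : Set.EqOn (fun y => Gr y * F y) (fun y => (-ψb x / W) * (ψa y * F y))
      (Set.uIcc δ.a x) := fun y hy => by
    rw [Set.uIcc_of_le x.2.1] at hy
    simp only [hGr, min_eq_right hy.2, max_eq_left hy.2]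
    ring
  have hr : Set.EqOn (fun y => Gr y * F y) (fun y => (-ψa x / W) * (ψb y * F y))
      (Set.uIcc x δ.b) := fun y hy => by
    rw [Set.uIcc_of_le x.2.2] at hy
    simp only [hGr, min_eq_left hy.1, max_eq_right hy.1]
    ring
  have i1 : IntervalIntegrable (fun y => Gr y * F y) volume δ.a x :=
    ((intervalIntegrable_comb_mul hC hc δ s₀ (fun j => (va j : ℂ)) hF ha x.2).const_mul
      (-ψb x / W)).congr_uIoo fun y hy => (hl (Set.Ioo_subset_Icc_self hy)).symm
  have i2 : IntervalIntegrable (fun y => Gr y * F y) volume x δ.b :=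
    ((intervalIntegrable_comb_mul hC hc δ s₀ (fun j => (vb j : ℂ)) hF x.2 hb).const_mul
      (-ψa x / W)).congr_uIoo fun y hy => (hr (Set.Ioo_subset_Icc_self hy)).symm
  rw [h1, ← intervalIntegral.integral_add_adjacent_intervals i1 i2,
    intervalIntegral.integral_congr hl, intervalIntegral.integral_congr hr,
    intervalIntegral.integral_const_mul, intervalIntegral.integral_const_mul]
  ring

/-- Eigenfunctions of the resolvent for nonzero eigenvalues are eigenfunctions of the problem. -/
lemma eigenvector_kernelOp (hC : Coeffs p q) (hc : 0 < c) (δ : FiniteProblem c) {s₀ : ℝ}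
    {va vb : Fin 2 → ℝ} (h : ResolventData p q δ s₀ va vb) {μ : ℝ} (hμ : μ ≠ 0)
    {f : Lp ℂ 2 (volIcc δ.a δ.b)}
    (hf : kernelOp (resolventKernel hC hc δ s₀ va vb) f = (μ : ℂ) • f) :
    ∃ t ∈ eigenCoeffs p q δ (s₀ + 1 / μ),
      f = (μ : ℂ)⁻¹ • combLp hC hc δ ((s₀ + 1 / μ : ℝ) : ℂ) t := by
  have hμc : (μ : ℂ) ≠ 0 := by exact_mod_cast hμ
  set g : C(Set.Icc δ.a δ.b, ℂ) :=
    (kernelMap (μ := volIcc δ.a δ.b) (resolventKernel hC hc δ s₀ va vb) f).toContinuousMap with hg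
  set F : ℝ → ℂ := fun r => (μ : ℂ)⁻¹ * Set.IccExtend δ.a_lt_b.le g r with hFdef
  have hFc : Continuous F := continuous_const.mul g.continuous.Icc_extend'
  have hgx : ∀ x, g x = ∫ y, (resolventKernel hC hc δ s₀ va vb (x, y) : ℂ) * f y
      ∂(volIcc δ.a δ.b) := fun x => kernelMap_apply _ f x
  have hFx : ∀ x : Set.Icc δ.a δ.b, F x = (μ : ℂ)⁻¹ * g x := fun x => by
    simp only [hFdef, Set.IccExtend_val]
  have hfF : ∀ᵐ x ∂(volIcc δ.a δ.b), f x = F x := by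
    have h1 := kernelOp_coe (resolventKernel hC hc δ s₀ va vb) f
    rw [hf] at h1
    filter_upwards [h1, Lp.coeFn_smul (μ : ℂ) f] with x hx hx2
    rw [hFx, hgx, ← hx, hx2, Pi.smul_apply, smul_eq_mul, inv_mul_cancel_left₀ hμc]
  set W : ℝ := va 0 * vb 1 - va 1 * vb 0 with hW
  have hWc : (W : ℂ) ≠ 0 := by exact_mod_cast h.wronskian_ne_zero
  set ta : Fin 2 → ℂ := fun j => (va j : ℂ) with hta
  set tb : Fin 2 → ℂ := fun j => (vb j : ℂ) with htb
  set ψa := comb p q c s₀ ta with hψa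
  set ψb := comb p q c s₀ tb with hψb
  set α : ℝ → ℂ := fun x => ∫ r in δ.a..x, ψa r * F r with hα
  set β : ℝ → ℂ := fun x => ∫ r in δ.b..x, ψb r * F r with hβ
  have hαd : ∀ r, 0 < r → HasDerivAt α (ψa r * F r) r := fun r hr =>
    hasDerivAt_integral_of_continuousOn ((continuousOn_comb hC hc s₀ ta).mul hFc.continuousOn)
      δ.a_pos hr
  have hβd : ∀ r, 0 < r → HasDerivAt β (ψb r * F r) r := fun r hr =>
    hasDerivAt_integral_of_continuousOn ((continuousOn_comb hC hc s₀ tb).mul hFc.continuousOn)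
      δ.b_pos hr
  set U : ℝ → ℂ := fun r => (ψa r * β r - ψb r * α r) / W with hU
  set V : ℝ → ℂ := fun r => (quasiDeriv p ψa r * β r - quasiDeriv p ψb r * α r) / W with hV
  have hUF : ∀ r ∈ Set.Icc δ.a δ.b, U r = μ * F r := fun r hr => by
    have h1 := hFx ⟨r, hr⟩
    rw [hgx, integral_resolventKernel hC hc δ s₀ va vb
      (hFc.continuousOn.integrableOn_compact isCompact_Icc) hfF ⟨r, hr⟩] at h1
    simp only at h1
    rw [h1, intervalIntegral.integral_symm δ.b r, ← mul_assoc, mul_inv_cancel₀ hμc, one_mul]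
    simp only [hU, hα, hβ, ← hψa, ← hψb, ← hta, ← htb]
    ring
  have hsa := comb_sys hC hc (s₀ : ℂ) ta
  have hsb := comb_sys hC hc (s₀ : ℂ) tb
  have hwr : ∀ r, 0 < r → ψa r * quasiDeriv p ψb r - quasiDeriv p ψa r * ψb r = W := fun r hr => by
    have := wr_const hC.pos hsa hsb (a := c) (b := r) fun t ht => (lt_min hc hr).trans_le ht.1
    simp only [wr, comb_self hC hc] at this
    rw [this, hW]
    push_cast
    rfl
  have hsys : Sys p q ((s₀ + 1 / μ : ℝ) : ℂ) (Set.Icc δ.a δ.b) U V := fun r hr => by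
    have hr0 : 0 < r := δ.Icc_subset hr
    have hpr : (p r : ℂ) ≠ 0 := by exact_mod_cast (hC.pos r hr0).ne'
    constructor
    · refine ((((hsa r hr0).1.mul (hβd r hr0)).sub
        ((hsb r hr0).1.mul (hαd r hr0))).div_const (W : ℂ)).congr_deriv ?_
      simp only [hV]
      field_simp
      ring
    · refine ((((hsa r hr0).2.mul (hβd r hr0)).sub
        ((hsb r hr0).2.mul (hαd r hr0))).div_const (W : ℂ)).congr_deriv ?_
      have h2 : (q r - ((s₀ + 1 / μ : ℝ) : ℂ)) * U r = (q r - s₀) * U r - F r := by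
        have : F r = (1 / μ) * U r := by rw [hUF r hr]; field_simp
        rw [this]
        push_cast
        ring
      rw [h2]
      simp only [hU]
      field_simp
      linear_combination -F r * hwr r hr0
  have heq := fun r hr => hsys.eq_comb hC hc δ.Icc_subset Set.ordConnected_Icc δ.c_mem (r := r) hr
  have ha : δ.a ∈ Set.Icc δ.a δ.b := ⟨le_rfl, δ.a_lt_b.le⟩
  have hb : δ.b ∈ Set.Icc δ.a δ.b := ⟨δ.a_lt_b.le, le_rfl⟩
  refine ⟨![U c, V c], ⟨?_, ?_⟩, ?_⟩
  · have h1 := h.left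
    rw [BoundaryCondition] at h1 ⊢
    rw [← (heq _ ha).1, ← (heq _ ha).2]
    have : α δ.a = 0 := intervalIntegral.integral_same
    simp only [hU, hV, this]
    linear_combination (β δ.a / W) * h1
  · have h1 := h.right
    rw [BoundaryCondition] at h1 ⊢
    rw [← (heq _ hb).1, ← (heq _ hb).2]
    have : β δ.b = 0 := intervalIntegral.integral_same
    simp only [hU, hV, this]
    linear_combination (-α δ.b / W) * h1
  · refine Lp.ext ?_
    refine EventuallyEq.trans ?_ (Lp.coeFn_smul _ _).symm
    filter_upwards [hfF, (memLp_subtype_of_continuousOn ((continuousOn_comb hC hc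
      ((s₀ + 1 / μ : ℝ) : ℂ) ![U c, V c]).mono δ.Icc_subset)).coeFn_toLp] with x hx hx2
    rw [Pi.smul_apply, combLp, hx2, hx, ← (heq x x.2).1, hUF x x.2, smul_eq_mul,
      inv_mul_cancel_left₀ hμc]

end

/-! ### The eigenfunction expansion of Green's function -/

section

variable {p q : ℝ → ℝ} {c : ℝ}

lemma ae_volIcc_iff {a b : ℝ} {P : ℝ → Prop} :
    (∀ᵐ x : Set.Icc a b ∂(volIcc a b), P x) ↔ ∀ᵐ x ∂volume.restrict (Set.Icc a b), P x :=
  (ae_restrict_iff_subtype measurableSet_Icc).symm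

/-- The resolvent is injective. For merely square integrable `f` its image need not be twice
differentiable, so the argument uses Lebesgue's differentiation theorem: if the image
`ψa β - ψb α` vanishes, then so does its quasi-derivative, hence `α = β = 0`, hence `f = 0`. -/
lemma kernelOp_injective (hC : Coeffs p q) (hc : 0 < c) (δ : FiniteProblem c) {s₀ : ℝ}
    {va vb : Fin 2 → ℝ} (h : ResolventData p q δ s₀ va vb) {f : Lp ℂ 2 (volIcc δ.a δ.b)}
    (hf : kernelOp (resolventKernel hC hc δ s₀ va vb) f = 0) : f = 0 := by
  set F : ℝ → ℂ := fun r => f (Set.projIcc δ.a δ.b δ.a_lt_b.le r) with hFdef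
  have hFx : ∀ x : Set.Icc δ.a δ.b, f x = F x := fun x => by
    simp only [hFdef, Set.projIcc_val]
  have hF : IntegrableOn F (Set.Icc δ.a δ.b) := by
    rw [integrableOn_iff_comap_subtypeVal measurableSet_Icc]
    have : F ∘ Subtype.val = (f : Set.Icc δ.a δ.b → ℂ) := funext fun x => (hFx x).symm
    rw [this]
    exact (Lp.memLp f).integrable (by norm_num)
  set W : ℝ := va 0 * vb 1 - va 1 * vb 0 with hW
  have hWc : (W : ℂ) ≠ 0 := by exact_mod_cast h.wronskian_ne_zero
  set ta : Fin 2 → ℂ := fun j => (va j : ℂ) with hta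
  set tb : Fin 2 → ℂ := fun j => (vb j : ℂ) with htb
  set ψa := comb p q c s₀ ta with hψa
  set ψb := comb p q c s₀ tb with hψb
  set α : ℝ → ℂ := fun x => ∫ r in δ.a..x, ψa r * F r with hα
  set β : ℝ → ℂ := fun x => ∫ r in δ.b..x, ψb r * F r with hβ
  have hsa := comb_sys hC hc (s₀ : ℂ) ta
  have hsb := comb_sys hC hc (s₀ : ℂ) tb
  have hwr : ∀ r, 0 < r → ψa r * quasiDeriv p ψb r - quasiDeriv p ψa r * ψb r = W := fun r hr => by
    have := wr_const hC.pos hsa hsb (a := c) (b := r) fun t ht => (lt_min hc hr).trans_le ht.1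
    simp only [wr, comb_self hC hc] at this
    rw [this, hW]
    push_cast
    rfl
  have ha : δ.a ∈ Set.Icc δ.a δ.b := ⟨le_rfl, δ.a_lt_b.le⟩
  have hb : δ.b ∈ Set.Icc δ.a δ.b := ⟨δ.a_lt_b.le, le_rfl⟩
  have ia := intervalIntegrable_comb_mul hC hc δ s₀ ta hF ha hb
  have ib := intervalIntegrable_comb_mul hC hc δ s₀ tb hF ha hb
  have huIcc : Set.uIcc δ.a δ.b = Set.Icc δ.a δ.b := Set.uIcc_of_le δ.a_lt_b.le
  have hαc : ContinuousOn α (Set.Ioo δ.a δ.b) := by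
    have := intervalIntegral.continuousOn_primitive_interval' ia (a := δ.a)
      (by rw [huIcc]; exact ha)
    rw [huIcc] at this
    exact this.mono Set.Ioo_subset_Icc_self
  have hβc : ContinuousOn β (Set.Ioo δ.a δ.b) := by
    have := intervalIntegral.continuousOn_primitive_interval' ib (a := δ.b)
      (by rw [huIcc]; exact hb)
    rw [huIcc] at this
    exact this.mono Set.Ioo_subset_Icc_self
  have hpos : Set.Ioo δ.a δ.b ⊆ Set.Ioi 0 := Set.Ioo_subset_Icc_self.trans δ.Icc_subset
  have hrestr : volume.restrict (Set.Icc δ.a δ.b) = volume.restrict (Set.Ioo δ.a δ.b) :=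
    Measure.restrict_congr_set Ioo_ae_eq_Icc.symm
  -- `T f = 0` says that `ψa β = ψb α`, first almost everywhere and then by continuity.
  have h0 : Set.EqOn (fun r => ψa r * β r - ψb r * α r) (fun _ => 0) (Set.Ioo δ.a δ.b) := by
    refine Measure.eqOn_open_of_ae_eq (μ := volume) ?_ isOpen_Ioo ?_ continuousOn_const
    · rw [← hrestr]
      refine ae_volIcc_iff.mp ?_
      have h1 := kernelOp_coe (resolventKernel hC hc δ s₀ va vb) f
      rw [hf] at h1
      filter_upwards [h1, Lp.coeFn_zero ℂ 2 (volIcc δ.a δ.b)] with x hx hx0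
      rw [hx0, integral_resolventKernel hC hc δ s₀ va vb hF (Eventually.of_forall hFx) x,
        intervalIntegral.integral_symm δ.b (x : ℝ)] at hx
      have := (div_eq_zero_iff.mp hx.symm).resolve_right hWc
      simp only [hα, hβ]
      linear_combination this
    · exact ((hsa.continuousOn.1.mono hpos).mul hβc).sub ((hsb.continuousOn.1.mono hpos).mul hαc)
  have hd : ∀ᵐ x ∂volume.restrict (Set.Ioo δ.a δ.b), x ∈ Set.Ioo δ.a δ.b ∧
      HasDerivAt α (ψa x * F x) x ∧ HasDerivAt β (ψb x * F x) x := by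
    filter_upwards [ae_restrict_of_ae ia.ae_hasDerivAt_integral,
      ae_restrict_of_ae ib.ae_hasDerivAt_integral, ae_restrict_mem measurableSet_Ioo]
      with x h1 h2 hx
    have hx' : x ∈ Set.uIcc δ.a δ.b := by rw [huIcc]; exact Set.Ioo_subset_Icc_self hx
    exact ⟨hx, h1 hx' _ Set.left_mem_uIcc, h2 hx' _ Set.right_mem_uIcc⟩
  have hαβ : ∀ᵐ x ∂volume.restrict (Set.Ioo δ.a δ.b), α x = 0 ∧ β x = 0 := by
    filter_upwards [hd] with x ⟨hx, h1, h2⟩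
    have hx0 := hpos hx
    have hpx : (p x : ℂ) ≠ 0 := by exact_mod_cast (hC.pos x hx0).ne'
    have hder := ((hsa x hx0).1.mul h2).sub ((hsb x hx0).1.mul h1)
    have hzero : HasDerivAt (fun r => ψa r * β r - ψb r * α r) 0 x :=
      (hasDerivAt_const x (0 : ℂ)).congr_of_eventuallyEq
        (h0.eventuallyEq_of_mem (Ioo_mem_nhds hx.1 hx.2))
    have e1 := hder.unique hzero
    have e2 : quasiDeriv p ψa x * β x - quasiDeriv p ψb x * α x = 0 := by
      field_simp at e1
      linear_combination e1
    have e3 : ψa x * β x - ψb x * α x = 0 := h0 hx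
    have e4 := hwr x hx0
    constructor
    · refine (mul_eq_zero.mp (?_ : (W : ℂ) * α x = 0)).resolve_left hWc
      linear_combination -α x * e4 - ψa x * e2 + quasiDeriv p ψa x * e3
    · refine (mul_eq_zero.mp (?_ : (W : ℂ) * β x = 0)).resolve_left hWc
      linear_combination -β x * e4 - ψb x * e2 + quasiDeriv p ψb x * e3
  have hα0 : Set.EqOn α (fun _ => 0) (Set.Ioo δ.a δ.b) :=
    Measure.eqOn_open_of_ae_eq (hαβ.mono fun x hx => hx.1) isOpen_Ioo hαc continuousOn_const
  have hβ0 : Set.EqOn β (fun _ => 0) (Set.Ioo δ.a δ.b) :=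
    Measure.eqOn_open_of_ae_eq (hαβ.mono fun x hx => hx.2) isOpen_Ioo hβc continuousOn_const
  have hFz : ∀ᵐ x ∂volume.restrict (Set.Ioo δ.a δ.b), F x = 0 := by
    filter_upwards [hd] with x ⟨hx, h1, h2⟩
    have hnhds := Ioo_mem_nhds hx.1 hx.2
    have z1 := h1.unique ((hasDerivAt_const x (0 : ℂ)).congr_of_eventuallyEq
      (hα0.eventuallyEq_of_mem hnhds))
    have z2 := h2.unique ((hasDerivAt_const x (0 : ℂ)).congr_of_eventuallyEq
      (hβ0.eventuallyEq_of_mem hnhds))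
    refine (mul_eq_zero.mp (?_ : (W : ℂ) * F x = 0)).resolve_left hWc
    linear_combination -F x * hwr x (hpos hx) + quasiDeriv p ψb x * z1 - quasiDeriv p ψa x * z2
  rw [← hrestr] at hFz
  rw [Lp.eq_zero_iff_ae_eq_zero]
  filter_upwards [ae_volIcc_iff.mpr hFz] with x hx
  rw [hFx, hx]
  rfl

lemma combLp_smul (hC : Coeffs p q) (hc : 0 < c) (δ : FiniteProblem c) (l z : ℂ)
    (t : Fin 2 → ℂ) : combLp hC hc δ l (z • t) = z • combLp hC hc δ l t := by
  rw [combLp, combLp, ← MemLp.toLp_const_smul]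
  refine MemLp.toLp_congr _ _ (Eventually.of_forall fun x => ?_)
  simp only [comb_smul, Pi.smul_apply, smul_eq_mul]

/-- Completeness of the eigenfunctions, from the spectral theorem for the compact resolvent at a
real point `s₀` which is not an eigenvalue. -/
theorem orthogonal_span_eigLp (hC : Coeffs p q) (hc : 0 < c) (δ : FiniteProblem c)
    (hac : δ.a < c) (hcb : c < δ.b) :
    (Submodule.span ℂ (Set.range (eigLp hC hc δ)))ᗮ = ⊥ := by
  obtain ⟨s₀, hs01, hs₀⟩ : ∃ s ∈ Set.Icc (0 : ℝ) 1, s ∉ {s ∈ eigSet p q δ | |s| ≤ 1} :=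
    (Set.Icc_infinite zero_lt_one).exists_notMem_finite (finite_eigSet_inter hC hc δ hac hcb 1)
  have hs₀' : s₀ ∉ eigSet p q δ := fun h => hs₀ ⟨h, abs_le.mpr ⟨by linarith [hs01.1], hs01.2⟩⟩
  obtain ⟨va, vb, h⟩ := exists_resolventData hC hc δ hs₀'
  set T := kernelOp (μ := volIcc δ.a δ.b) (resolventKernel hC hc δ s₀ va vb) with hT
  have hsymm : T.IsSymmetric := isSymmetric_kernelOp (resolventKernel_symm hC hc δ s₀ va vb)
  have hcompl := ContinuousLinearMap.orthogonalComplement_iSup_eigenspaces_eq_bot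
    (isCompactOperator_kernelOp (μ := volIcc δ.a δ.b) (resolventKernel hC hc δ s₀ va vb)) hsymm
  rw [eq_bot_iff, ← hcompl]
  refine Submodule.orthogonal_le (iSup_le fun μ f hf => ?_)
  rw [Module.End.mem_eigenspace_iff] at hf
  have hf' : T f = μ • f := hf
  by_cases hf0 : f = 0
  · rw [hf0]; exact Submodule.zero_mem _
  have hμ : ((μ.re : ℝ) : ℂ) = μ := Complex.conj_eq_iff_re.mp
    (hsymm.conj_eigenvalue_eq_self (Module.End.hasEigenvalue_of_hasEigenvector
      ⟨Module.End.mem_eigenspace_iff.mpr hf, hf0⟩))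
  by_cases hμ0 : μ.re = 0
  · rw [← hμ, hμ0, Complex.ofReal_zero, zero_smul] at hf'
    exact absurd (kernelOp_injective hC hc δ h hf') hf0
  · rw [← hμ] at hf'
    obtain ⟨t, ht, hft⟩ := eigenvector_kernelOp hC hc δ h hμ0 hf'
    rw [hft]
    refine Submodule.smul_mem _ _ ?_
    by_cases hs : s₀ + 1 / μ.re ∈ eigSet p q δ
    · obtain ⟨z, rfl⟩ := (eigVec_mem hC hc δ hs).2.2 t ht
      rw [combLp_smul]
      exact Submodule.smul_mem _ _ (Submodule.subset_span ⟨⟨_, hs⟩, rfl⟩)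
    · have h0 : eigVec p q δ (s₀ + 1 / μ.re) = 0 := by simpa [eigSet] using hs
      have ht0 : t = (0 : ℂ) • t := by
        rcases eigVec_spec hC hc δ (s₀ + 1 / μ.re) with ⟨-, h1⟩ | ⟨-, h1, -⟩
        · rw [h1 t ht, smul_zero]
        · rw [h0] at h1
          simp [comb_eq] at h1
      rw [ht0, combLp_smul, zero_smul]
      exact Submodule.zero_mem _

/-- Parseval's identity for Green's function: the imaginary part of `M` for the finite problem is
the Poisson integral of its spectral matrix. -/
theorem hasSum_im_matrixM (hC : Coeffs p q) (hc : 0 < c) (δ : FiniteProblem c) {l : ℂ}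
    (hl : l.im ≠ 0) {m' m : ℂ} (hac : δ.a < c) (hcb : c < δ.b)
    (hm' : BoundaryCondition p δ.β' δ.a (comb p q c l ![1, m']))
    (hm : BoundaryCondition p δ.β δ.b (comb p q c l ![1, m])) (j k : Fin 2) :
    HasSum (fun s : ℝ => eigVec p q δ s j * eigVec p q δ s k *
      (l.im / ((s - l.re) ^ 2 + l.im ^ 2))) (matrixM m' m j k).im := by
  obtain ⟨u, hu, hgram⟩ := exists_greenVec hC hc δ hl hac hcb hm' hm
  have hsum := (HilbertBasis.mkOfOrthogonalEqBot (orthonormal_eigLp hC hc δ)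
    (orthogonal_span_eigLp hC hc δ hac hcb)).hasSum_inner_mul_inner (u k) (u j)
  rw [HilbertBasis.coe_mkOfOrthogonalEqBot, hgram] at hsum
  have hterm : ∀ s : eigSet p q δ, inner ℂ (u k) (eigLp hC hc δ s) *
      inner ℂ (eigLp hC hc δ s) (u j) = ((eigVec p q δ s j * eigVec p q δ s k *
        (1 / (((s : ℝ) - l.re) ^ 2 + l.im ^ 2)) : ℝ) : ℂ) := fun s => by
    have hmem := (eigVec_mem hC hc δ s.2).1
    rw [← inner_conj_symm, eigLp, hu s _ hmem j, hu s _ hmem k]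
    have hn : ((((s : ℝ) - l.re) ^ 2 + l.im ^ 2 : ℝ) : ℂ) =
        conj (((s : ℝ) : ℂ) - l) * (((s : ℝ) : ℂ) - l) := by
      rw [mul_comm, Complex.mul_conj, Complex.normSq_apply]
      simp only [Complex.sub_re, Complex.sub_im, Complex.ofReal_re, Complex.ofReal_im]
      push_cast
      ring
    have hsl : ((s : ℝ) : ℂ) - l ≠ 0 := fun h => hl (by
      have := congrArg Complex.im h
      simpa using this)
    have hsl' : conj (((s : ℝ) : ℂ) - l) ≠ 0 := (map_ne_zero _).mpr hsl
    rw [Complex.ofReal_mul, Complex.ofReal_div, hn, map_div₀, Complex.conj_ofReal]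
    push_cast
    field_simp
  simp only [hterm] at hsum
  rw [Complex.hasSum_ofReal] at hsum
  have h2 := hsum.mul_left l.im
  rw [mul_div_cancel₀ _ hl] at h2
  have h3 : HasSum ((fun s : ℝ => eigVec p q δ s j * eigVec p q δ s k *
      (l.im / ((s - l.re) ^ 2 + l.im ^ 2))) ∘ (Subtype.val : eigSet p q δ → ℝ))
      (matrixM m' m j k).im := by
    have he : ((fun s : ℝ => eigVec p q δ s j * eigVec p q δ s k *
        (l.im / ((s - l.re) ^ 2 + l.im ^ 2))) ∘ (Subtype.val : eigSet p q δ → ℝ)) =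
        fun s : eigSet p q δ => l.im * (eigVec p q δ s j * eigVec p q δ s k *
          (1 / (((s : ℝ) - l.re) ^ 2 + l.im ^ 2))) := by
      funext s
      simp only [Function.comp]
      ring
    rw [he]
    exact h2
  refine (hasSum_subtype_iff_of_support_subset ?_).mp h3
  intro s hs hs'
  refine hs ?_
  simp only
  rw [hs']
  simp

end

/-! ### The Poisson kernel as an approximate identity -/

section

/-- The Poisson kernel of the upper half-plane at the point `ν + i ε`, without the factor
`1 / π`. -/
noncomputable def poisson (ε ν s : ℝ) : ℝ := ε / ((s - ν) ^ 2 + ε ^ 2)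

theorem poisson_pos {ε : ℝ} (hε : 0 < ε) (ν s : ℝ) : 0 < poisson ε ν s := by
  unfold poisson; positivity

theorem continuous_poisson {ε : ℝ} (hε : 0 < ε) :
    Continuous fun z : ℝ × ℝ => poisson ε z.1 z.2 := by
  unfold poisson
  refine continuous_const.div (by fun_prop) fun z => ?_
  positivity

/-- On bounded sets of `ν`, the Poisson kernel is dominated by a multiple of `1 / (1 + s²)`. -/
theorem exists_poisson_le {ε : ℝ} (hε : 0 < ε) (R : ℝ) :
    ∃ K, 0 < K ∧ ∀ ν, |ν| ≤ R → ∀ s, poisson ε ν s ≤ K * (1 + s ^ 2)⁻¹ := by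
  refine ⟨ε * (1 + 2 * R ^ 2 + 2 * ε ^ 2) / ε ^ 2 + 2 * ε, by positivity, fun ν hν s => ?_⟩
  unfold poisson
  have hν2 : ν ^ 2 ≤ R ^ 2 := sq_le_sq' (by linarith [neg_abs_le ν]) ((le_abs_self ν).trans hν)
  rw [← div_eq_mul_inv, div_le_div_iff₀ (by positivity) (by positivity)]
  have h1 : 1 + s ^ 2 ≤ (1 + 2 * R ^ 2) + 2 * (s - ν) ^ 2 := by nlinarith [sq_nonneg (s - 2 * ν)]
  have h2 : ε * (1 + 2 * R ^ 2 + 2 * ε ^ 2) / ε ^ 2 * ((s - ν) ^ 2 + ε ^ 2) ≥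
      ε * (1 + 2 * R ^ 2 + 2 * ε ^ 2) := by
    rw [ge_iff_le, div_mul_eq_mul_div, le_div_iff₀ (by positivity)]
    have : 0 ≤ ε * (1 + 2 * R ^ 2 + 2 * ε ^ 2) * (s - ν) ^ 2 := by positivity
    nlinarith
  have h3 := mul_le_mul_of_nonneg_left h1 hε.le
  have h4 : 0 ≤ ε * ε ^ 2 := by positivity
  nlinarith

theorem integral_mul_poisson {ε : ℝ} (hε : 0 < ε) (f : ℝ → ℝ) (s : ℝ) :
    ∫ ν, f ν * poisson ε ν s = ∫ u, f (s + ε * u) * (1 + u ^ 2)⁻¹ := by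
  have h1 : ∫ ν, f ν * poisson ε ν s = ∫ t, f (s + t) * poisson ε (s + t) s :=
    (integral_add_left_eq_self (fun ν => f ν * poisson ε ν s) s).symm
  have h2 := Measure.integral_comp_mul_left (fun t => f (s + t) * poisson ε (s + t) s) ε
  rw [abs_of_pos (inv_pos.mpr hε), smul_eq_mul, ← h1] at h2
  have h3 : ∫ ν, f ν * poisson ε ν s =
      ε * ∫ u, f (s + ε * u) * poisson ε (s + ε * u) s := by
    rw [h2, ← mul_assoc, mul_inv_cancel₀ hε.ne', one_mul]
  rw [h3, ← integral_const_mul]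
  refine integral_congr_ae (Eventually.of_forall fun u => ?_)
  simp only [poisson]
  have : (0 : ℝ) < 1 + u ^ 2 := by positivity
  rw [show (s - (s + ε * u)) ^ 2 + ε ^ 2 = ε ^ 2 * (1 + u ^ 2) by ring]
  field_simp

theorem exists_eq_zero_of_lt_abs {f : ℝ → ℝ} (hfc : HasCompactSupport f) :
    ∃ R, ∀ s, R < |s| → f s = 0 := by
  obtain ⟨R, hR⟩ := hfc.isCompact.isBounded.subset_closedBall 0
  refine ⟨R, fun s hs => image_eq_zero_of_notMem_tsupport fun h => ?_⟩
  have := hR h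
  rw [Metric.mem_closedBall, dist_zero_right, Real.norm_eq_abs] at this
  exact absurd this (not_le.mpr hs)

/-- The Poisson kernel is an approximate identity, with the decay needed to integrate the error
against measures for which `1 / (1 + s²)` is integrable. -/
theorem poisson_approx {f : ℝ → ℝ} (hf : Continuous f) (hfc : HasCompactSupport f) {η : ℝ}
    (hη : 0 < η) : ∀ᶠ ε in 𝓝[>] (0 : ℝ), ∀ s,
      |(1 / Real.pi) * (∫ ν, f ν * poisson ε ν s) - f s| ≤ η * (1 + s ^ 2)⁻¹ := by
  obtain ⟨B, hB⟩ := hfc.exists_bound_of_continuous hf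
  have hB0 : 0 ≤ B := (norm_nonneg _).trans (hB 0)
  obtain ⟨R, hR1, hR⟩ : ∃ R : ℝ, 1 ≤ R ∧ ∀ ν, R < |ν| → f ν = 0 := by
    obtain ⟨R, hR⟩ := exists_eq_zero_of_lt_abs hfc
    exact ⟨max R 1, le_max_right _ _, fun ν hν => hR ν ((le_max_left _ _).trans_lt hν)⟩
  have hfint : Integrable f := hf.integrable_of_hasCompactSupport hfc
  set η₁ : ℝ := η / (2 * (1 + 4 * R ^ 2)) with hη₁
  have hη₁0 : 0 < η₁ := by positivity
  obtain ⟨d, hd, hfd⟩ := Metric.uniformContinuous_iff.mp (hfc.uniformContinuous_of_continuous hf)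
    η₁ hη₁0
  -- a modulus of continuity that is itself continuous, so that dominated convergence applies
  have hmod : ∀ s t, |f (s + t) - f s| ≤ η₁ + 2 * B * min 1 (|t| / d) := fun s t => by
    rcases lt_or_ge |t| d with h | h
    · have h1 := hfd (a := s + t) (b := s) (by rw [Real.dist_eq]; simpa using h)
      rw [Real.dist_eq] at h1
      have : 0 ≤ 2 * B * min 1 (|t| / d) := by positivity
      linarith
    · rw [min_eq_left ((one_le_div hd).mpr h)]
      have h1 := abs_sub (f (s + t)) (f s)
      have h2 := hB (s + t)
      have h3 := hB s
      rw [Real.norm_eq_abs] at h2 h3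
      linarith
  have hlim : Tendsto (fun ε : ℝ => ∫ u, (η₁ + 2 * B * min 1 (|ε * u| / d)) * (1 + u ^ 2)⁻¹)
      (𝓝[>] 0) (𝓝 (∫ u : ℝ, η₁ * (1 + u ^ 2)⁻¹)) := by
    refine tendsto_integral_filter_of_dominated_convergence
      (fun u => (η₁ + 2 * B) * (1 + u ^ 2)⁻¹) ?_ ?_ (integrable_inv_one_add_sq.const_mul _) ?_
    · refine Eventually.of_forall fun ε => Continuous.aestronglyMeasurable ?_
      refine Continuous.mul (by fun_prop) (Continuous.inv₀ (by fun_prop) fun u => ?_)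
      positivity
    · refine Eventually.of_forall fun ε => Eventually.of_forall fun u => ?_
      rw [Real.norm_eq_abs, abs_of_nonneg (by positivity)]
      refine mul_le_mul_of_nonneg_right ?_ (by positivity)
      nlinarith [min_le_left (1 : ℝ) (|ε * u| / d)]
    · refine Eventually.of_forall fun u => ?_
      have hc : Continuous fun ε : ℝ => (η₁ + 2 * B * min 1 (|ε * u| / d)) * (1 + u ^ 2)⁻¹ := by
        fun_prop
      have := (hc.tendsto 0).mono_left (nhdsWithin_le_nhds (s := Set.Ioi 0))
      simpa using this
  rw [integral_const_mul, integral_univ_inv_one_add_sq] at hlim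
  have hev := hlim.eventually (gt_mem_nhds (show η₁ * Real.pi < 2 * η₁ * Real.pi by
    nlinarith [Real.pi_pos]))
  set F := ∫ ν, |f ν| with hF
  have hF0 : 0 ≤ F := integral_nonneg fun _ => abs_nonneg _
  have hsmall : ∀ᶠ ε in 𝓝[>] (0 : ℝ), 8 * F * ε < η := by
    have hc : Continuous fun ε : ℝ => 8 * F * ε := by fun_prop
    have := (hc.tendsto 0).mono_left (nhdsWithin_le_nhds (s := Set.Ioi 0))
    rw [mul_zero] at this
    exact this.eventually (gt_mem_nhds hη)
  filter_upwards [hev, hsmall, self_mem_nhdsWithin] with ε h1 h2 h3 s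
  have h3 : 0 < ε := h3
  have hπ := Real.pi_pos
  -- near the support the error is uniformly small; far from it the kernel decays like `ε / s²`
  rcases le_or_gt |s| (2 * R) with hs | hs
  · have hs2 : s ^ 2 ≤ 4 * R ^ 2 := by
      have := sq_le_sq' (by linarith [neg_abs_le s]) ((le_abs_self s).trans hs)
      linarith
    have hcont : Continuous fun u : ℝ => (1 + u ^ 2)⁻¹ :=
      Continuous.inv₀ (by fun_prop) fun u => by positivity
    have hi1 : Integrable fun u : ℝ => f (s + ε * u) * (1 + u ^ 2)⁻¹ :=
      integrable_inv_one_add_sq.bdd_mul (c := B)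
        (hf.comp (by fun_prop : Continuous fun u : ℝ => s + ε * u)).aestronglyMeasurable
        (Eventually.of_forall fun u => hB _)
    have hdiff : (1 / Real.pi) * (∫ ν, f ν * poisson ε ν s) - f s =
        (1 / Real.pi) * ∫ u, (f (s + ε * u) - f s) * (1 + u ^ 2)⁻¹ := by
      simp_rw [sub_mul]
      rw [integral_sub hi1 (integrable_inv_one_add_sq.const_mul _), integral_const_mul,
        integral_univ_inv_one_add_sq, integral_mul_poisson h3]
      field_simp
    have hi2 : Integrable fun u : ℝ => (η₁ + 2 * B * min 1 (|ε * u| / d)) * (1 + u ^ 2)⁻¹ := by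
      refine integrable_inv_one_add_sq.bdd_mul (c := η₁ + 2 * B)
        (by fun_prop :
          Continuous fun u : ℝ => η₁ + 2 * B * min 1 (|ε * u| / d)).aestronglyMeasurable
        (Eventually.of_forall fun u => ?_)
      rw [Real.norm_eq_abs, abs_of_nonneg (by positivity)]
      nlinarith [min_le_left (1 : ℝ) (|ε * u| / d)]
    have hle : |∫ u, (f (s + ε * u) - f s) * (1 + u ^ 2)⁻¹| ≤
        ∫ u, (η₁ + 2 * B * min 1 (|ε * u| / d)) * (1 + u ^ 2)⁻¹ := by
      rw [← Real.norm_eq_abs]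
      refine norm_integral_le_of_norm_le hi2 (Eventually.of_forall fun u => ?_)
      rw [norm_mul, Real.norm_eq_abs, Real.norm_eq_abs,
        abs_of_pos (by positivity : 0 < (1 + u ^ 2)⁻¹)]
      exact mul_le_mul_of_nonneg_right (hmod _ _) (by positivity)
    rw [hdiff, abs_mul, abs_of_pos (by positivity)]
    calc (1 / Real.pi) * |∫ u, (f (s + ε * u) - f s) * (1 + u ^ 2)⁻¹|
        ≤ (1 / Real.pi) * (2 * η₁ * Real.pi) :=
          mul_le_mul_of_nonneg_left (hle.trans h1.le) (by positivity)
      _ = η * (1 + 4 * R ^ 2)⁻¹ := by rw [hη₁]; field_simp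
      _ ≤ η * (1 + s ^ 2)⁻¹ := by gcongr
  · have hs0 : f s = 0 := hR s (by linarith)
    have hs1 : 4 ≤ s ^ 2 := by nlinarith [sq_abs s, abs_nonneg s]
    have hk : ∀ ν, |f ν * poisson ε ν s| ≤ |f ν| * (8 * ε * (1 + s ^ 2)⁻¹) := fun ν => by
      rw [abs_mul]
      rcases lt_or_ge R |ν| with hν | hν
      · simp [hR ν hν]
      · refine mul_le_mul_of_nonneg_left ?_ (abs_nonneg _)
        rw [abs_of_pos (poisson_pos h3 _ _), poisson, ← div_eq_mul_inv,
          div_le_div_iff₀ (by positivity) (by positivity)]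
        have hd2 : s ^ 2 / 4 ≤ (s - ν) ^ 2 := by
          have h5 : |s| / 2 ≤ |s - ν| := by linarith [abs_sub_abs_le_abs_sub s ν]
          have := pow_le_pow_left₀ (by positivity) h5 2
          rw [div_pow, sq_abs, sq_abs] at this
          linarith
        have h4 : 1 + s ^ 2 ≤ 8 * ((s - ν) ^ 2 + ε ^ 2) := by nlinarith [sq_nonneg ε]
        nlinarith
    have hle : |∫ ν, f ν * poisson ε ν s| ≤ F * (8 * ε * (1 + s ^ 2)⁻¹) := by
      rw [hF, ← integral_mul_const, ← Real.norm_eq_abs]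
      exact norm_integral_le_of_norm_le (hfint.abs.mul_const _) (Eventually.of_forall hk)
    rw [hs0, sub_zero, abs_mul, abs_of_pos (by positivity)]
    have hp1 : 1 / Real.pi ≤ 1 := by
      rw [div_le_one hπ]; linarith [Real.pi_gt_three]
    calc (1 / Real.pi) * |∫ ν, f ν * poisson ε ν s|
        ≤ 1 * (F * (8 * ε * (1 + s ^ 2)⁻¹)) := by gcongr
      _ = 8 * F * ε * (1 + s ^ 2)⁻¹ := by ring
      _ ≤ η * (1 + s ^ 2)⁻¹ := by gcongr

section Density

variable {σ : Measure ℝ} {w : ℝ → ℝ}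

theorem integrable_mul_poisson (hw : Integrable (fun s => w s * (1 + s ^ 2)⁻¹) σ)
    (hwm : Measurable w) {ε : ℝ} (hε : 0 < ε) (ν : ℝ) :
    Integrable (fun s => w s * poisson ε ν s) σ := by
  obtain ⟨K, hK, h⟩ := exists_poisson_le hε |ν|
  refine (hw.norm.const_mul K).mono' ?_ (Eventually.of_forall fun s => ?_)
  · exact (hwm.mul ((continuous_poisson hε).comp
      (by fun_prop : Continuous fun s : ℝ => (ν, s))).measurable).aestronglyMeasurable
  · rw [norm_mul, norm_mul, Real.norm_eq_abs (poisson _ _ _), abs_of_pos (poisson_pos hε _ _),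
      Real.norm_eq_abs (_⁻¹), abs_of_pos (by positivity)]
    have := mul_le_mul_of_nonneg_left (h ν le_rfl s) (norm_nonneg (w s))
    linarith

theorem integrable_mul_compact (hw : Integrable (fun s => w s * (1 + s ^ 2)⁻¹) σ)
    (hwm : Measurable w) {g : ℝ → ℝ} (hg : Measurable g) {B R : ℝ} (hB : ∀ s, |g s| ≤ B)
    (hR : ∀ s, R < |s| → g s = 0) : Integrable (fun s => w s * g s) σ := by
  refine (hw.norm.const_mul (B * (1 + R ^ 2))).mono' (hwm.mul hg).aestronglyMeasurable
    (Eventually.of_forall fun s => ?_)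
  have hB0 : 0 ≤ B := (abs_nonneg _).trans (hB s)
  rw [norm_mul, norm_mul, Real.norm_eq_abs (_⁻¹), abs_of_pos (by positivity)]
  rcases lt_or_ge R |s| with h | h
  · rw [hR s h, norm_zero, mul_zero]; positivity
  · have h2 : s ^ 2 ≤ R ^ 2 := by
      rw [← sq_abs s]
      exact pow_le_pow_left₀ (abs_nonneg _) h 2
    have h3 : ‖g s‖ ≤ B * (1 + R ^ 2) * (1 + s ^ 2)⁻¹ := by
      refine (hB s).trans ?_
      rw [← div_eq_mul_inv, le_div_iff₀ (by positivity)]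
      gcongr
    calc ‖w s‖ * ‖g s‖ ≤ ‖w s‖ * (B * (1 + R ^ 2) * (1 + s ^ 2)⁻¹) := by gcongr
      _ = _ := by ring

theorem integrable_mul_of_hasCompactSupport (hw : Integrable (fun s => w s * (1 + s ^ 2)⁻¹) σ)
    (hwm : Measurable w) {f : ℝ → ℝ} (hf : Continuous f) (hfc : HasCompactSupport f) :
    Integrable (fun s => w s * f s) σ := by
  obtain ⟨B, hB⟩ := hfc.exists_bound_of_continuous hf
  obtain ⟨R, hR⟩ := exists_eq_zero_of_lt_abs hfc
  exact integrable_mul_compact hw hwm hf.measurable hB hR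

theorem measurable_poissonIntegral [SFinite σ] (hwm : Measurable w) {ε : ℝ} (hε : 0 < ε) :
    Measurable fun ν => ∫ s, w s * poisson ε ν s ∂σ := by
  have h : Measurable fun z : ℝ × ℝ => w z.2 * poisson ε z.1 z.2 :=
    (hwm.comp measurable_snd).mul (continuous_poisson hε).measurable
  exact h.stronglyMeasurable.integral_prod_right.measurable

theorem abs_poissonIntegral_le (hw : Integrable (fun s => w s * (1 + s ^ 2)⁻¹) σ)
    {ε ν K : ℝ} (hε : 0 < ε) (hK : ∀ s, poisson ε ν s ≤ K * (1 + s ^ 2)⁻¹) :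
    |∫ s, w s * poisson ε ν s ∂σ| ≤ K * ∫ s, |w s| * (1 + s ^ 2)⁻¹ ∂σ := by
  have hw' : Integrable (fun s => |w s| * (1 + s ^ 2)⁻¹) σ := by
    refine hw.abs.congr (Eventually.of_forall fun s => ?_)
    simp only [abs_mul]
    rw [abs_of_pos (by positivity : 0 < (1 + s ^ 2)⁻¹)]
  rw [← integral_const_mul, ← Real.norm_eq_abs]
  refine norm_integral_le_of_norm_le (hw'.const_mul K) (Eventually.of_forall fun s => ?_)
  rw [norm_mul, Real.norm_eq_abs, Real.norm_eq_abs, abs_of_pos (poisson_pos hε _ _)]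
  calc _ ≤ |w s| * (K * (1 + s ^ 2)⁻¹) := by gcongr; exact hK s
    _ = _ := by ring

/-- Smearing a test function by the Poisson kernel changes its integral by an amount controlled
by the mass of `|w| / (1 + s²)` only. -/
theorem poissonIntegral_approx [SFinite σ] (hw : Integrable (fun s => w s * (1 + s ^ 2)⁻¹) σ)
    (hwm : Measurable w) {f : ℝ → ℝ} (hf : Continuous f) (hfc : HasCompactSupport f)
    {ε η : ℝ} (hε : 0 < ε) (h : ∀ s, |(1 / Real.pi) * (∫ ν, f ν * poisson ε ν s) - f s| ≤
      η * (1 + s ^ 2)⁻¹) :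
    |(1 / Real.pi) * (∫ ν, f ν * ∫ s, w s * poisson ε ν s ∂σ) - ∫ s, w s * f s ∂σ| ≤
      η * ∫ s, |w s| * (1 + s ^ 2)⁻¹ ∂σ := by
  obtain ⟨R, hR⟩ := exists_eq_zero_of_lt_abs hfc
  obtain ⟨K, hK0, hK⟩ := exists_poisson_le hε R
  have hw' : Integrable (fun s => |w s| * (1 + s ^ 2)⁻¹) σ := by
    refine hw.abs.congr (Eventually.of_forall fun s => ?_)
    simp only [abs_mul]
    rw [abs_of_pos (by positivity : 0 < (1 + s ^ 2)⁻¹)]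
  have hfint : Integrable f := hf.integrable_of_hasCompactSupport hfc
  have hprod : Integrable (Function.uncurry fun ν s => f ν * (w s * poisson ε ν s))
      (volume.prod σ) := by
    refine ((hfint.norm.mul_prod hw').const_mul K).mono' ?_ (Eventually.of_forall fun z => ?_)
    · exact ((hf.measurable.comp measurable_fst).mul ((hwm.comp measurable_snd).mul
        (continuous_poisson hε).measurable)).aestronglyMeasurable
    · simp only [Function.uncurry, norm_mul, Real.norm_eq_abs]
      rw [abs_of_pos (poisson_pos hε _ _)]
      rcases lt_or_ge R |z.1| with h1 | h1
      · rw [hR _ h1]; simp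
      · have := hK _ h1 z.2
        calc |f z.1| * (|w z.2| * poisson ε z.1 z.2)
            ≤ |f z.1| * (|w z.2| * (K * (1 + z.2 ^ 2)⁻¹)) := by gcongr
          _ = _ := by ring
  have hswap := integral_integral_swap hprod
  have e1 : (∫ ν, f ν * ∫ s, w s * poisson ε ν s ∂σ) =
      ∫ s, w s * (∫ ν, f ν * poisson ε ν s) ∂σ := by
    simp_rw [← integral_const_mul]
    rw [hswap]
    refine integral_congr_ae (Eventually.of_forall fun s => ?_)
    refine integral_congr_ae (Eventually.of_forall fun ν => ?_)
    simp only
    ring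
  have hi1 : Integrable (fun s => w s * (∫ ν, f ν * poisson ε ν s)) σ := by
    refine hprod.integral_prod_right.congr (Eventually.of_forall fun s => ?_)
    simp only [Function.uncurry, ← integral_const_mul]
    refine integral_congr_ae (Eventually.of_forall fun ν => ?_)
    simp only
    ring
  rw [e1, ← integral_const_mul,
    ← integral_sub (hi1.const_mul _) (integrable_mul_of_hasCompactSupport hw hwm hf hfc),
    ← integral_const_mul, ← Real.norm_eq_abs]
  refine norm_integral_le_of_norm_le (hw'.const_mul η) (Eventually.of_forall fun s => ?_)
  rw [show (1 / Real.pi) * (w s * ∫ ν, f ν * poisson ε ν s) - w s * f s =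
    w s * ((1 / Real.pi) * (∫ ν, f ν * poisson ε ν s) - f s) by ring, norm_mul, Real.norm_eq_abs,
    Real.norm_eq_abs]
  calc _ ≤ |w s| * (η * (1 + s ^ 2)⁻¹) := by gcongr; exact h s
    _ = _ := by ring

end Density

end

/-! ### Vague convergence and masses of intervals -/

section

/-- A continuous ramp, increasing to the indicator function of `(0, ∞)` as `k → ∞`. -/
noncomputable def ramp (k : ℕ) (u : ℝ) : ℝ := max 0 (min 1 (k * u))

/-- A continuous tent, decreasing to the indicator function of `{0}` as `k → ∞`. -/
noncomputable def tent (k : ℕ) (u : ℝ) : ℝ := max 0 (1 - k * |u|)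

/-- A continuous trapezoid, tending to the indicator function of `(y, x]` as `k → ∞`. -/
noncomputable def trapezoid (k : ℕ) (y x s : ℝ) : ℝ := ramp k (s - y) - ramp k (s - x)

theorem continuous_ramp (k : ℕ) : Continuous (ramp k) := by unfold ramp; fun_prop

theorem continuous_tent (k : ℕ) : Continuous (tent k) := by unfold tent; fun_prop

theorem continuous_trapezoid (k : ℕ) (y x : ℝ) : Continuous (trapezoid k y x) := by
  unfold trapezoid
  exact ((continuous_ramp k).comp (by fun_prop)).sub ((continuous_ramp k).comp (by fun_prop))

theorem ramp_mono (k : ℕ) : Monotone (ramp k) := fun u v h => by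
  unfold ramp
  gcongr

theorem ramp_nonneg (k : ℕ) (u : ℝ) : 0 ≤ ramp k u := le_max_left _ _

theorem ramp_le_one (k : ℕ) (u : ℝ) : ramp k u ≤ 1 :=
  max_le zero_le_one (min_le_left _ _)

theorem ramp_of_nonpos (k : ℕ) {u : ℝ} (hu : u ≤ 0) : ramp k u = 0 :=
  max_eq_left ((min_le_right _ _).trans (mul_nonpos_of_nonneg_of_nonpos (Nat.cast_nonneg _) hu))

theorem ramp_of_one_le {k : ℕ} (hk : 1 ≤ k) {u : ℝ} (hu : 1 ≤ u) : ramp k u = 1 := by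
  have h1 : (1 : ℝ) ≤ k := by exact_mod_cast hk
  have : (1 : ℝ) ≤ k * u := by nlinarith
  simp [ramp, this]

theorem tent_nonneg (k : ℕ) (u : ℝ) : 0 ≤ tent k u := le_max_left _ _

theorem tent_le_one (k : ℕ) (u : ℝ) : tent k u ≤ 1 :=
  max_le zero_le_one (by have : 0 ≤ (k : ℝ) * |u| := by positivity
                         linarith)

theorem tent_zero (k : ℕ) : tent k 0 = 1 := by simp [tent]

theorem tent_of_one_le {k : ℕ} (hk : 1 ≤ k) {u : ℝ} (hu : 1 ≤ |u|) : tent k u = 0 := by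
  have h1 : (1 : ℝ) ≤ k := by exact_mod_cast hk
  refine max_eq_left ?_
  nlinarith

theorem abs_indicator_sub_ramp_le (k : ℕ) (u : ℝ) :
    |(if 0 < u then 1 else 0) - ramp k u| ≤ tent k u := by
  split_ifs with h
  · have h1 : 0 ≤ (k : ℝ) * u := by positivity
    rw [ramp, tent, abs_of_pos h, max_eq_right (le_min zero_le_one h1)]
    rcases le_total 1 ((k : ℝ) * u) with h2 | h2
    · rw [min_eq_left h2, max_eq_left (by linarith)]; simp
    · rw [min_eq_right h2, max_eq_right (by linarith), abs_of_nonneg (by linarith)]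
  · rw [ramp_of_nonpos k (not_lt.mp h)]
    simpa using tent_nonneg k u

theorem indicator_Ioc_eq_sub {y x : ℝ} (hyx : y ≤ x) (s : ℝ) :
    (Set.Ioc y x).indicator (1 : ℝ → ℝ) s =
      (if 0 < s - y then 1 else 0) - (if 0 < s - x then 1 else 0) := by
  by_cases hy : y < s <;> by_cases hx : s ≤ x
  · simp [Set.indicator, hy, hx, not_lt.mpr hx]
  · simp [Set.indicator, hy, hx, not_le.mp hx]
  · simp [Set.indicator, hy, not_lt.mpr hx]
  · exact absurd (lt_of_le_of_lt hyx (not_le.mp hx)) hy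

theorem abs_indicator_sub_trapezoid_le (k : ℕ) {y x : ℝ} (hyx : y ≤ x) (s : ℝ) :
    |(Set.Ioc y x).indicator 1 s - trapezoid k y x s| ≤ tent k (s - x) + tent k (s - y) := by
  have h1 := abs_indicator_sub_ramp_le k (s - y)
  have h2 := abs_indicator_sub_ramp_le k (s - x)
  rw [indicator_Ioc_eq_sub hyx, trapezoid]
  calc _ = |((if 0 < s - y then 1 else 0) - ramp k (s - y)) -
        ((if 0 < s - x then 1 else 0) - ramp k (s - x))| := by congr 1; ring
    _ ≤ _ := abs_sub _ _
    _ ≤ _ := by linarith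

theorem tendsto_tent (u : ℝ) :
    Tendsto (fun k : ℕ => tent k u) atTop (𝓝 (if u = 0 then 1 else 0)) := by
  split_ifs with h
  · subst h; simp only [tent_zero]; exact tendsto_const_nhds
  · have hu : 0 < |u| := abs_pos.mpr h
    obtain ⟨N, hN⟩ := exists_nat_ge (1 / |u|)
    refine tendsto_const_nhds.congr' ?_
    filter_upwards [eventually_ge_atTop N] with k hk
    have hk' : (N : ℝ) ≤ k := by exact_mod_cast hk
    have : 1 ≤ (k : ℝ) * |u| := by
      rw [div_le_iff₀ hu] at hN
      nlinarith
    exact (max_eq_left (by linarith)).symm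

theorem tendsto_trapezoid {y x : ℝ} (hyx : y ≤ x) (s : ℝ) :
    Tendsto (fun k : ℕ => trapezoid k y x s) atTop (𝓝 ((Set.Ioc y x).indicator 1 s)) := by
  have hr : ∀ u : ℝ, Tendsto (fun k : ℕ => ramp k u) atTop (𝓝 (if 0 < u then 1 else 0)) := by
    intro u
    split_ifs with h
    · have h1 := tendsto_tent u
      rw [if_neg h.ne'] at h1
      rw [tendsto_iff_dist_tendsto_zero]
      refine squeeze_zero (fun _ => dist_nonneg) (fun k => ?_) h1
      have h2 := abs_indicator_sub_ramp_le k u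
      rwa [if_pos h, abs_sub_comm] at h2
    · simp only [ramp_of_nonpos _ (not_lt.mp h)]; exact tendsto_const_nhds
  rw [indicator_Ioc_eq_sub hyx]
  exact (hr _).sub (hr _)

theorem trapezoid_nonneg (k : ℕ) {y x : ℝ} (hyx : y ≤ x) (s : ℝ) : 0 ≤ trapezoid k y x s :=
  sub_nonneg.mpr (ramp_mono k (by linarith))

theorem trapezoid_le_one (k : ℕ) (y x s : ℝ) : trapezoid k y x s ≤ 1 := by
  have := ramp_le_one k (s - y)
  have := ramp_nonneg k (s - x)
  unfold trapezoid; linarith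

theorem trapezoid_eq_zero {k : ℕ} (hk : 1 ≤ k) {y x s : ℝ} (hyx : y ≤ x)
    (hs : s ∉ Set.Icc y (x + 1)) : trapezoid k y x s = 0 := by
  rw [Set.mem_Icc, not_and_or, not_le, not_le] at hs
  unfold trapezoid
  rcases hs with h | h
  · rw [ramp_of_nonpos k (by linarith), ramp_of_nonpos k (by linarith), sub_zero]
  · rw [ramp_of_one_le hk (by linarith), ramp_of_one_le hk (by linarith), sub_self]

theorem tent_sub_eq_zero {k : ℕ} (hk : 1 ≤ k) {x s : ℝ}
    (hs : s ∉ Set.Icc (x - 1) (x + 1)) : tent k (s - x) = 0 := by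
  refine tent_of_one_le hk ?_
  rw [Set.mem_Icc, not_and_or, not_le, not_le] at hs
  rcases hs with h | h
  · exact (by linarith : 1 ≤ -(s - x)).trans (neg_le_abs _)
  · exact (by linarith : 1 ≤ s - x).trans (le_abs_self _)

theorem hasCompactSupport_trapezoid {k : ℕ} (hk : 1 ≤ k) {y x : ℝ} (hyx : y ≤ x) :
    HasCompactSupport (trapezoid k y x) :=
  HasCompactSupport.intro isCompact_Icc fun _ hs => trapezoid_eq_zero hk hyx hs

theorem continuous_tent_sub (k : ℕ) (x : ℝ) : Continuous fun s => tent k (s - x) :=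
  (continuous_tent k).comp (by fun_prop)

theorem hasCompactSupport_tent {k : ℕ} (hk : 1 ≤ k) (x : ℝ) :
    HasCompactSupport fun s => tent k (s - x) :=
  HasCompactSupport.intro isCompact_Icc fun _ hs => tent_sub_eq_zero hk hs

section LocallyFinite

variable (μ : Measure ℝ) [IsLocallyFiniteMeasure μ]

theorem tendsto_integral_of_le_indicator {g : ℕ → ℝ → ℝ} {K E : Set ℝ} (hK : IsCompact K)
    (hE : MeasurableSet E) (hg : ∀ k, Continuous (g k))
    (hb : ∀ k, 1 ≤ k → ∀ s, |g k s| ≤ K.indicator 1 s)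
    (hlim : ∀ s, Tendsto (fun k => g k s) atTop (𝓝 (E.indicator 1 s))) :
    Tendsto (fun k => ∫ s, g k s ∂μ) atTop (𝓝 (μ.real E)) := by
  rw [← integral_indicator_one hE]
  refine tendsto_integral_filter_of_dominated_convergence (K.indicator 1)
    (Eventually.of_forall fun k => (hg k).aestronglyMeasurable) ?_ ?_
    (Eventually.of_forall hlim)
  · filter_upwards [eventually_ge_atTop 1] with k hk
    exact Eventually.of_forall (hb k hk)
  · exact (integrable_indicator_iff hK.measurableSet).mpr
      (integrableOn_const hK.measure_lt_top.ne)

theorem tendsto_integral_tent (x : ℝ) :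
    Tendsto (fun k : ℕ => ∫ s, tent k (s - x) ∂μ) atTop (𝓝 (μ.real {x})) := by
  refine tendsto_integral_of_le_indicator μ (K := Set.Icc (x - 1) (x + 1)) isCompact_Icc
    (measurableSet_singleton x) (fun k => continuous_tent_sub k x) (fun k hk s => ?_) fun s => ?_
  · by_cases hs : s ∈ Set.Icc (x - 1) (x + 1)
    · rw [Set.indicator_of_mem hs, abs_of_nonneg (tent_nonneg _ _)]
      exact tent_le_one _ _
    · rw [Set.indicator_of_notMem hs, tent_sub_eq_zero hk hs, abs_zero]
  · convert tendsto_tent (s - x) using 2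
    simp [Set.indicator, sub_eq_zero]

theorem tendsto_integral_trapezoid {y x : ℝ} (hyx : y ≤ x) :
    Tendsto (fun k : ℕ => ∫ s, trapezoid k y x s ∂μ) atTop (𝓝 (μ.real (Set.Ioc y x))) := by
  refine tendsto_integral_of_le_indicator μ (K := Set.Icc y (x + 1)) isCompact_Icc
    measurableSet_Ioc (fun k => continuous_trapezoid k y x) (fun k hk s => ?_)
    (tendsto_trapezoid hyx)
  by_cases hs : s ∈ Set.Icc y (x + 1)
  · rw [Set.indicator_of_mem hs, abs_of_nonneg (trapezoid_nonneg _ hyx _)]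
    exact trapezoid_le_one _ _ _ _
  · rw [Set.indicator_of_notMem hs, trapezoid_eq_zero hk hyx hs, abs_zero]

end LocallyFinite

theorem exists_weight_lt {a b η : ℝ} (ha : 0 ≤ a) (hb : 0 ≤ b) (hab : a * b = 0) (hη : 0 < η) :
    ∃ θ, 0 < θ ∧ θ * a + θ⁻¹ * b < η := by
  rcases mul_eq_zero.mp hab with rfl | rfl
  · refine ⟨(b + 1) / η, by positivity, ?_⟩
    rw [inv_div, mul_zero, zero_add, div_mul_eq_mul_div, div_lt_iff₀ (by positivity)]
    nlinarith
  · refine ⟨η / (a + 1), by positivity, ?_⟩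
    rw [mul_zero, add_zero, div_mul_eq_mul_div, div_lt_iff₀ (by positivity)]
    nlinarith

theorem integrable_mul_of_integrableOn {σ : Measure ℝ} {w g : ℝ → ℝ}
    (hw : ∀ a b, IntegrableOn w (Set.Icc a b) σ) (hg : Measurable g) {B a b : ℝ}
    (hB : ∀ s, |g s| ≤ B) (h0 : ∀ s, s ∉ Set.Icc a b → g s = 0) :
    Integrable (fun s => w s * g s) σ := by
  have h1 : IntegrableOn (fun s => w s * g s) (Set.Icc a b) σ :=
    (hw a b).mul_bdd (c := B) hg.aestronglyMeasurable (Eventually.of_forall fun s => hB s)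
  refine (integrableOn_iff_integrable_of_support_subset fun s hs => ?_).mp h1
  by_contra h
  exact hs (by simp [h0 s h])

/-- Convergence of the masses of half-open intervals from vague convergence, for an off-diagonal
entry `w` of a nonnegative matrix density with diagonal entries `u`, `v`. Instead of requiring that
the diagonal entries of the limit charge no endpoint, it suffices that *one* of them does not:
near an endpoint `|w|` is dominated by `(θ u + v / θ) / 2`, where `θ` is at our disposal. -/
theorem tendsto_setIntegral_Ioc {ι : Type*} {F : Filter ι} {σ : ι → Measure ℝ}
    {w u v : ι → ℝ → ℝ} {A B U V : Measure ℝ} [IsLocallyFiniteMeasure A]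
    [IsLocallyFiniteMeasure B] [IsLocallyFiniteMeasure U] [IsLocallyFiniteMeasure V]
    (hw : ∀ᶠ i in F, ∀ a b, IntegrableOn (w i) (Set.Icc a b) (σ i))
    (hu : ∀ᶠ i in F, ∀ a b, IntegrableOn (u i) (Set.Icc a b) (σ i))
    (hv : ∀ᶠ i in F, ∀ a b, IntegrableOn (v i) (Set.Icc a b) (σ i))
    (habs : ∀ᶠ i in F, ∀ s θ, 0 < θ → |w i s| ≤ (θ * u i s + θ⁻¹ * v i s) / 2)
    (hW : ∀ f : ℝ → ℝ, Continuous f → HasCompactSupport f →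
      Tendsto (fun i => ∫ s, w i s * f s ∂σ i) F (𝓝 (∫ s, f s ∂A - ∫ s, f s ∂B)))
    (hU : ∀ f : ℝ → ℝ, Continuous f → HasCompactSupport f →
      Tendsto (fun i => ∫ s, u i s * f s ∂σ i) F (𝓝 (∫ s, f s ∂U)))
    (hV : ∀ f : ℝ → ℝ, Continuous f → HasCompactSupport f →
      Tendsto (fun i => ∫ s, v i s * f s ∂σ i) F (𝓝 (∫ s, f s ∂V)))
    {y x : ℝ} (hyx : y ≤ x) (hx : U.real {x} * V.real {x} = 0)
    (hy : U.real {y} * V.real {y} = 0) :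
    Tendsto (fun i => ∫ s in Set.Ioc y x, w i s ∂σ i) F
      (𝓝 (A.real (Set.Ioc y x) - B.real (Set.Ioc y x))) := by
  rw [Metric.tendsto_nhds]
  intro η hη
  obtain ⟨θ, hθ, hθη⟩ := exists_weight_lt measureReal_nonneg measureReal_nonneg hx
    (by positivity : 0 < η / 4)
  obtain ⟨κ, hκ, hκη⟩ := exists_weight_lt measureReal_nonneg measureReal_nonneg hy
    (by positivity : 0 < η / 4)
  have e1 := ((tendsto_integral_tent U x).const_mul θ).add
    ((tendsto_integral_tent V x).const_mul θ⁻¹) |>.eventually (gt_mem_nhds hθη)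
  have e2 := ((tendsto_integral_tent U y).const_mul κ).add
    ((tendsto_integral_tent V y).const_mul κ⁻¹) |>.eventually (gt_mem_nhds hκη)
  have e3 := Metric.tendsto_nhds.mp
    ((tendsto_integral_trapezoid A hyx).sub (tendsto_integral_trapezoid B hyx)) (η / 4)
    (by positivity)
  obtain ⟨k, h1, h2, h3, hk⟩ := (e1.and (e2.and (e3.and (eventually_ge_atTop 1)))).exists
  have cx := continuous_tent_sub k x
  have cy := continuous_tent_sub k y
  have sx := hasCompactSupport_tent hk x
  have sy := hasCompactSupport_tent hk y
  have ct := continuous_trapezoid k y x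
  have st := hasCompactSupport_trapezoid hk hyx
  have e4 := ((hU _ cx sx).const_mul θ).add ((hV _ cx sx).const_mul θ⁻¹)
    |>.eventually (gt_mem_nhds h1)
  have e5 := ((hU _ cy sy).const_mul κ).add ((hV _ cy sy).const_mul κ⁻¹)
    |>.eventually (gt_mem_nhds h2)
  have e6 := Metric.tendsto_nhds.mp (hW _ ct st) (η / 4) (by positivity)
  filter_upwards [e4, e5, e6, hw, hu, hv, habs] with i h4 h5 h6 gw gu gv gabs
  have tb : ∀ z s, |tent k (s - z)| ≤ 1 := fun z s => by
    rw [abs_of_nonneg (tent_nonneg _ _)]; exact tent_le_one _ _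
  have iux := integrable_mul_of_integrableOn gu cx.measurable (tb x)
    fun s hs => tent_sub_eq_zero hk hs
  have ivx := integrable_mul_of_integrableOn gv cx.measurable (tb x)
    fun s hs => tent_sub_eq_zero hk hs
  have iuy := integrable_mul_of_integrableOn gu cy.measurable (tb y)
    fun s hs => tent_sub_eq_zero hk hs
  have ivy := integrable_mul_of_integrableOn gv cy.measurable (tb y)
    fun s hs => tent_sub_eq_zero hk hs
  have iw := integrable_mul_of_integrableOn gw ct.measurable
    (fun s => (abs_of_nonneg (trapezoid_nonneg k hyx s)).trans_le (trapezoid_le_one k y x s))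
    fun s hs => trapezoid_eq_zero hk hyx hs
  have iw' : Integrable (fun s => w i s * (Set.Ioc y x).indicator 1 s) (σ i) :=
    integrable_mul_of_integrableOn gw (measurable_one.indicator measurableSet_Ioc) (B := 1)
      (fun s => by by_cases hs : s ∈ Set.Ioc y x <;> simp [hs])
      fun s hs => Set.indicator_of_notMem (fun h => hs (Set.Ioc_subset_Icc_self h)) _
  have e7 : ∫ s in Set.Ioc y x, w i s ∂σ i = ∫ s, w i s * (Set.Ioc y x).indicator 1 s ∂σ i := by
    rw [← integral_indicator measurableSet_Ioc]
    refine integral_congr_ae (Eventually.of_forall fun s => ?_)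
    by_cases hs : s ∈ Set.Ioc y x <;> simp [hs]
  have hdiff : |∫ s in Set.Ioc y x, w i s ∂σ i - ∫ s, w i s * trapezoid k y x s ∂σ i| ≤ η / 4 := by
    rw [e7, ← integral_sub iw' iw, ← Real.norm_eq_abs]
    have ix : Integrable (fun s => θ * (u i s * tent k (s - x)) +
        θ⁻¹ * (v i s * tent k (s - x))) (σ i) := (iux.const_mul _).add (ivx.const_mul _)
    have iy : Integrable (fun s => κ * (u i s * tent k (s - y)) +
        κ⁻¹ * (v i s * tent k (s - y))) (σ i) := (iuy.const_mul _).add (ivy.const_mul _)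
    have hdom : Integrable (fun s => ((θ * (u i s * tent k (s - x)) +
        θ⁻¹ * (v i s * tent k (s - x))) + (κ * (u i s * tent k (s - y)) +
        κ⁻¹ * (v i s * tent k (s - y)))) / 2) (σ i) := (ix.add iy).div_const 2
    refine (norm_integral_le_of_norm_le hdom (Eventually.of_forall fun s => ?_)).trans ?_
    · rw [← mul_sub, norm_mul, Real.norm_eq_abs, Real.norm_eq_abs]
      have hA := abs_indicator_sub_trapezoid_le k hyx s
      have hB := mul_le_mul_of_nonneg_right (gabs s θ hθ) (tent_nonneg k (s - x))
      have hC := mul_le_mul_of_nonneg_right (gabs s κ hκ) (tent_nonneg k (s - y))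
      have hD := mul_le_mul_of_nonneg_left hA (abs_nonneg (w i s))
      linarith
    · rw [integral_div, integral_add ix iy, integral_add (iux.const_mul _) (ivx.const_mul _),
        integral_add (iuy.const_mul _) (ivy.const_mul _), integral_const_mul, integral_const_mul,
        integral_const_mul, integral_const_mul]
      linarith
  rw [Real.dist_eq] at h3 h6 ⊢
  rw [abs_lt] at h3 h6 ⊢
  rw [abs_le] at hdiff
  constructor <;> linarith [h3.1, h3.2, h6.1, h6.2, hdiff.1, hdiff.2]

end

/-! ### Limits of Poisson integrals -/

section

/-- The densities `w n` with respect to `σ n` have Poisson integrals converging to the function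
`P` on the upper half-plane, and are uniformly bounded with respect to `1 / (1 + s²)`. -/
structure PoissonApprox (P : ℝ → ℝ → ℝ) (σ : ℕ → Measure ℝ) (w : ℕ → ℝ → ℝ) : Prop where
  sfinite : ∀ n, SFinite (σ n)
  meas : ∀ n, Measurable (w n)
  integrable : ∀ n, Integrable (fun s => w n s * (1 + s ^ 2)⁻¹) (σ n)
  bound : ∃ C, ∀ n, ∫ s, |w n s| * (1 + s ^ 2)⁻¹ ∂σ n ≤ C
  tendsto : ∀ ν ε, 0 < ε → Tendsto (fun n => ∫ s, w n s * poisson ε ν s ∂σ n) atTop (𝓝 (P ν ε))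

namespace PoissonApprox

variable {P P₁ P₂ : ℝ → ℝ → ℝ} {σ : ℕ → Measure ℝ} {w w₁ w₂ : ℕ → ℝ → ℝ}

theorem integrable_abs (h : PoissonApprox P σ w) (n : ℕ) :
    Integrable (fun s => |w n s| * (1 + s ^ 2)⁻¹) (σ n) := by
  refine (h.integrable n).abs.congr (Eventually.of_forall fun s => ?_)
  simp only [abs_mul]
  rw [abs_of_pos (by positivity : 0 < (1 + s ^ 2)⁻¹)]

theorem const_mul (h : PoissonApprox P σ w) (a : ℝ) :
    PoissonApprox (fun ν ε => a * P ν ε) σ (fun n s => a * w n s) where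
  sfinite := h.sfinite
  meas n := (h.meas n).const_mul a
  integrable n := by simpa only [mul_assoc] using (h.integrable n).const_mul a
  bound := by
    obtain ⟨C, hC⟩ := h.bound
    refine ⟨|a| * C, fun n => ?_⟩
    simp only [abs_mul, mul_assoc]
    rw [integral_const_mul]
    exact mul_le_mul_of_nonneg_left (hC n) (abs_nonneg a)
  tendsto ν ε hε := by
    simpa only [mul_assoc, integral_const_mul] using (h.tendsto ν ε hε).const_mul a

theorem add (h₁ : PoissonApprox P₁ σ w₁) (h₂ : PoissonApprox P₂ σ w₂) :
    PoissonApprox (fun ν ε => P₁ ν ε + P₂ ν ε) σ (fun n s => w₁ n s + w₂ n s) where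
  sfinite := h₁.sfinite
  meas n := (h₁.meas n).add (h₂.meas n)
  integrable n := by
    simp only [add_mul]
    exact (h₁.integrable n).add (h₂.integrable n)
  bound := by
    obtain ⟨C₁, hC₁⟩ := h₁.bound
    obtain ⟨C₂, hC₂⟩ := h₂.bound
    refine ⟨C₁ + C₂, fun n => le_trans ?_ (add_le_add (hC₁ n) (hC₂ n))⟩
    rw [← integral_add (h₁.integrable_abs n) (h₂.integrable_abs n)]
    refine integral_mono_of_nonneg (Eventually.of_forall fun s => by positivity)
      ((h₁.integrable_abs n).add (h₂.integrable_abs n)) (Eventually.of_forall fun s => ?_)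
    simp only
    rw [← add_mul]
    gcongr
    exact abs_add_le _ _
  tendsto ν ε hε := by
    refine ((h₁.tendsto ν ε hε).add (h₂.tendsto ν ε hε)).congr fun n => ?_
    rw [← integral_add (integrable_mul_poisson (h₁.integrable n) (h₁.meas n) hε ν)
      (integrable_mul_poisson (h₂.integrable n) (h₂.meas n) hε ν)]
    simp only [add_mul]

theorem measurable (h : PoissonApprox P σ w) {ε : ℝ} (hε : 0 < ε) :
    Measurable fun ν => P ν ε := by
  have := h.sfinite
  exact measurable_of_tendsto_metrizable
    (fun n => measurable_poissonIntegral (σ := σ n) (h.meas n) hε)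
    (tendsto_pi_nhds.mpr fun ν => h.tendsto ν ε hε)

theorem exists_abs_le (h : PoissonApprox P σ w) {ε : ℝ} (hε : 0 < ε) (R : ℝ) :
    ∃ K, ∀ ν, |ν| ≤ R → (∀ n, |∫ s, w n s * poisson ε ν s ∂σ n| ≤ K) ∧ |P ν ε| ≤ K := by
  obtain ⟨K, hK0, hK⟩ := exists_poisson_le hε R
  obtain ⟨C, hC⟩ := h.bound
  refine ⟨K * C, fun ν hν => ?_⟩
  have h1 : ∀ n, |∫ s, w n s * poisson ε ν s ∂σ n| ≤ K * C := fun n =>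
    (abs_poissonIntegral_le (h.integrable n) hε (hK ν hν)).trans
      (mul_le_mul_of_nonneg_left (hC n) hK0.le)
  exact ⟨h1, le_of_tendsto (h.tendsto ν ε hε).abs (Eventually.of_forall h1)⟩

theorem integrableOn (h : PoissonApprox P σ w) {ε : ℝ} (hε : 0 < ε) (a b : ℝ) :
    IntegrableOn (fun ν => P ν ε) (Set.Icc a b) := by
  obtain ⟨K, hK⟩ := h.exists_abs_le hε (max |a| |b|)
  refine Measure.integrableOn_of_bounded (M := K) isCompact_Icc.measure_lt_top.ne
    (h.measurable hε).aestronglyMeasurable ?_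
  refine (ae_restrict_iff' measurableSet_Icc).mpr (Eventually.of_forall fun ν hν => ?_)
  exact (hK ν (abs_le_max_abs_abs hν.1 hν.2)).2

theorem integrableOn_density (h : PoissonApprox P σ w) (n : ℕ) (a b : ℝ) :
    IntegrableOn (w n) (Set.Icc a b) (σ n) := by
  rw [← integrable_indicator_iff measurableSet_Icc]
  refine (integrable_mul_compact (h.integrable n) (h.meas n)
    (measurable_one.indicator (measurableSet_Icc (a := a) (b := b))) (B := 1)
    (R := max |a| |b|) (fun s => ?_) fun s hs => ?_).congr (Eventually.of_forall fun s => ?_)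
  · by_cases hs : s ∈ Set.Icc a b <;> simp [hs]
  · exact Set.indicator_of_notMem (fun h => not_lt.mpr (abs_le_max_abs_abs h.1 h.2) hs) _
  · by_cases hs : s ∈ Set.Icc a b <;> simp [hs]

theorem integrable_mul (h : PoissonApprox P σ w) (n : ℕ) {f : ℝ → ℝ} (hf : Continuous f)
    (hfc : HasCompactSupport f) : Integrable (fun s => w n s * f s) (σ n) :=
  integrable_mul_of_hasCompactSupport (h.integrable n) (h.meas n) hf hfc

/-- The vague limit exists, and it is also the boundary value of `P / π`. -/
theorem exists_limit (h : PoissonApprox P σ w) {f : ℝ → ℝ} (hf : Continuous f)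
    (hfc : HasCompactSupport f) :
    ∃ L, Tendsto (fun n => ∫ s, w n s * f s ∂σ n) atTop (𝓝 L) ∧
      Tendsto (fun ε => (1 / Real.pi) * ∫ ν, f ν * P ν ε) (𝓝[>] 0) (𝓝 L) := by
  have := h.sfinite
  obtain ⟨C, hC⟩ := h.bound
  have hC0 : 0 ≤ C := (integral_nonneg fun s => by positivity).trans (hC 0)
  obtain ⟨R, hR⟩ := exists_eq_zero_of_lt_abs hfc
  have hdct : ∀ ε, 0 < ε → Tendsto (fun n => (1 / Real.pi) *
      ∫ ν, f ν * ∫ s, w n s * poisson ε ν s ∂σ n) atTop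
      (𝓝 ((1 / Real.pi) * ∫ ν, f ν * P ν ε)) := fun ε hε => by
    obtain ⟨K, hK⟩ := h.exists_abs_le hε R
    refine (tendsto_integral_of_dominated_convergence (fun ν => |f ν| * K) (fun n => ?_)
      ((hf.integrable_of_hasCompactSupport hfc).abs.mul_const K) (fun n => ?_) ?_).const_mul _
    · exact (hf.measurable.mul
        (measurable_poissonIntegral (σ := σ n) (h.meas n) hε)).aestronglyMeasurable
    · refine Eventually.of_forall fun ν => ?_
      rw [norm_mul, Real.norm_eq_abs, Real.norm_eq_abs]
      rcases lt_or_ge R |ν| with h1 | h1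
      · rw [hR ν h1]; simp
      · exact mul_le_mul_of_nonneg_left ((hK ν h1).1 n) (abs_nonneg _)
    · exact Eventually.of_forall fun ν => (h.tendsto ν ε hε).const_mul _
  -- the smearing error is uniform in `n`, which interchanges the limits `n → ∞` and `ε → 0`
  have key : ∀ η, 0 < η → ∀ᶠ ε in 𝓝[>] (0 : ℝ), ∀ᶠ n in atTop,
      |(∫ s, w n s * f s ∂σ n) - (1 / Real.pi) * ∫ ν, f ν * P ν ε| < η := fun η hη => by
    filter_upwards [poisson_approx hf hfc (show 0 < η / (2 * (C + 1)) by positivity),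
      self_mem_nhdsWithin] with ε h1 h2
    filter_upwards [Metric.tendsto_nhds.mp (hdct ε h2) (η / 2) (by positivity)] with n h3
    have h4 := poissonIntegral_approx (h.integrable n) (h.meas n) hf hfc h2 h1
    have h5 : η / (2 * (C + 1)) * ∫ s, |w n s| * (1 + s ^ 2)⁻¹ ∂σ n ≤ η / 2 := by
      calc _ ≤ η / (2 * (C + 1)) * (C + 1) := by
            gcongr; exact (hC n).trans (by linarith)
        _ = η / 2 := by field_simp
    rw [Real.dist_eq, abs_lt] at h3
    have h6 := abs_le.mp (h4.trans h5)
    rw [abs_lt]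
    constructor <;> linarith [h3.1, h3.2, h6.1, h6.2]
  have hcau : CauchySeq fun n => ∫ s, w n s * f s ∂σ n := by
    refine Metric.cauchySeq_iff.mpr fun η hη => ?_
    obtain ⟨ε, hε⟩ := (key (η / 2) (by positivity)).exists
    obtain ⟨N, hN⟩ := eventually_atTop.mp hε
    refine ⟨N, fun m hm n hn => ?_⟩
    have h1 := abs_lt.mp (hN m hm)
    have h2 := abs_lt.mp (hN n hn)
    rw [Real.dist_eq, abs_lt]
    constructor <;> linarith [h1.1, h1.2, h2.1, h2.2]
  obtain ⟨L, hL⟩ := cauchySeq_tendsto_of_complete hcau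
  refine ⟨L, hL, Metric.tendsto_nhds.mpr fun η hη => ?_⟩
  filter_upwards [key (η / 2) (by positivity)] with ε hε
  have : |L - (1 / Real.pi) * ∫ ν, f ν * P ν ε| ≤ η / 2 :=
    le_of_tendsto (hL.sub_const _).abs (hε.mono fun _ h => h.le)
  rw [Real.dist_eq, abs_sub_comm]
  linarith

/-- The vague limit of nonnegative densities is a locally finite measure, by the
Riesz–Markov–Kakutani theorem. -/
theorem exists_measure (h : PoissonApprox P σ w) (h0 : ∀ n s, 0 ≤ w n s) :
    ∃ μ : Measure ℝ, IsLocallyFiniteMeasure μ ∧ ∀ f : ℝ → ℝ, Continuous f →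
      HasCompactSupport f → Tendsto (fun n => ∫ s, w n s * f s ∂σ n) atTop (𝓝 (∫ s, f s ∂μ)) := by
  have hex : ∀ f : CompactlySupportedContinuousMap ℝ ℝ,
      ∃ L, Tendsto (fun n => ∫ s, w n s * f s ∂σ n) atTop (𝓝 L) := fun f =>
    let ⟨L, hL⟩ := h.exists_limit f.continuous f.hasCompactSupport
    ⟨L, hL.1⟩
  choose L hL using hex
  let Λ : CompactlySupportedContinuousMap ℝ ℝ →ₗ[ℝ] ℝ :=
    { toFun := L
      map_add' := fun f g => by
        refine tendsto_nhds_unique (hL (f + g)) (((hL f).add (hL g)).congr fun n => ?_)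
        have i1 : Integrable (fun s => w n s * f s) (σ n) :=
          h.integrable_mul n f.continuous f.hasCompactSupport
        have i2 : Integrable (fun s => w n s * g s) (σ n) :=
          h.integrable_mul n g.continuous g.hasCompactSupport
        rw [← integral_add i1 i2]
        simp [mul_add]
      map_smul' := fun a f => by
        refine tendsto_nhds_unique (hL (a • f)) (((hL f).const_mul a).congr fun n => ?_)
        rw [← integral_const_mul]
        refine integral_congr_ae (Eventually.of_forall fun s => ?_)
        simp only [CompactlySupportedContinuousMap.smul_apply, smul_eq_mul]
        ring }
  let Λp := PositiveLinearMap.mk₀ Λ fun f hf => ge_of_tendsto' (hL f) fun n =>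
    integral_nonneg fun s => mul_nonneg (h0 n s) (CompactlySupportedContinuousMap.le_def.mp hf s)
  refine ⟨RealRMK.rieszMeasure Λp, inferInstance, fun f hf hfc => ?_⟩
  have h1 := RealRMK.integral_rieszMeasure Λp ⟨⟨f, hf⟩, hfc⟩
  have h2 := hL ⟨⟨f, hf⟩, hfc⟩
  change ∫ s, f s ∂_ = L _ at h1
  rw [h1]
  exact h2

end PoissonApprox

/-- The distribution function of `μ`, vanishing at `0`. -/
noncomputable def distribution (μ : Measure ℝ) (x : ℝ) : ℝ :=
  if 0 ≤ x then μ.real (Set.Ioc 0 x) else -μ.real (Set.Ioc x 0)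

section Distribution

variable (μ : Measure ℝ) [IsLocallyFiniteMeasure μ]

theorem measureReal_Ioc_add {a b c : ℝ} (hab : a ≤ b) (hbc : b ≤ c) :
    μ.real (Set.Ioc a b) + μ.real (Set.Ioc b c) = μ.real (Set.Ioc a c) := by
  rw [← Set.Ioc_union_Ioc_eq_Ioc hab hbc, measureReal_union (Set.Ioc_disjoint_Ioc_of_le le_rfl)
    measurableSet_Ioc measure_Ioc_lt_top.ne measure_Ioc_lt_top.ne]

theorem distribution_sub {y x : ℝ} (hyx : y ≤ x) :
    distribution μ x - distribution μ y = μ.real (Set.Ioc y x) := by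
  unfold distribution
  split_ifs with hx hy hy
  · linarith [measureReal_Ioc_add μ hy hyx]
  · linarith [measureReal_Ioc_add μ (not_le.mp hy).le hx]
  · exact absurd (hy.trans hyx) hx
  · linarith [measureReal_Ioc_add μ hyx (not_le.mp hx).le]

theorem monotone_distribution : Monotone (distribution μ) := fun y x h => by
  rw [← sub_nonneg, distribution_sub μ h]
  exact measureReal_nonneg

theorem tendsto_measureReal_Ioc (x : ℝ) :
    Tendsto (fun n : ℕ => μ.real (Set.Ioc (x - 1 / ((n : ℝ) + 1)) x)) atTop (𝓝 (μ.real {x})) := by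
  have hI : ⋂ n : ℕ, Set.Ioc (x - 1 / ((n : ℝ) + 1)) x = {x} := by
    ext s
    simp only [Set.mem_iInter, Set.mem_Ioc, Set.mem_singleton_iff]
    constructor
    · intro h
      refine le_antisymm (h 0).2 ?_
      have h1 : Tendsto (fun n : ℕ => x - 1 / ((n : ℝ) + 1)) atTop (𝓝 (x - 0)) :=
        tendsto_const_nhds.sub tendsto_one_div_add_atTop_nhds_zero_nat
      rw [sub_zero] at h1
      exact le_of_tendsto' h1 fun n => (h n).1.le
    · rintro rfl n
      refine ⟨?_, le_rfl⟩
      have : (0 : ℝ) < 1 / ((n : ℝ) + 1) := by positivity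
      linarith
  have h := tendsto_measure_iInter_atTop (μ := μ)
    (s := fun n : ℕ => Set.Ioc (x - 1 / ((n : ℝ) + 1)) x)
    (fun n => measurableSet_Ioc.nullMeasurableSet) (fun m n hmn => by
      refine Set.Ioc_subset_Ioc_left ?_
      have : (m : ℝ) ≤ n := by exact_mod_cast hmn
      have : 1 / ((n : ℝ) + 1) ≤ 1 / ((m : ℝ) + 1) := by gcongr
      linarith) ⟨0, measure_Ioc_lt_top.ne⟩
  rw [hI] at h
  exact (ENNReal.tendsto_toReal (isCompact_singleton.measure_lt_top.ne)).comp h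

end Distribution

end

/-! ### Nonnegative matrix densities -/

section

theorem eVariationOn_le_of_edist_le {f g : ℝ → ℝ} (h : ∀ x y, edist (f x) (f y) ≤ edist (g x) (g y))
    (S : Set ℝ) : eVariationOn f S ≤ eVariationOn g S :=
  iSup_mono fun _ => Finset.sum_le_sum fun _ _ => h _ _

theorem locallyBoundedVariationOn_distribution_sub (A B : Measure ℝ) [IsLocallyFiniteMeasure A]
    [IsLocallyFiniteMeasure B] :
    LocallyBoundedVariationOn (fun x => distribution A x - distribution B x) Set.univ := by
  have hm : MonotoneOn (fun x => distribution A x + distribution B x) Set.univ :=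
    ((monotone_distribution A).add (monotone_distribution B)).monotoneOn _
  intro a b ha hb
  refine ne_top_of_le_ne_top (hm.locallyBoundedVariationOn a b ha hb)
    (eVariationOn_le_of_edist_le (fun x y => ?_) _)
  rw [edist_dist, edist_dist, Real.dist_eq, Real.dist_eq]
  refine ENNReal.ofReal_le_ofReal ?_
  rcases le_total x y with h | h
  · have h1 := monotone_distribution A h
    have h2 := monotone_distribution B h
    rw [abs_of_nonpos (a := _ + _ - _) (by linarith)]
    refine abs_le.mpr ⟨by linarith, by linarith⟩
  · have h1 := monotone_distribution A h
    have h2 := monotone_distribution B h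
    rw [abs_of_nonneg (a := _ + _ - _) (by linarith)]
    refine abs_le.mpr ⟨by linarith, by linarith⟩

/-- At a continuity point of the difference of the distribution functions, the two measures have
the same atom. -/
theorem measureReal_singleton_eq_of_continuousAt {A B : Measure ℝ} [IsLocallyFiniteMeasure A]
    [IsLocallyFiniteMeasure B] {x : ℝ}
    (h : ContinuousAt (fun x => distribution A x - distribution B x) x) :
    A.real {x} - B.real {x} = 0 := by
  have h1 := (tendsto_measureReal_Ioc A x).sub (tendsto_measureReal_Ioc B x)
  have h2 : Tendsto (fun n : ℕ => x - 1 / ((n : ℝ) + 1)) atTop (𝓝 x) := by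
    simpa using tendsto_const_nhds.sub (tendsto_one_div_add_atTop_nhds_zero_nat (𝕜 := ℝ))
  have h3 := (tendsto_const_nhds (x := distribution A x - distribution B x)).sub
    (h.tendsto.comp h2)
  rw [sub_self] at h3
  refine tendsto_nhds_unique h1 (h3.congr fun n => ?_)
  have hn : x - 1 / ((n : ℝ) + 1) ≤ x := by
    have : (0 : ℝ) < 1 / ((n : ℝ) + 1) := by positivity
    linarith
  rw [← distribution_sub A hn, ← distribution_sub B hn]
  simp only [Function.comp]
  ring

/-- The nonnegative symmetric matrix densities `W n` with respect to `σ n` have Poisson integrals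
converging entrywise to `P`. -/
structure MatrixApprox (P : Fin 2 → Fin 2 → ℝ → ℝ → ℝ) (σ : ℕ → Measure ℝ)
    (W : ℕ → Fin 2 → Fin 2 → ℝ → ℝ) : Prop where
  entry : ∀ j k, PoissonApprox (P j k) σ fun n => W n j k
  symm : ∀ n s, W n 1 0 s = W n 0 1 s
  nonneg : ∀ n s a b, 0 ≤ a ^ 2 * W n 0 0 s + 2 * (a * b) * W n 0 1 s + b ^ 2 * W n 1 1 s

/-- A nonnegative quadratic form bounds its entries by weighted means of the diagonal ones. -/
theorem abs_entry_le {w : Fin 2 → Fin 2 → ℝ} (hs : w 1 0 = w 0 1)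
    (h : ∀ a b, 0 ≤ a ^ 2 * w 0 0 + 2 * (a * b) * w 0 1 + b ^ 2 * w 1 1) (j k : Fin 2) {θ : ℝ}
    (hθ : 0 < θ) : |w j k| ≤ (θ * w j j + θ⁻¹ * w k k) / 2 := by
  have h0 : 0 ≤ w 0 0 := by simpa using h 1 0
  have h1 : 0 ≤ w 1 1 := by simpa using h 0 1
  have key : ∀ κ : ℝ, 0 < κ → |w 0 1| ≤ (κ * w 0 0 + κ⁻¹ * w 1 1) / 2 := fun κ hκ => by
    have e : κ⁻¹ * w 1 1 = (1 / κ) * w 1 1 := by rw [one_div]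
    have h2 := mul_nonneg (inv_pos.mpr hκ).le (h κ 1)
    have h3 := mul_nonneg (inv_pos.mpr hκ).le (h κ (-1))
    have e2 : κ⁻¹ * (κ ^ 2 * w 0 0 + 2 * (κ * 1) * w 0 1 + 1 ^ 2 * w 1 1) =
      κ * w 0 0 + 2 * w 0 1 + κ⁻¹ * w 1 1 := by field_simp
    have e3 : κ⁻¹ * (κ ^ 2 * w 0 0 + 2 * (κ * -1) * w 0 1 + (-1) ^ 2 * w 1 1) =
      κ * w 0 0 - 2 * w 0 1 + κ⁻¹ * w 1 1 := by field_simp; ring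
    rw [e2] at h2
    rw [e3] at h3
    exact abs_le.mpr ⟨by linarith, by linarith⟩
  have diag : ∀ u : ℝ, 0 ≤ u → |u| ≤ (θ * u + θ⁻¹ * u) / 2 := fun u hu => by
    rw [abs_of_nonneg hu]
    have h2 : 2 ≤ θ + θ⁻¹ := by
      have : θ * θ⁻¹ = 1 := mul_inv_cancel₀ hθ.ne'
      nlinarith [sq_nonneg (θ - 1), inv_pos.mpr hθ]
    nlinarith
  fin_cases j <;> fin_cases k
  · exact diag _ h0
  · exact key θ hθ
  · change |w 1 0| ≤ (θ * w 1 1 + θ⁻¹ * w 0 0) / 2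
    have := key θ⁻¹ (inv_pos.mpr hθ)
    rw [inv_inv] at this
    rw [hs]
    linarith
  · exact diag _ h1

theorem nonneg_diag {w : Fin 2 → Fin 2 → ℝ}
    (h : ∀ a b, 0 ≤ a ^ 2 * w 0 0 + 2 * (a * b) * w 0 1 + b ^ 2 * w 1 1) (j : Fin 2) :
    0 ≤ w j j := by
  fin_cases j
  · simpa using h 1 0
  · simpa using h 0 1

/-- If `0 ≤ w ≤ ε P` as quadratic forms with `det P ≤ 1 / 4` for arbitrarily small `ε`, then `w`
has rank at most one; here for a diagonal `w`. -/
theorem mul_eq_zero_of_form_le {w : Fin 2 → Fin 2 → ℝ} {P : ℝ → Fin 2 → Fin 2 → ℝ}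
    (h : ∀ a b, 0 ≤ a ^ 2 * w 0 0 + 2 * (a * b) * w 0 1 + b ^ 2 * w 1 1)
    (hle : ∀ ε, 0 < ε → ∀ a b, a ^ 2 * w 0 0 + 2 * (a * b) * w 0 1 + b ^ 2 * w 1 1 ≤
      ε * (a ^ 2 * P ε 0 0 + 2 * (a * b) * P ε 0 1 + b ^ 2 * P ε 1 1))
    (hdet : ∀ ε, 0 < ε → P ε 0 0 * P ε 1 1 - P ε 0 1 ^ 2 ≤ 1 / 4) (h01 : w 0 1 = 0) :
    w 0 0 * w 1 1 = 0 := by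
  have h0 := nonneg_diag h 0
  have h1 := nonneg_diag h 1
  simp only [h01, mul_zero, add_zero] at hle
  have key : ∀ ε, 0 < ε → w 0 0 * w 1 1 ≤ ε ^ 2 / 4 := fun ε hε => by
    have hd := hdet ε hε
    have d0 : w 0 0 ≤ ε * P ε 0 0 := by simpa using hle ε hε 1 0
    have d1 : w 1 1 ≤ ε * P ε 1 1 := by simpa using hle ε hε 0 1
    set u := ε * P ε 0 0 - w 0 0 with hu
    set v := ε * P ε 1 1 - w 1 1 with hv
    set q := ε * P ε 0 1 with hq
    have hform : ∀ a b, 0 ≤ a ^ 2 * u + 2 * (a * b) * q + b ^ 2 * v := fun a b => by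
      have := hle ε hε a b
      rw [hu, hv, hq]; linarith
    have hdisc : q ^ 2 ≤ u * v := by
      have hu0 : 0 ≤ u := by simpa using hform 1 0
      rcases hu0.eq_or_lt with hu0 | hu0
      · by_contra hcon
        have hq0 : q ≠ 0 := fun h => hcon (by rw [h, ← hu0]; simp)
        have := hform (-(v + 1) / (2 * q)) 1
        rw [← hu0] at this hcon
        have e : 2 * (-(v + 1) / (2 * q) * 1) * q = -(v + 1) := by field_simp
        rw [e] at this
        linarith
      · have := hform (-q) u
        have e : (-q) ^ 2 * u + 2 * (-q * u) * q + u ^ 2 * v = u * (u * v - q ^ 2) := by ring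
        rw [e] at this
        linarith [nonneg_of_mul_nonneg_right this hu0]
    have hd2 : (u + w 0 0) * (v + w 1 1) - q ^ 2 ≤ ε ^ 2 / 4 := by
      have := mul_le_mul_of_nonneg_left hd (sq_nonneg ε)
      rw [hu, hv, hq]; nlinarith
    nlinarith [mul_nonneg (sub_nonneg.mpr d0) h1, mul_nonneg (sub_nonneg.mpr d1) h0]
  refine le_antisymm ?_ (mul_nonneg h0 h1)
  have hc : Continuous fun ε : ℝ => ε ^ 2 / 4 := by fun_prop
  have := (hc.tendsto 0).mono_left (nhdsWithin_le_nhds (s := Set.Ioi 0))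
  refine ge_of_tendsto (by simpa using this) ?_
  filter_upwards [self_mem_nhdsWithin] with ε hε using key ε hε

namespace MatrixApprox

variable {P : Fin 2 → Fin 2 → ℝ → ℝ → ℝ} {σ : ℕ → Measure ℝ}
  {W : ℕ → Fin 2 → Fin 2 → ℝ → ℝ}

/-- The quadratic form of the limit `P` is nonnegative. -/
theorem nonneg_limit (h : MatrixApprox P σ W) {ν ε : ℝ} (hε : 0 < ε) (a b : ℝ) :
    0 ≤ a ^ 2 * P 0 0 ν ε + 2 * (a * b) * P 0 1 ν ε + b ^ 2 * P 1 1 ν ε := by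
  have h1 := ((((h.entry 0 0).const_mul (a ^ 2)).add ((h.entry 0 1).const_mul (2 * (a * b)))).add
    ((h.entry 1 1).const_mul (b ^ 2))).tendsto ν ε hε
  exact ge_of_tendsto' h1 fun n => integral_nonneg fun s =>
    mul_nonneg (h.nonneg n s a b) (poisson_pos hε _ _).le

theorem symm_limit (h : MatrixApprox P σ W) {ν ε : ℝ} (hε : 0 < ε) : P 1 0 ν ε = P 0 1 ν ε := by
  refine tendsto_nhds_unique ((h.entry 1 0).tendsto ν ε hε) ?_
  simpa only [h.symm] using (h.entry 0 1).tendsto ν ε hε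

/-- The integrals of the quadratic form converge to the quadratic form of the limits. -/
theorem tendsto_form {A B : Fin 2 → Fin 2 → Measure ℝ} (h : MatrixApprox P σ W)
    (hAB : ∀ j k, ∀ f : ℝ → ℝ, Continuous f → HasCompactSupport f →
      Tendsto (fun n => ∫ s, W n j k s * f s ∂σ n) atTop (𝓝 (∫ s, f s ∂A j k - ∫ s, f s ∂B j k)))
    {f : ℝ → ℝ} (hf : Continuous f) (hfc : HasCompactSupport f) (a b : ℝ) :
    Tendsto (fun n => ∫ s, (a ^ 2 * W n 0 0 s + 2 * (a * b) * W n 0 1 s + b ^ 2 * W n 1 1 s) * f s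
      ∂σ n) atTop (𝓝 (a ^ 2 * (∫ s, f s ∂A 0 0 - ∫ s, f s ∂B 0 0) +
        2 * (a * b) * (∫ s, f s ∂A 0 1 - ∫ s, f s ∂B 0 1) +
        b ^ 2 * (∫ s, f s ∂A 1 1 - ∫ s, f s ∂B 1 1))) := by
  refine ((((hAB 0 0 f hf hfc).const_mul _).add ((hAB 0 1 f hf hfc).const_mul _)).add
    ((hAB 1 1 f hf hfc).const_mul _)).congr fun n => ?_
  have i0 : Integrable (fun s => a ^ 2 * (W n 0 0 s * f s)) (σ n) :=
    ((h.entry 0 0).integrable_mul n hf hfc).const_mul _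
  have i1 : Integrable (fun s => 2 * (a * b) * (W n 0 1 s * f s)) (σ n) :=
    ((h.entry 0 1).integrable_mul n hf hfc).const_mul _
  have i2 : Integrable (fun s => b ^ 2 * (W n 1 1 s * f s)) (σ n) :=
    ((h.entry 1 1).integrable_mul n hf hfc).const_mul _
  have i01 : Integrable (fun s => a ^ 2 * (W n 0 0 s * f s) + 2 * (a * b) * (W n 0 1 s * f s))
    (σ n) := i0.add i1
  rw [← integral_const_mul, ← integral_const_mul, ← integral_const_mul, ← integral_add i0 i1,
    ← integral_add i01 i2]
  refine integral_congr_ae (Eventually.of_forall fun s => ?_)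
  simp only
  ring

/-- Each entry of the limit is a difference of two measures, the limits of
`(w_jj + w_kk) / 2 + w_jk`
and `(w_jj + w_kk) / 2`, which are nonnegative. -/
theorem exists_measures (h : MatrixApprox P σ W) (j k : Fin 2) :
    ∃ A B : Measure ℝ, IsLocallyFiniteMeasure A ∧ IsLocallyFiniteMeasure B ∧
      ∀ f : ℝ → ℝ, Continuous f → HasCompactSupport f →
        Tendsto (fun n => ∫ s, W n j k s * f s ∂σ n) atTop (𝓝 (∫ s, f s ∂A - ∫ s, f s ∂B)) := by
  have habs := fun n s => abs_le.mp
    (abs_entry_le (w := fun j k => W n j k s) (h.symm n s) (h.nonneg n s) j k one_pos)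
  have hnn := fun n s => nonneg_diag (w := fun j k => W n j k s) (h.nonneg n s)
  simp only [inv_one, one_mul] at habs
  have hB := ((h.entry j j).add (h.entry k k)).const_mul (1 / 2)
  have hA := hB.add (h.entry j k)
  obtain ⟨A, hA1, hA2⟩ := hA.exists_measure fun n s => by linarith [(habs n s).1]
  obtain ⟨B, hB1, hB2⟩ := hB.exists_measure fun n s => by linarith [hnn n s j, hnn n s k]
  refine ⟨A, B, hA1, hB1, fun f hf hfc => ((hA2 f hf hfc).sub (hB2 f hf hfc)).congr fun n => ?_⟩
  rw [← integral_sub (hA.integrable_mul n hf hfc) (hB.integrable_mul n hf hfc)]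
  refine integral_congr_ae (Eventually.of_forall fun s => ?_)
  simp only
  ring

end MatrixApprox

end

/-! ### Stieltjes inversion for matrices -/

/-- **Stieltjes inversion for matrices.** If `P` is a pointwise limit of Poisson integrals of
nonnegative matrix densities, and `det P ≤ 1 / 4`, then there is a nondecreasing matrix function
`ρ` whose increments are the limits of the increments of *every* sequence of densities
approximating `P`, and of the integrals of `P / π` along horizontal lines approaching the real
axis. The bound on the determinant forces the jumps of `ρ` to have rank at most one, so that
continuity of the single entry `ρ j k` suffices for the convergence of this entry. -/
theorem MatrixApprox.exists_spectral_function {P : Fin 2 → Fin 2 → ℝ → ℝ → ℝ}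
    {σ₀ : ℕ → Measure ℝ} {W₀ : ℕ → Fin 2 → Fin 2 → ℝ → ℝ} (h₀ : MatrixApprox P σ₀ W₀)
    (hdet : ∀ ν ε, 0 < ε → P 0 0 ν ε * P 1 1 ν ε - P 0 1 ν ε ^ 2 ≤ 1 / 4) :
    ∃ ρ : Fin 2 → Fin 2 → ℝ → ℝ, ρ 1 0 = ρ 0 1 ∧
      (∀ y x, y ≤ x → ∀ a b, 0 ≤ a ^ 2 * (ρ 0 0 x - ρ 0 0 y) +
        2 * (a * b) * (ρ 0 1 x - ρ 0 1 y) + b ^ 2 * (ρ 1 1 x - ρ 1 1 y)) ∧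
      (∀ j k, LocallyBoundedVariationOn (ρ j k) Set.univ) ∧
      (∀ σ W, MatrixApprox P σ W → ∀ j k y x, y ≤ x → ContinuousAt (ρ j k) x →
        ContinuousAt (ρ j k) y →
        Tendsto (fun n => ∫ s in Set.Ioc y x, W n j k s ∂σ n) atTop (𝓝 (ρ j k x - ρ j k y))) ∧
      (∀ j k y x, y ≤ x → ContinuousAt (ρ j k) x → ContinuousAt (ρ j k) y →
        Tendsto (fun ε => (1 / Real.pi) * ∫ ν in Set.Ioc y x, P j k ν ε) (𝓝[>] 0)
          (𝓝 (ρ j k x - ρ j k y))) := by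
  choose A₀ B₀ hA₀ hB₀ hAB₀ using h₀.exists_measures
  obtain ⟨A, B, hA, hB, hAs, hBs, hAB⟩ : ∃ A B : Fin 2 → Fin 2 → Measure ℝ,
      (∀ j k, IsLocallyFiniteMeasure (A j k)) ∧ (∀ j k, IsLocallyFiniteMeasure (B j k)) ∧
      A 1 0 = A 0 1 ∧ B 1 0 = B 0 1 ∧ ∀ j k, ∀ f : ℝ → ℝ, Continuous f → HasCompactSupport f →
        Tendsto (fun n => ∫ s, W₀ n j k s * f s ∂σ₀ n) atTop
          (𝓝 (∫ s, f s ∂A j k - ∫ s, f s ∂B j k)) := by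
    -- the choice is made for `j ≤ k` only, so that the result is symmetric
    refine ⟨fun j k => A₀ (min j k) (max j k), fun j k => B₀ (min j k) (max j k),
      fun _ _ => hA₀ _ _, fun _ _ => hB₀ _ _, rfl, rfl, fun j k f hf hfc => ?_⟩
    refine (hAB₀ (min j k) (max j k) f hf hfc).congr fun n => ?_
    fin_cases j <;> fin_cases k
    · rfl
    · rfl
    · change ∫ s, W₀ n 0 1 s * f s ∂σ₀ n = ∫ s, W₀ n 1 0 s * f s ∂σ₀ n
      simp only [h₀.symm]
    · rfl
  choose U hU hUlim using fun j => (h₀.entry j j).exists_measure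
    fun n s => nonneg_diag (w := fun j k => W₀ n j k s) (h₀.nonneg n s) j
  -- both the densities and the boundary values of `P` converge vaguely to `A - B`
  have hlimP : ∀ j k, ∀ f : ℝ → ℝ, Continuous f → HasCompactSupport f →
      Tendsto (fun ε => (1 / Real.pi) * ∫ ν, f ν * P j k ν ε) (𝓝[>] 0)
        (𝓝 (∫ s, f s ∂A j k - ∫ s, f s ∂B j k)) := fun j k f hf hfc => by
    obtain ⟨L, h1, h2⟩ := (h₀.entry j k).exists_limit hf hfc
    rwa [tendsto_nhds_unique (hAB j k f hf hfc) h1]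
  have hUAB : ∀ j, ∀ f : ℝ → ℝ, Continuous f → HasCompactSupport f →
      ∫ s, f s ∂A j j - ∫ s, f s ∂B j j = ∫ s, f s ∂U j := fun j f hf hfc =>
    tendsto_nhds_unique (hAB j j f hf hfc) (hUlim j f hf hfc)
  have hlimW : ∀ σ W, MatrixApprox P σ W → ∀ j k, ∀ f : ℝ → ℝ, Continuous f →
      HasCompactSupport f → Tendsto (fun n => ∫ s, W n j k s * f s ∂σ n) atTop
        (𝓝 (∫ s, f s ∂A j k - ∫ s, f s ∂B j k)) := fun σ W h j k f hf hfc => by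
    obtain ⟨L, h1, h2⟩ := (h.entry j k).exists_limit hf hfc
    rwa [tendsto_nhds_unique (hlimP j k f hf hfc) h2]
  -- the atoms are the limits of the integrals of ever narrower tents
  have hatomlim : ∀ j k x, Tendsto (fun i : ℕ => ∫ s, tent i (s - x) ∂A j k -
      ∫ s, tent i (s - x) ∂B j k) atTop (𝓝 ((A j k).real {x} - (B j k).real {x})) :=
    fun j k x => (tendsto_integral_tent (A j k) x).sub (tendsto_integral_tent (B j k) x)
  have hatomU : ∀ j x, (A j j).real {x} - (B j j).real {x} = (U j).real {x} := fun j x => by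
    refine tendsto_nhds_unique (hatomlim j j x) ((tendsto_integral_tent (U j) x).congr' ?_)
    filter_upwards [eventually_ge_atTop 1] with i hi
    exact (hUAB j _ (continuous_tent_sub i x) (hasCompactSupport_tent hi x)).symm
  have hatom : ∀ j k x, (A j k).real {x} - (B j k).real {x} = 0 →
      (U j).real {x} * (U k).real {x} = 0 := fun j k x hjk => by
    have hprod : (A 0 1).real {x} - (B 0 1).real {x} = 0 →
        (U 0).real {x} * (U 1).real {x} = 0 := fun h01 => by
      rw [← hatomU, ← hatomU]
      have hform := fun a b => (((hatomlim 0 0 x).const_mul (a ^ 2)).add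
        ((hatomlim 0 1 x).const_mul (2 * (a * b)))).add ((hatomlim 1 1 x).const_mul (b ^ 2))
      refine mul_eq_zero_of_form_le (w := fun j k => (A j k).real {x} - (B j k).real {x})
        (P := fun ε j k => P j k x ε) (fun a b => ?_) (fun ε hε a b => ?_)
        (fun ε hε => hdet x ε hε) h01
      · refine ge_of_tendsto (hform a b) ?_
        filter_upwards [eventually_ge_atTop 1] with i hi
        refine ge_of_tendsto' (h₀.tendsto_form hAB (continuous_tent_sub i x)
          (hasCompactSupport_tent hi x) a b) fun n => integral_nonneg fun s =>
          mul_nonneg (h₀.nonneg n s a b) (tent_nonneg _ _)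
      · refine le_of_tendsto (hform a b) ?_
        obtain ⟨N, hN⟩ := exists_nat_ge (1 / ε)
        filter_upwards [eventually_ge_atTop 1, eventually_ge_atTop N] with i hi hiN
        have hP := ((((h₀.entry 0 0).const_mul (a ^ 2)).add
          ((h₀.entry 0 1).const_mul (2 * (a * b)))).add ((h₀.entry 1 1).const_mul (b ^ 2)))
        have hq := hP.integrable_mul
        refine le_of_tendsto_of_tendsto' (h₀.tendsto_form hAB (continuous_tent_sub i x)
          (hasCompactSupport_tent hi x) a b) ((hP.tendsto x ε hε).const_mul ε) fun n => ?_
        rw [← integral_const_mul]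
        refine integral_mono (hq n (continuous_tent_sub i x) (hasCompactSupport_tent hi x))
          ((integrable_mul_poisson (hP.integrable n) (hP.meas n) hε x).const_mul ε) fun s => ?_
        simp only
        rw [mul_left_comm ε]
        refine mul_le_mul_of_nonneg_left ?_ (h₀.nonneg n s a b)
        -- `1 - t ≤ 1 / (1 + t²)` for `t = |s - x| / ε`
        rw [poisson, mul_div_assoc', le_div_iff₀ (by positivity)]
        have hiN' : (N : ℝ) ≤ i := by exact_mod_cast hiN
        have h1 : 1 ≤ i * ε := by
          rw [div_le_iff₀ hε] at hN
          nlinarith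
        rw [← sq_abs (s - x)]
        have ht := abs_nonneg (s - x)
        set t := |s - x| with htdef
        rw [tent, ← htdef]
        rcases le_total (1 - i * t) 0 with h2 | h2
        · rw [max_eq_left h2, zero_mul]; positivity
        · rw [max_eq_right h2]
          have h3 : t ≤ ε := by nlinarith
          have h4 : 1 - i * t ≤ 1 - t / ε := by
            have : t / ε ≤ i * t := by rw [div_le_iff₀ hε]; nlinarith
            linarith
          have h5 : (1 - t / ε) * (t ^ 2 + ε ^ 2) ≤ ε * ε := by
            have e : (1 - t / ε) * (t ^ 2 + ε ^ 2) = ε * ε - t / ε * (t ^ 2 - t * ε + ε ^ 2) := by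
              field_simp; ring
            have : 0 ≤ t / ε * (t ^ 2 - t * ε + ε ^ 2) :=
              mul_nonneg (by positivity) (by nlinarith [sq_nonneg (t - ε)])
            linarith
          exact (mul_le_mul_of_nonneg_right h4 (by positivity)).trans h5
    have hdiag : ∀ j, (A j j).real {x} - (B j j).real {x} = 0 →
        (U j).real {x} * (U j).real {x} = 0 := fun j hj => by
      rw [← hatomU, hj, zero_mul]
    fin_cases j <;> fin_cases k
    · exact hdiag 0 hjk
    · exact hprod hjk
    · change (A 1 0).real {x} - (B 1 0).real {x} = 0 at hjk
      rw [hAs, hBs] at hjk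
      exact (mul_comm _ _).trans (hprod hjk)
    · exact hdiag 1 hjk
  have hinc : ∀ j k y x, y ≤ x → (distribution (A j k) x - distribution (B j k) x) -
      (distribution (A j k) y - distribution (B j k) y) =
      (A j k).real (Set.Ioc y x) - (B j k).real (Set.Ioc y x) := fun j k y x hyx => by
    rw [← distribution_sub (A j k) hyx, ← distribution_sub (B j k) hyx]; ring
  refine ⟨fun j k x => distribution (A j k) x - distribution (B j k) x, ?_, ?_, ?_, ?_, ?_⟩
  · funext x
    simp only [hAs, hBs]
  · intro y x hyx a b
    simp only [hinc _ _ y x hyx]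
    have hT := fun j k => (tendsto_integral_trapezoid (A j k) hyx).sub
      (tendsto_integral_trapezoid (B j k) hyx)
    refine ge_of_tendsto ((((hT 0 0).const_mul (a ^ 2)).add ((hT 0 1).const_mul (2 * (a * b)))).add
      ((hT 1 1).const_mul (b ^ 2))) ?_
    filter_upwards [eventually_ge_atTop 1] with i hi
    exact ge_of_tendsto' (h₀.tendsto_form hAB (continuous_trapezoid i y x)
      (hasCompactSupport_trapezoid hi hyx) a b) fun n => integral_nonneg fun s =>
      mul_nonneg (h₀.nonneg n s a b) (trapezoid_nonneg _ hyx _)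
  · exact fun j k => locallyBoundedVariationOn_distribution_sub (A j k) (B j k)
  · intro σ W h j k y x hyx hx hy
    simp only [hinc _ _ y x hyx]
    refine tendsto_setIntegral_Ioc (u := fun n => W n j j) (v := fun n => W n k k) (U := U j)
      (V := U k) (Eventually.of_forall fun n a b => (h.entry j k).integrableOn_density n a b)
      (Eventually.of_forall fun n a b => (h.entry j j).integrableOn_density n a b)
      (Eventually.of_forall fun n a b => (h.entry k k).integrableOn_density n a b)
      (Eventually.of_forall fun n s θ hθ => abs_entry_le (w := fun j k => W n j k s)
        (h.symm n s) (h.nonneg n s) j k hθ) (hlimW σ W h j k)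
      (fun f hf hfc => ?_) (fun f hf hfc => ?_) hyx
      (hatom j k x (measureReal_singleton_eq_of_continuousAt hx))
      (hatom j k y (measureReal_singleton_eq_of_continuousAt hy))
    · rw [← hUAB j f hf hfc]; exact hlimW σ W h j j f hf hfc
    · rw [← hUAB k f hf hfc]; exact hlimW σ W h k k f hf hfc
  · intro j k y x hyx hx hy
    simp only [hinc _ _ y x hyx, ← integral_const_mul]
    have hpos : ∀ᶠ ε in 𝓝[>] (0 : ℝ), 0 < ε := self_mem_nhdsWithin
    have hL : ∀ j k, ∀ f : ℝ → ℝ, Continuous f → HasCompactSupport f →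
        Tendsto (fun ε => ∫ ν, 1 / Real.pi * P j k ν ε * f ν) (𝓝[>] 0)
          (𝓝 (∫ s, f s ∂A j k - ∫ s, f s ∂B j k)) := fun j k f hf hfc => by
      refine (hlimP j k f hf hfc).congr fun ε => ?_
      rw [← integral_const_mul]
      refine integral_congr_ae (Eventually.of_forall fun ν => ?_)
      simp only
      ring
    refine tendsto_setIntegral_Ioc (σ := fun _ => volume)
      (w := fun ε ν => 1 / Real.pi * P j k ν ε)
      (u := fun ε ν => 1 / Real.pi * P j j ν ε) (v := fun ε ν => 1 / Real.pi * P k k ν ε)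
      (U := U j) (V := U k)
      (hpos.mono fun ε hε a b => ((h₀.entry j k).integrableOn hε a b).const_mul _)
      (hpos.mono fun ε hε a b => ((h₀.entry j j).integrableOn hε a b).const_mul _)
      (hpos.mono fun ε hε a b => ((h₀.entry k k).integrableOn hε a b).const_mul _)
      (hpos.mono fun ε hε ν θ hθ => ?_) (hL j k)
      (fun f hf hfc => ?_) (fun f hf hfc => ?_) hyx
      (hatom j k x (measureReal_singleton_eq_of_continuousAt hx))
      (hatom j k y (measureReal_singleton_eq_of_continuousAt hy))
    · have := abs_entry_le (w := fun j k => P j k ν ε) (h₀.symm_limit hε)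
        (h₀.nonneg_limit hε) j k hθ
      rw [abs_mul, abs_of_pos (by positivity : 0 < 1 / Real.pi)]
      have h2 := mul_le_mul_of_nonneg_left this (by positivity : 0 ≤ 1 / Real.pi)
      linarith
    · rw [← hUAB j f hf hfc]; exact hL j j f hf hfc
    · rw [← hUAB k f hf hfc]; exact hL k k f hf hfc

/-! ### The spectral matrices of finite problems -/

section

variable {p q : ℝ → ℝ} {c : ℝ}

/-- Counting measure on the points of a countable set of reals. -/
noncomputable def countOn (S : Set ℝ) : Measure ℝ :=
  Measure.map (Subtype.val : S → ℝ) Measure.count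

section CountOn

variable {S : Set ℝ}

theorem sfinite_countOn (hS : S.Countable) : SFinite (countOn S) := by
  have := hS.to_subtype
  unfold countOn
  infer_instance

theorem integrable_countOn_iff (hS : S.Countable) {g : ℝ → ℝ} :
    Integrable g (countOn S) ↔ Summable fun s : S => ‖g s‖ := by
  rw [countOn, (MeasurableEmbedding.subtype_coe hS.measurableSet).integrable_map_iff,
    integrable_count_iff]
  rfl

theorem integral_countOn (hS : S.Countable) {g : ℝ → ℝ} (hg : Integrable g (countOn S)) :
    ∫ s, g s ∂countOn S = ∑' s : S, g s := by
  have := hS.to_subtype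
  have hg' := hg
  rw [countOn, (MeasurableEmbedding.subtype_coe hS.measurableSet).integrable_map_iff] at hg'
  rw [countOn, (MeasurableEmbedding.subtype_coe hS.measurableSet).integral_map]
  refine (integral_countable hg').trans (tsum_congr fun s => ?_)
  simp [measureReal_def]

theorem integrable_integral_countOn_of_hasSum (hS : S.Countable) {g : ℝ → ℝ} {L : ℝ}
    (hsupp : Function.support g ⊆ S) (h : HasSum g L) :
    Integrable g (countOn S) ∧ ∫ s, g s ∂countOn S = L := by
  have h' := (hasSum_subtype_iff_of_support_subset hsupp).mpr h
  have hi : Integrable g (countOn S) :=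
    (integrable_countOn_iff hS).mpr h'.summable.norm
  exact ⟨hi, (integral_countOn hS hi).trans h'.tsum_eq⟩

theorem setIntegral_countOn (hS : S.Countable) {g : ℝ → ℝ} {E : Set ℝ} (hE : MeasurableSet E)
    (hsupp : Function.support g ⊆ S) (hfin : (S ∩ E).Finite) :
    ∫ s in E, g s ∂countOn S = ∑ᶠ s ∈ E, g s := by
  have hsub : Function.support (E.indicator g) ⊆ S ∩ E := by
    rw [Set.support_indicator]
    exact fun s hs => ⟨hsupp hs.2, hs.1⟩
  have hf : (Function.support (E.indicator g)).Finite := hfin.subset hsub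
  rw [← integral_indicator hE, finsum_mem_def,
    ← tsum_eq_finsum (L := SummationFilter.unconditional ℝ) hf]
  exact (integrable_integral_countOn_of_hasSum hS (hsub.trans Set.inter_subset_left)
    (summable_of_hasFiniteSupport hf : Summable _).hasSum).2

end CountOn

theorem finite_eigSet_inter_Ioc (hC : Coeffs p q) (hc : 0 < c) (δ : FiniteProblem c)
    (hac : δ.a < c) (hcb : c < δ.b) (y x : ℝ) : (eigSet p q δ ∩ Set.Ioc y x).Finite :=
  (finite_eigSet_inter hC hc δ hac hcb (max |y| |x|)).subset fun _ hs =>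
    ⟨hs.1, abs_le_max_abs_abs hs.2.1.le hs.2.2⟩

theorem countable_eigSet (hC : Coeffs p q) (hc : 0 < c) (δ : FiniteProblem c)
    (hac : δ.a < c) (hcb : c < δ.b) : (eigSet p q δ).Countable := by
  refine (Set.countable_iUnion fun n : ℕ =>
    (finite_eigSet_inter hC hc δ hac hcb n).countable).mono fun s hs => ?_
  obtain ⟨n, hn⟩ := exists_nat_ge |s|
  exact Set.mem_iUnion.mpr ⟨n, hs, hn⟩

/-- The density of the spectral matrix of `δ` with respect to counting measure on the
eigenvalues. -/
noncomputable def spectralDensity (p q : ℝ → ℝ) {c : ℝ} (δ : FiniteProblem c) (j k : Fin 2)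
    (s : ℝ) : ℝ := eigVec p q δ s j * eigVec p q δ s k

theorem support_spectralDensity (δ : FiniteProblem c) (j k : Fin 2) :
    Function.support (spectralDensity p q δ j k) ⊆ eigSet p q δ := fun s hs h => by
  refine hs ?_
  simp [spectralDensity, h]

theorem finiteSpectralMatrix_sub (hC : Coeffs p q) (hc : 0 < c) (δ : FiniteProblem c)
    (hac : δ.a < c) (hcb : c < δ.b) (j k : Fin 2) {y x : ℝ} (hyx : y ≤ x) :
    finiteSpectralMatrix p q δ x j k - finiteSpectralMatrix p q δ y j k =
      ((∫ s in Set.Ioc y x, spectralDensity p q δ j k s ∂countOn (eigSet p q δ) : ℝ) : ℂ) := by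
  have hS := countable_eigSet hC hc δ hac hcb
  have hjump : ∀ s, spectralJump p q δ s j k = ((spectralDensity p q δ j k s : ℝ) : ℂ) :=
      fun s => by
    rw [spectralJump_eq hC hc, spectralDensity]; push_cast; rfl
  have hsupp := support_spectralDensity (p := p) (q := q) δ j k
  have hfin := finite_eigSet_inter_Ioc hC hc δ hac hcb
  have hsum : ∀ a b : ℝ, ∑ᶠ s ∈ Set.Ioc a b, spectralJump p q δ s j k =
      ((∑ᶠ s ∈ Set.Ioc a b, spectralDensity p q δ j k s : ℝ) : ℂ) := fun a b => by
    have hf : (Function.support ((Set.Ioc a b).indicator (spectralDensity p q δ j k))).Finite := by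
      rw [Set.support_indicator]
      exact (hfin a b).subset fun s hs => ⟨hsupp hs.2, hs.1⟩
    rw [finsum_mem_def, finsum_mem_def]
    refine Eq.trans ?_ (Complex.ofRealHom.toAddMonoidHom.map_finsum hf).symm
    refine finsum_congr fun s => ?_
    by_cases hs : s ∈ Set.Ioc a b
    · simp [hs, hjump]
    · simp [hs]
  have hadd : ∀ a b d : ℝ, a ≤ b → b ≤ d → ∑ᶠ s ∈ Set.Ioc a d, spectralDensity p q δ j k s =
      (∑ᶠ s ∈ Set.Ioc a b, spectralDensity p q δ j k s) +
        ∑ᶠ s ∈ Set.Ioc b d, spectralDensity p q δ j k s := fun a b d hab hbd => by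
    rw [← Set.Ioc_union_Ioc_eq_Ioc hab hbd]
    exact finsum_mem_union' (Set.Ioc_disjoint_Ioc_of_le le_rfl)
      ((hfin a b).subset fun s hs => ⟨hsupp hs.2, hs.1⟩)
      ((hfin b d).subset fun s hs => ⟨hsupp hs.2, hs.1⟩)
  rw [setIntegral_countOn hS measurableSet_Ioc hsupp (hfin y x)]
  simp only [finiteSpectralMatrix, Matrix.of_apply, hsum]
  split_ifs with hx hy hy
  · rw [hadd 0 y x hy hyx]; push_cast; ring
  · rw [hadd y 0 x (not_le.mp hy).le hx]; push_cast; ring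
  · exact absurd (hy.trans hyx) hx
  · rw [hadd y x 0 hyx (not_le.mp hx).le]; push_cast; ring

/-- `det (Im M) = - Im m · Im m' / |m' - m|²` is at most `1 / 4`. -/
theorem im_matrixM_det_le {m' m : ℂ} (h : m' ≠ m) :
    (matrixM m' m 0 0).im * (matrixM m' m 1 1).im - (matrixM m' m 0 1).im ^ 2 ≤ 1 / 4 := by
  have hN : 0 < Complex.normSq (m' - m) := Complex.normSq_pos.mpr (sub_ne_zero.mpr h)
  have e0 : (matrixM m' m 0 0).im = -(m'.im - m.im) / Complex.normSq (m' - m) := by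
    simp [matrixM]
  have e1 : (matrixM m' m 1 1).im = ((m'.re * m.im + m'.im * m.re) * (m'.re - m.re) -
      (m'.re * m.re - m'.im * m.im) * (m'.im - m.im)) / Complex.normSq (m' - m) := by
    simp [matrixM, Complex.div_im]
    ring
  have e2 : (matrixM m' m 0 1).im = (m'.re * m.im - m'.im * m.re) /
      Complex.normSq (m' - m) := by
    simp [matrixM, Complex.div_im]
    ring
  have hns : Complex.normSq (m' - m) = (m'.re - m.re) ^ 2 + (m'.im - m.im) ^ 2 := by
    rw [Complex.normSq_apply, Complex.sub_re, Complex.sub_im]; ring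
  have hdet : (matrixM m' m 0 0).im * (matrixM m' m 1 1).im - (matrixM m' m 0 1).im ^ 2 =
      -(m'.im * m.im) / Complex.normSq (m' - m) := by
    rw [e0, e1, e2, eq_div_iff hN.ne']
    rw [hns] at hN ⊢
    field_simp
    ring
  rw [hdet, div_le_iff₀ hN, hns]
  nlinarith [sq_nonneg (m'.im + m.im), sq_nonneg (m'.re - m.re)]

theorem tendsto_im_matrixM {ι : Type*} {F : Filter ι} {u' u : ι → ℂ} {m' m : ℂ}
    (h' : Tendsto u' F (𝓝 m')) (h : Tendsto u F (𝓝 m)) (hne : m' ≠ m) (j k : Fin 2) :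
    Tendsto (fun i => (matrixM (u' i) (u i) j k).im) F (𝓝 (matrixM m' m j k).im) := by
  have hd := h'.sub h
  have hd0 : m' - m ≠ 0 := sub_ne_zero.mpr hne
  have hC := (Complex.continuous_im.tendsto (matrixM m' m j k))
  refine hC.comp ?_
  fin_cases j <;> fin_cases k
  · exact tendsto_const_nhds.div hd hd0
  · exact ((h'.add h).div hd hd0).const_mul _
  · exact ((h'.add h).div hd hd0).const_mul _
  · exact (h'.mul h).div hd hd0

/-- The spectral matrices of problems on intervals exhausting `(0, ∞)` have Poisson integrals
converging to `Im M`. -/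
theorem matrixApprox_of_exhausts (hC : Coeffs p q) (hc : 0 < c) {m' m : ℂ → ℂ}
    (hm' : ∀ l : ℂ, l.im ≠ 0 → IsWeylLimitPoint p q c l (𝓝[>] 0) (m' l))
    (hm : ∀ l : ℂ, l.im ≠ 0 → IsWeylLimitPoint p q c l atTop (m l))
    (hne : ∀ l : ℂ, l.im ≠ 0 → m' l ≠ m l) {δ : ℕ → FiniteProblem c} (hδ : ExhaustsHalfLine δ)
    (hac : ∀ n, (δ n).a < c) (hcb : ∀ n, c < (δ n).b) :
    MatrixApprox (fun j k ν ε =>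
        (matrixM (m' (ν + ε * Complex.I)) (m (ν + ε * Complex.I)) j k).im)
      (fun n => countOn (eigSet p q (δ n))) (fun n => spectralDensity p q (δ n)) := by
  have hS := fun n => countable_eigSet hC hc (δ n) (hac n) (hcb n)
  have key : ∀ ν ε : ℝ, 0 < ε → ∀ j k, (∀ n, Integrable (fun s => spectralDensity p q (δ n) j k s *
      poisson ε ν s) (countOn (eigSet p q (δ n)))) ∧
      Tendsto (fun n => ∫ s, spectralDensity p q (δ n) j k s * poisson ε ν s
        ∂countOn (eigSet p q (δ n))) atTop
        (𝓝 (matrixM (m' (ν + ε * Complex.I)) (m (ν + ε * Complex.I)) j k).im) := by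
    intro ν ε hε j k
    set l : ℂ := ν + ε * Complex.I with hl
    have hre : l.re = ν := by simp [hl]
    have him : l.im = ε := by simp [hl]
    have hl0 : l.im ≠ 0 := by rw [him]; exact hε.ne'
    choose u' hu'1 hu'2 using fun n => exists_mem_weylCircle hC hc hl0 (δ n).a_pos (hac n).ne
      (δ n).β'_mem
    choose u hu1 hu2 using fun n => exists_mem_weylCircle hC hc hl0 (δ n).b_pos (hcb n).ne'
      (δ n).β_mem
    have ha : Tendsto (fun n => (δ n).a) atTop (𝓝[>] 0) :=
      tendsto_nhdsWithin_iff.mpr ⟨hδ.1, Eventually.of_forall fun n => (δ n).a_pos⟩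
    have ht' : Tendsto u' atTop (𝓝 (m' l)) := fun V hV =>
      (ha.eventually (hm' l hl0 V hV)).mono fun n h => h.2 (hu'1 n)
    have ht : Tendsto u atTop (𝓝 (m l)) := fun V hV =>
      (hδ.2.eventually (hm l hl0 V hV)).mono fun n h => h.2 (hu1 n)
    have hsum : ∀ n, Integrable (fun s => spectralDensity p q (δ n) j k s *
        poisson ε ν s) (countOn (eigSet p q (δ n))) ∧
        ∫ s, spectralDensity p q (δ n) j k s * poisson ε ν s ∂countOn (eigSet p q (δ n)) =
          (matrixM (u' n) (u n) j k).im := fun n => by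
      have h := hasSum_im_matrixM hC hc (δ n) hl0 (hac n) (hcb n) (hu'2 n) (hu2 n) j k
      rw [hre, him] at h
      exact integrable_integral_countOn_of_hasSum (hS n)
        ((Function.support_mul_subset_left _ _).trans (support_spectralDensity (δ n) j k)) h
    refine ⟨fun n => (hsum n).1, ?_⟩
    simp only [fun n => (hsum n).2]
    exact tendsto_im_matrixM ht' ht (hne l hl0) j k
  have hp1 : ∀ s, poisson 1 0 s = (1 + s ^ 2)⁻¹ := fun s => by
    simp [poisson, add_comm]
  have hint : ∀ j k n, Integrable (fun s => spectralDensity p q (δ n) j k s * (1 + s ^ 2)⁻¹)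
      (countOn (eigSet p q (δ n))) := fun j k n => by
    simpa only [hp1] using (key 0 1 one_pos j k).1 n
  have hform : ∀ n s a b, 0 ≤ a ^ 2 * spectralDensity p q (δ n) 0 0 s +
      2 * (a * b) * spectralDensity p q (δ n) 0 1 s + b ^ 2 * spectralDensity p q (δ n) 1 1 s :=
    fun n s a b => by
      unfold spectralDensity
      nlinarith [sq_nonneg (a * eigVec p q (δ n) s 0 + b * eigVec p q (δ n) s 1)]
  have hsymm : ∀ n s, spectralDensity p q (δ n) 1 0 s = spectralDensity p q (δ n) 0 1 s :=
    fun n s => mul_comm _ _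
  refine ⟨fun j k => ⟨fun n => sfinite_countOn (hS n), fun n => ?_, hint j k, ?_,
    fun ν ε hε => (key ν ε hε j k).2⟩, hsymm, hform⟩
  · refine measurable_zero.measurable_of_countable_ne ((hS n).mono fun s hs => ?_)
    exact support_spectralDensity (δ n) j k fun h => hs h.symm
  · obtain ⟨C₁, h1⟩ := ((key 0 1 one_pos j j).2).bddAbove_range
    obtain ⟨C₂, h2⟩ := ((key 0 1 one_pos k k).2).bddAbove_range
    simp only [hp1] at h1 h2
    refine ⟨(C₁ + C₂) / 2, fun n => ?_⟩
    have e1 := h1 ⟨n, rfl⟩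
    have e2 := h2 ⟨n, rfl⟩
    have i1 := hint j j n
    have i2 := hint k k n
    have hle : ∫ s, |spectralDensity p q (δ n) j k s| * (1 + s ^ 2)⁻¹ ∂countOn (eigSet p q (δ n)) ≤
        ∫ s, (spectralDensity p q (δ n) j j s * (1 + s ^ 2)⁻¹ +
          spectralDensity p q (δ n) k k s * (1 + s ^ 2)⁻¹) / 2 ∂countOn (eigSet p q (δ n)) := by
      refine integral_mono_of_nonneg (Eventually.of_forall fun s => by positivity)
        ((i1.add i2).div_const 2) (Eventually.of_forall fun s => ?_)
      have h := abs_entry_le (w := fun j k => spectralDensity p q (δ n) j k s) (hsymm n s)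
        (hform n s) j k one_pos
      simp only [inv_one, one_mul] at h
      have h3 := mul_le_mul_of_nonneg_right h (by positivity : 0 ≤ (1 + s ^ 2)⁻¹)
      simp only
      linarith
    rw [integral_div, integral_add i1 i2] at hle
    simp only at e1 e2
    linarith

/-- A real symmetric matrix with nonnegative quadratic form is positive semidefinite over `ℂ`. -/
theorem posSemidef_of_real {M : Matrix (Fin 2) (Fin 2) ℂ} {d : Fin 2 → Fin 2 → ℝ}
    (hM : ∀ j k, M j k = d j k) (hs : d 1 0 = d 0 1)
    (h : ∀ a b, 0 ≤ a ^ 2 * d 0 0 + 2 * (a * b) * d 0 1 + b ^ 2 * d 1 1) : M.PosSemidef := by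
  refine Matrix.PosSemidef.of_dotProduct_mulVec_nonneg ?_ fun x => ?_
  · ext j k
    rw [Matrix.conjTranspose_apply, hM, hM, Complex.star_def, Complex.conj_ofReal]
    fin_cases j <;> fin_cases k
    · rfl
    · exact congrArg _ hs
    · exact congrArg _ hs.symm
    · rfl
  · have h1 := h (x 0).re (x 1).re
    have h2 := h (x 0).im (x 1).im
    have e : star x ⬝ᵥ (M.mulVec x) = (((x 0).re ^ 2 * d 0 0 + 2 * ((x 0).re * (x 1).re) * d 0 1 +
        (x 1).re ^ 2 * d 1 1 + ((x 0).im ^ 2 * d 0 0 + 2 * ((x 0).im * (x 1).im) * d 0 1 +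
        (x 1).im ^ 2 * d 1 1) : ℝ) : ℂ) := by
      simp only [dotProduct, Matrix.mulVec, Fin.sum_univ_two, hM, Pi.star_apply, hs]
      apply Complex.ext <;> simp [pow_two] <;> ring
    rw [e]
    exact_mod_cast add_nonneg h1 h2

end

/-! ### The spectral matrix on the half-line -/

section

variable {p q : ℝ → ℝ} {c : ℝ}

/-- There are problems on intervals exhausting the half-line. -/
theorem exists_exhaustsHalfLine (hc : 0 < c) :
    ∃ δ : ℕ → FiniteProblem c, ExhaustsHalfLine δ ∧ (∀ n, (δ n).a < c) ∧ ∀ n, c < (δ n).b := by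
  have ha : ∀ n : ℕ, c * (1 / ((n : ℝ) + 1 + 1)) < c := fun n =>
    mul_lt_of_lt_one_right hc
      (by rw [div_lt_one (by positivity)]; linarith [n.cast_nonneg (α := ℝ)])
  have hb : ∀ n : ℕ, c < c + ((n : ℝ) + 1) := fun n => by
    have : (0 : ℝ) ≤ n := n.cast_nonneg
    linarith
  refine ⟨fun n => ⟨c * (1 / ((n : ℝ) + 1 + 1)), c + ((n : ℝ) + 1), 0, 0, by positivity, (ha n).le,
    (hb n).le, (ha n).trans (hb n), ⟨le_rfl, Real.pi_pos⟩, ⟨le_rfl, Real.pi_pos⟩⟩, ⟨?_, ?_⟩, ha, hb⟩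
  · have h := (tendsto_one_div_add_atTop_nhds_zero_nat (𝕜 := ℝ)).comp (tendsto_add_atTop_nat 1)
    simpa [Function.comp_def] using h.const_mul c
  · exact tendsto_atTop_add_const_left _ _
      (tendsto_atTop_add_const_right _ _ tendsto_natCast_atTop_atTop)

theorem ExhaustsHalfLine.exists_shift (hc : 0 < c) {δ : ℕ → FiniteProblem c}
    (hδ : ExhaustsHalfLine δ) : ∃ N, ExhaustsHalfLine (fun n => δ (n + N)) ∧
      (∀ n, (δ (n + N)).a < c) ∧ ∀ n, c < (δ (n + N)).b := by
  obtain ⟨N, hN⟩ := eventually_atTop.mp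
    ((hδ.1.eventually (gt_mem_nhds hc)).and (hδ.2.eventually (eventually_gt_atTop c)))
  exact ⟨N, ⟨hδ.1.comp (tendsto_add_atTop_nat N), hδ.2.comp (tendsto_add_atTop_nat N)⟩,
    fun n => (hN _ (Nat.le_add_left N n)).1, fun n => (hN _ (Nat.le_add_left N n)).2⟩

theorem continuousAt_ofReal_iff {f : ℝ → ℝ} {x : ℝ} :
    ContinuousAt (fun s => (f s : ℂ)) x ↔ ContinuousAt f x :=
  ⟨fun h => by simpa [Function.comp_def] using Complex.continuous_re.continuousAt.comp h,
    fun h => Complex.continuous_ofReal.continuousAt.comp h⟩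

/-- Convergence of increments at ordered pairs of points implies it at all pairs. -/
theorem tendsto_sub_of_le {ι : Type*} {F : Filter ι} {φ : ι → ℝ → ℂ} {ρ : ℝ → ℂ} {C : Set ℝ}
    (h : ∀ y ∈ C, ∀ x ∈ C, y ≤ x → Tendsto (fun i => φ i x - φ i y) F (𝓝 (ρ x - ρ y)))
    {x y : ℝ} (hx : x ∈ C) (hy : y ∈ C) :
    Tendsto (fun i => φ i x - φ i y) F (𝓝 (ρ x - ρ y)) := by
  rcases le_total y x with hyx | hyx
  · exact h y hy x hx hyx
  · simpa using (h x hx y hy hyx).neg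

end

end WeylTheory

theorem theorem2p8 (p q : ℝ → ℝ)
    (hp_pos : ∀ r : ℝ, 0 < r → 0 < p r)
    (hp : ContDiffOn ℝ 1 p (Set.Ioi 0))
    (hq : ContinuousOn q (Set.Ioi 0))
    (c : ℝ) (hc : 0 < c)
    (h_zero : WeylTheory.LimitPointAtZero p q)
    (h_infty : WeylTheory.LimitPointAtInfty p q) :
    ∃ m' m : ℂ → ℂ,
      -- the limit points at the origin and at infinity
      (∀ l : ℂ, l.im ≠ 0 →
        WeylTheory.IsWeylLimitPoint p q c l (𝓝[>] 0) (m' l) ∧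
        WeylTheory.IsWeylLimitPoint p q c l atTop (m l) ∧ m' l ≠ m l) ∧
      ∃ ρ : ℝ → Matrix (Fin 2) (Fin 2) ℂ,
        WeylTheory.IsSpectralMatrix ρ ∧
        -- convergence of the finite-interval spectral matrices
        (∀ δ : ℕ → WeylTheory.FiniteProblem c, WeylTheory.ExhaustsHalfLine δ →
          WeylTheory.IsLimitOfFinite p q δ ρ) ∧
        -- essential uniqueness
        (∀ ρ' : ℝ → Matrix (Fin 2) (Fin 2) ℂ, WeylTheory.IsSpectralMatrix ρ' →
          (∃ δ : ℕ → WeylTheory.FiniteProblem c, WeylTheory.ExhaustsHalfLine δ ∧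
            WeylTheory.IsLimitOfFinite p q δ ρ') →
          ∀ (j k : Fin 2) (x y : ℝ),
            ContinuousAt (fun s => ρ s j k) x → ContinuousAt (fun s => ρ s j k) y →
            ContinuousAt (fun s => ρ' s j k) x → ContinuousAt (fun s => ρ' s j k) y →
            ρ' x j k - ρ' y j k = ρ x j k - ρ y j k) ∧
        -- the inversion formula
        (∀ (j k : Fin 2) (x y : ℝ),
          (∀ ε : ℝ, 0 < ε → IntervalIntegrable
            (fun ν : ℝ => (WeylTheory.matrixM (m' (ν + ε * Complex.I))
              (m (ν + ε * Complex.I)) j k).im) volume y x) ∧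
          (ContinuousAt (fun s => ρ s j k) x → ContinuousAt (fun s => ρ s j k) y →
            Tendsto (fun ε : ℝ => (((1 / Real.pi) *
              ∫ ν in y..x, (WeylTheory.matrixM (m' (ν + ε * Complex.I))
                (m (ν + ε * Complex.I)) j k).im : ℝ) : ℂ))
              (𝓝[>] 0) (𝓝 (ρ x j k - ρ y j k)))) := by
  have hC : WeylTheory.Coeffs p q := ⟨hp_pos, hp.continuousOn, hq⟩
  have hex' : ∀ l : ℂ, ∃ m, l.im ≠ 0 →
      WeylTheory.IsWeylLimitPoint p q c l (𝓝[>] 0) m ∧ m.im / l.im < 0 := fun l => by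
    by_cases hl : l.im ≠ 0
    · obtain ⟨m, hm⟩ := WeylTheory.exists_isWeylLimitPoint_zero hC hc h_zero hl
      exact ⟨m, fun _ => hm⟩
    · exact ⟨0, fun h => absurd h hl⟩
  have hex : ∀ l : ℂ, ∃ m, l.im ≠ 0 →
      WeylTheory.IsWeylLimitPoint p q c l atTop m ∧ 0 < m.im / l.im := fun l => by
    by_cases hl : l.im ≠ 0
    · obtain ⟨m, hm⟩ := WeylTheory.exists_isWeylLimitPoint_atTop hC hc h_infty hl
      exact ⟨m, fun _ => hm⟩
    · exact ⟨0, fun h => absurd h hl⟩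
  choose m' hm' using hex'
  choose m hm using hex
  have hne : ∀ l : ℂ, l.im ≠ 0 → m' l ≠ m l := fun l hl h => by
    have h1 := (hm' l hl).2
    rw [h] at h1
    exact lt_asymm h1 (hm l hl).2
  refine ⟨m', m, fun l hl => ⟨(hm' l hl).1, (hm l hl).1, hne l hl⟩, ?_⟩
  have happrox : ∀ δ : ℕ → WeylTheory.FiniteProblem c, _ → _ → _ → _ := fun δ hδ hac hcb =>
    WeylTheory.matrixApprox_of_exhausts hC hc (fun l hl => (hm' l hl).1)
      (fun l hl => (hm l hl).1) hne (δ := δ) hδ hac hcb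
  obtain ⟨δ₀, hδ₀, hac₀, hcb₀⟩ := WeylTheory.exists_exhaustsHalfLine hc
  have h₀ := happrox δ₀ hδ₀ hac₀ hcb₀
  obtain ⟨ρ, hsymm, hmono, hbv, hlim, hinv⟩ := h₀.exists_spectral_function
    (fun ν ε hε => WeylTheory.im_matrixM_det_le (hne _ (by simpa using hε.ne')))
  have hlimit : ∀ δ : ℕ → WeylTheory.FiniteProblem c, WeylTheory.ExhaustsHalfLine δ →
      WeylTheory.IsLimitOfFinite p q δ fun x => Matrix.of fun j k => (ρ j k x : ℂ) := by
    intro δ hδ j k x y hx hy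
    -- `c` may be an endpoint of finitely many of the intervals; these are discarded
    simp only [Matrix.of_apply, WeylTheory.continuousAt_ofReal_iff] at hx hy ⊢
    obtain ⟨N, hN, hac, hcb⟩ := hδ.exists_shift hc
    rw [← tendsto_add_atTop_iff_nat N]
    refine WeylTheory.tendsto_sub_of_le (C := {x | ContinuousAt (ρ j k) x})
      (φ := fun n x => WeylTheory.finiteSpectralMatrix p q (δ (n + N)) x j k)
      (ρ := fun x => (ρ j k x : ℂ)) (fun y hy x hx hyx => ?_) hx hy
    have h := hlim _ _ (happrox _ hN hac hcb) j k y x hyx hx hy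
    rw [← Complex.ofReal_sub]
    refine ((Complex.continuous_ofReal.tendsto _).comp h).congr fun n => ?_
    exact (WeylTheory.finiteSpectralMatrix_sub hC hc _ (hac n) (hcb n) j k hyx).symm
  refine ⟨fun x => Matrix.of fun j k => (ρ j k x : ℂ), ⟨fun x => ?_, fun y x hyx => ?_,
    fun j k => ?_⟩, hlimit, ?_, fun j k x y => ⟨fun ε hε => ?_, fun hx hy => ?_⟩⟩
  · ext j k
    simp only [Matrix.conjTranspose_apply, Matrix.of_apply, Complex.star_def, Complex.conj_ofReal]
    fin_cases j <;> fin_cases k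
    · rfl
    · exact congrArg _ (congrFun hsymm x)
    · exact congrArg _ (congrFun hsymm x).symm
    · rfl
  · refine WeylTheory.posSemidef_of_real (d := fun j k => ρ j k x - ρ j k y)
      (fun j k => ?_) ?_ (hmono y x hyx.le)
    · simp
    · simp only [hsymm]
  · exact (Complex.isometry_ofReal.lipschitz).comp_locallyBoundedVariationOn (hbv j k)
  · rintro ρ' - ⟨δ, hδ, hρ'⟩ j k x y hx hy hx' hy'
    exact tendsto_nhds_unique (hρ' j k x y hx' hy') (hlimit δ hδ j k x y hx hy)
  · exact ⟨((h₀.entry j k).integrableOn hε y x).mono_set Set.Ioc_subset_Icc_self,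
      ((h₀.entry j k).integrableOn hε x y).mono_set Set.Ioc_subset_Icc_self⟩
  · simp only [Matrix.of_apply, WeylTheory.continuousAt_ofReal_iff] at hx hy ⊢
    have h : ∀ y x, y ≤ x → ContinuousAt (ρ j k) x → ContinuousAt (ρ j k) y →
        Tendsto (fun ε : ℝ => (1 / Real.pi) * ∫ ν in y..x, (WeylTheory.matrixM
          (m' (ν + ε * Complex.I)) (m (ν + ε * Complex.I)) j k).im) (𝓝[>] 0)
          (𝓝 (ρ j k x - ρ j k y)) := fun y x hyx hx hy => by
      simp only [intervalIntegral.integral_of_le hyx]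
      exact hinv j k y x hyx hx hy
    rw [← Complex.ofReal_sub]
    refine (Complex.continuous_ofReal.tendsto _).comp ?_
    rcases le_total y x with hyx | hyx
    · exact h y x hyx hx hy
    · have h' := (h x y hyx hy hx).neg
      rw [neg_sub] at h'
      refine h'.congr fun ε => ?_
      rw [intervalIntegral.integral_symm x y]
      ring
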